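/- **Setting.** Consider $\mathbb R^{11}$ with coordinates $x^+,x^-,x^1,\dots,x^9$ and, for $B=\mathrm{diag}(B_1,\dots,B_9)$ real, the Cahen–Wallach metric $g=2dx^+dx^--\sum_iB_i(x^i)^2(dx^-)^2+\sum_i(dx^i)^2$. Let $S=S_-\oplus S_+$ be its irreducible (complex, $32$-dimensional) spinor bundle, with $\Gamma_A\Gamma_B+\Gamma_B\Gamma_A=-2g_{AB}$, with components $\xi=(\xi_1,\xi_2)$, $\Gamma_+:S_+\to S_-$ and $\Gamma_+|_{S_-}=0$, and with charge conjugation $C$ (a skew-symmetric bilinear form for which all $\Gamma_A$ are skew). For $c,d$ in the complexified Clifford algebra of $V=\mathbb R^9$, acting on $S_\pm$ as on two copies of the spinor module of $V$ that are identified by $\Gamma_+$, let $D$ be the connection $$D_+=\nabla_+,\qquad D_-\xi=\nabla_-\xi+(c\,\xi_1,d\,\xi_2),\qquad D_i\xi=\nabla_i\xi-\tfrac12\Gamma_+(c\Gamma_i-\Gamma_id)\xi_2,$$ with $\nabla$ the Levi-Civita connection. Choose $\lambda_i$ with $\lambda_i^2=B_i$ and consider the Killing fields $$K_{(\pm)}=-\partial_\pm,\quad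 K_{(i)}=\cos(\lambda_ix^-)\partial_i+\lambda_i\sin(\lambda_ix^-)x^i\partial_+,\quad K_{(i^*)}=-\lambda_i\sin(\lambda_ix^-)\partial_i+\lambda_i^2\cos(\lambda_ix^-)x^i\partial_+,\quad K_{(ij)}=x^j\partial_i-x^i\partial_j .$$ A *geometric superalgebra* is a pair of a Lie algebra $\mathcal K_0$ of (complexified) Killing fields and a space $\mathcal K_1$ of $D$-parallel spinor fields such that the spinorial Lie derivative $\mathcal L_X\xi=\nabla_X\xi-\Gamma(\nabla X)\xi$ is a representation of $\mathcal K_0$ on $\mathcal K_1$, with a symmetric bilinear map $\{\cdot,\cdot\}:\mathcal K_1\times\mathcal K_1\to\mathcal K_0$ satisfying $2\{\mathcal L_X\xi,\xi\}=[X,\{\xi,\xi\}]$. It is *non-restricted* if $\mathcal K_1$ contains all $D$-parallel spinor fields, and $\nu=\dim\mathcal K_1/\dim S$ (where $\dim S=32$). It gives *geometric supersymmetry* (is a super Lie algebra) if in addition $\mathcal L_{\{\xi,\xi\}}\xi=0$ for all $\xi\in\mathcal K_1$. In both families below $\{1,\dots,9\}$ is divided into blocks; $\mathcal K_0$ is spanned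 by $K_{(\pm)}$, all $K_{(i)},K_{(i^*)}$, and those $K_{(ij)}$ with $i,j$ in the same block; and, with $(\xi_1,\xi_2)$ denoting $\xi$ at the origin, $$\begin{aligned}\{\xi,\xi\}={}&C(\xi_1,\Gamma_-\xi_1)K_{(+)}+C(\xi_2,\Gamma_+\xi_2)K_{(-)}-2\sum_iC(\xi_1,\Gamma_i\xi_2)K_{(i)}\\&+\sum_{i}\tfrac{2i}{\lambda_i}C(\xi_1,\Gamma_{123}\Gamma_i\xi_2)K_{(i^*)}+\tfrac12\sum_{i,j\text{ in one block}}\epsilon_i\, i\lambda_i\,C(\xi_2,\Gamma_+\Gamma_{123}\Gamma_{ij}\xi_2)K_{(ij)},\end{aligned}$$ where $\epsilon_i=1$ for $i\le3$, $\epsilon_i=-1$ for $i\ge4$, the factor $i$ in $\tfrac{2i}{\lambda_i}$ and $i\lambda_i$ is the imaginary unit, and the terms of $K_{(i^*)}$ with $\lambda_i=0$ (where $K_{(i^*)}=0$) are omitted. **Proposition.** (1) Let $\alpha,\beta\in\mathbb C$ be such that $B=-\mathrm{diag}\big((\alpha-\beta)^2\mathbb 1_3,(\alpha+\beta)^2\mathbb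 1_6\big)$ is real (for instance both real or both imaginary), $c=\alpha\Gamma_{123}$, $d=\beta\Gamma_{123}$, $\lambda_i=-i(\alpha-\beta)$ for $i\le3$ and $-i(\alpha+\beta)$ for $i\ge4$, with blocks $\{1,2,3\},\{4,\dots,9\}$, and let $\mathcal K_1$ be the space of all $D$-parallel spinor fields. Then $\mathcal L_{\{\xi,\xi\}}\xi=0$ for all $\xi\in\mathcal K_1$ if and only if $\alpha=-3\beta$; equivalently, the family yields non-restricted geometric supersymmetry with $\nu=1$; equivalently, there is $a\in\mathbb C$ with $$B=-4a^2\,\mathrm{diag}(4\cdot\mathbb 1_3,\mathbb 1_6),\qquad c=-3a\Gamma_{123},\qquad d=a\Gamma_{123}.$$ (2) Let $X^\pm=\tfrac12(1\pm\Gamma_{1245})$ and let $\alpha_+,\alpha_-,\alpha'_+\in\mathbb C$ be such that $$B=-\mathrm{diag}\big((\alpha_--\alpha'_+)^2\mathbb 1_2,(\alpha_+-\alpha'_+)^2,(\alpha_-+\alpha'_+)^2\mathbb 1_2,(\alpha_++\alpha'_+)^2\mathbb 1_4\big)$$ is real, $c=(\alpha_+X^++\alpha_-X^-)\Gamma_{123}$,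 $d=\alpha'_+X^+\Gamma_{123}$, $\lambda_i=-i\mu_i$ with $\mu=(\alpha_--\alpha'_+,\alpha_--\alpha'_+,\alpha_+-\alpha'_+,\alpha_-+\alpha'_+,\alpha_-+\alpha'_+,\alpha_++\alpha'_+,\dots,\alpha_++\alpha'_+)$, with blocks $\{1,2\},\{3\},\{4,5\},\{6,\dots,9\}$, and let $\mathcal K_1$ be the space of all $D$-parallel $\xi$ with $X^-\xi_2=0$ at the origin. Then $\mathcal L_{\{\xi,\xi\}}\xi=0$ for all $\xi\in\mathcal K_1$ if and only if $\alpha_+=-3\alpha'_+$; equivalently, the family yields geometric supersymmetry with $\nu=\tfrac34$, which is moreover non-restricted unless $\alpha_+=\alpha_-=\alpha'_+=0$; equivalently, $$B=-\mathrm{diag}\big((\alpha_--\alpha'_+)^2\mathbb 1_2,16\alpha_+'^2,(\alpha_-+\alpha'_+)^2\mathbb 1_2,4\alpha_+'^2\mathbb 1_4\big),\quad c=(-3\alpha'_+X^++\alpha_-X^-)\Gamma_{123},\quad d=\alpha'_+X^+\Gamma_{123}.$$ -/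

import Mathlib

noncomputable section

namespace CahenWallach

open Matrix Complex
open scoped Kronecker ContDiff

/-! ## Coordinates, metric and Levi-Civita connection -/

/-- Labels `+`, `-`, `1, …, 9` of the eleven coordinates. -/
abbrev Idx : Type := Fin 2 ⊕ Fin 9

/-- The label `+`. -/
abbrev plus : Idx := Sum.inl 0

/-- The label `-`. -/
abbrev minus : Idx := Sum.inl 1

/-- The label of the `i`-th Euclidean direction (counted from `0`). -/
abbrev sp (i : Fin 9) : Idx := Sum.inr i

/-- The underlying manifold `ℝ¹¹` with its global coordinates. -/
abbrev Spacetime : Type := Idx → ℝ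

/-- Complexified vector fields, by their components in the coordinate basis. -/
abbrev VField : Type := Spacetime → Idx → ℂ

/-- The coordinate derivative `∂_A`. -/
def pd {F : Type*} [NormedAddCommGroup F] [NormedSpace ℝ F] (A : Idx) (f : Spacetime → F)
    (x : Spacetime) : F :=
  fderiv ℝ f x (Pi.single A 1)

/-- The Lie bracket of vector fields. -/
def lieBracket (X Y : VField) : VField := fun x A =>
  ∑ E, (X x E * pd E (fun y => Y y A) x - Y x E * pd E (fun y => X y A) x)

/-- The Lorentzian inner product on `ℝ² ⊕ V` in the basis `e₊, e₋, e₁, …, e₉`: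
`⟨e₊, e₋⟩ = 1`, `⟨e_i, e_j⟩ = δ_ij`, all other products vanish. It is its own inverse matrix. -/
def eta : Matrix Idx Idx ℝ :=
  Matrix.fromBlocks !![0, 1; 1, 0] 0 0 1

/-- The Cahen-Wallach metric `2 dx⁺ dx⁻ - ∑ B_i (x^i)² (dx⁻)² + ∑ (dx^i)²` of the diagonal
symmetric map `B`. -/
def metric (B : Fin 9 → ℝ) (x : Spacetime) : Matrix Idx Idx ℝ :=
  eta + Matrix.single minus minus (-∑ i, B i * x (sp i) ^ 2)

/-- The Christoffel symbol `Γ^E_{FG}` of the metric. -/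
def christoffel (B : Fin 9 → ℝ) (x : Spacetime) (E F G : Idx) : ℝ :=
  (1 / 2) * ∑ H, (metric B x)⁻¹ E H *
    (pd F (fun y => metric B y H G) x + pd G (fun y => metric B y H F) x
      - pd H (fun y => metric B y F G) x)

/-- The Levi-Civita covariant derivative `∇_A X`. -/
def covDeriv (B : Fin 9 → ℝ) (A : Idx) (X : VField) : VField := fun x E =>
  pd A (fun y => X y E) x + ∑ F, (christoffel B x E A F : ℂ) * X x F

/-- `X` is a (complexified) Killing vector field: the Lie derivative of the metric vanishes. -/
def IsKilling (B : Fin 9 → ℝ) (X : VField) : Prop :=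
  ∀ x E F, ∑ A, (X x A * (pd A (fun y => metric B y E F) x : ℝ)
    + (metric B x A F : ℂ) * pd E (fun y => X y A) x
    + (metric B x E A : ℂ) * pd F (fun y => X y A) x) = 0

/-- The global null frame `e₊ = ∂₊`, `e₋ = ∂₋ + ½ ∑ B_i (x^i)² ∂₊`, `e_i = ∂_i`, whose products
are given by `eta`. -/
def frame (B : Fin 9 → ℝ) (a : Idx) : VField := fun x A =>
  (if A = a then 1 else 0) +
    (if a = minus ∧ A = plus then ((1 / 2 * ∑ i, B i * x (sp i) ^ 2 : ℝ) : ℂ) else 0)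

/-- The complex bilinear extension of the metric. -/
def metricInner (B : Fin 9 → ℝ) (x : Spacetime) (v w : Idx → ℂ) : ℂ :=
  ∑ E, ∑ F, (metric B x E F : ℂ) * v E * w F

/-! ## Spinors -/

/-- Index set of the sixteen-dimensional spinor space of `V = ℝ⁹`. -/
abbrev SIdx : Type := Fin 2 × Fin 2 × Fin 2 × Fin 2

/-- Nine pairwise anticommuting symmetric integral matrices of square `1`. -/
def gammaInt : Fin 9 → Matrix SIdx SIdx ℤ :=
  let e : Matrix (Fin 2) (Fin 2) ℤ := !![0, 1; -1, 0]
  let s : Matrix (Fin 2) (Fin 2) ℤ := !![0, 1; 1, 0]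
  let t : Matrix (Fin 2) (Fin 2) ℤ := !![1, 0; 0, -1]
  let o : Matrix (Fin 2) (Fin 2) ℤ := 1
  ![e ⊗ₖ (e ⊗ₖ (e ⊗ₖ e)), e ⊗ₖ (o ⊗ₖ (s ⊗ₖ e)), e ⊗ₖ (o ⊗ₖ (t ⊗ₖ e)),
    e ⊗ₖ (s ⊗ₖ (e ⊗ₖ o)), e ⊗ₖ (t ⊗ₖ (e ⊗ₖ o)), e ⊗ₖ (e ⊗ₖ (o ⊗ₖ s)),
    e ⊗ₖ (e ⊗ₖ (o ⊗ₖ t)), s ⊗ₖ (o ⊗ₖ (o ⊗ₖ o)), t ⊗ₖ (o ⊗ₖ (o ⊗ₖ o))]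

/-- Endomorphisms of the spinor space of `V`; all of them come from the complexified Clifford
algebra of `V`, which acts irreducibly. -/
abbrev Cl : Type := Matrix SIdx SIdx ℂ

/-- The action of `e_i` on the spinor space of `V`, with `γ_i γ_j + γ_j γ_i = -2 δ_ij`. -/
def gam (i : Fin 9) : Cl := I • (gammaInt i).map (Int.cast : ℤ → ℂ)

/-- `Γ₁₂₃`. -/
def gam123 : Cl := gam 0 * gam 1 * gam 2

/-- `Γ₁₂₄₅`. -/
def gam1245 : Cl := gam 0 * gam 1 * gam 3 * gam 4

/-- The projection `X⁺₁₂₄₅`. -/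
def Xp : Cl := (1 / 2 : ℂ) • (1 + gam1245)

/-- The projection `X⁻₁₂₄₅`. -/
def Xm : Cl := (1 / 2 : ℂ) • (1 - gam1245)

/-- The thirty-two-dimensional irreducible spinor space `S = S₋ ⊕ S₊`; a spinor is the pair
`(ξ₁, ξ₂)` of its components. Both summands are copies of the spinor module of `V`. -/
abbrev Spinor : Type := (SIdx → ℂ) × (SIdx → ℂ)

/-- The Clifford multiplications `Γ₊`, `Γ₋`, `Γ_i` on `S`. -/
def Gam : Idx → Module.End ℂ Spinor
  | Sum.inl 0 => LinearMap.inl ℂ _ _ ∘ₗ LinearMap.snd ℂ _ _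
  | Sum.inl 1 => (-2 : ℂ) • (LinearMap.inr ℂ _ _ ∘ₗ LinearMap.fst ℂ _ _)
  | Sum.inr i => LinearMap.prodMap (-(Matrix.toLin' (gam i))) (Matrix.toLin' (gam i))

/-- `Γ^a`, the index being raised with `eta`. -/
def GamUp (a : Idx) : Module.End ℂ Spinor := ∑ b, (eta a b : ℂ) • Gam b

/-- The projection `σ₋ = -½ Γ₊ Γ₋` onto `S₋`, the component `ξ₁`. -/
def sigmaMinus : Module.End ℂ Spinor := (-(1 / 2) : ℂ) • (Gam plus * Gam minus)

/-- The projection `σ₊ = -½ Γ₋ Γ₊` onto `S₊`, the component `ξ₂`. -/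
def sigmaPlus : Module.End ℂ Spinor := (-(1 / 2) : ℂ) • (Gam minus * Gam plus)

/-- The action on `S` of an element of the Clifford algebra of `V` through the two copies of its
spinor module. It commutes with `Γ₊` and `Γ₋`. -/
def clAct (c : Cl) : Module.End ℂ Spinor :=
  LinearMap.prodMap (Matrix.toLin' c) (Matrix.toLin' c)

/-- The charge conjugation: the skew-symmetric bilinear form
`C(ξ, η) = C(ξ₁, η₂) - C(η₁, ξ₂)`, for which all Clifford multiplications are skew. -/
def chargeConj (ξ η : Spinor) : ℂ := ξ.1 ⬝ᵥ η.2 - η.1 ⬝ᵥ ξ.2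

/-- The spin representation of `𝔰𝔬(1,10)`: `A`, given by `A_ab = ⟨e_a, A e_b⟩`, acts by
`-¼ ∑ A_ab Γ^a Γ^b`. -/
def spinRep (A : Idx → Idx → ℂ) : Module.End ℂ Spinor :=
  (-(1 / 4) : ℂ) • ∑ a, ∑ b, A a b • (GamUp a * GamUp b)

/-- Spinor fields, by their components in the spin frame over `frame`. -/
abbrev SField : Type := Spacetime → Spinor

/-- The spinorial Levi-Civita connection `∇_A`. -/
def nabla (B : Fin 9 → ℝ) (A : Idx) (ξ : SField) : SField := fun x =>
  pd A ξ x +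
    spinRep (fun a b => metricInner B x (frame B a x) (covDeriv B A (frame B b) x)) (ξ x)

/-- The spinorial Lie derivative `ℒ_X ξ = ∇_X ξ - Γ(∇X) ξ`. -/
def spinLie (B : Fin 9 → ℝ) (X : VField) (ξ : SField) : SField := fun x =>
  ∑ A, X x A • nabla B A ξ x -
    spinRep (fun a b => metricInner B x (frame B a x)
      (∑ A, frame B b x A • covDeriv B A X x)) (ξ x)

/-- `s_{c,d}(e_i) = c Γ_i - Γ_i d`. -/
def sMap (c d : Cl) (i : Fin 9) : Cl := c * gam i - gam i * d

/-- The connection `D` of the pair `(c, d)`. -/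
def connD (B : Fin 9 → ℝ) (c d : Cl) : Idx → SField → SField
  | Sum.inl 0, ξ => nabla B plus ξ
  | Sum.inl 1, ξ => fun x => nabla B minus ξ x
      + clAct c (sigmaMinus (ξ x)) + clAct d (sigmaPlus (ξ x))
  | Sum.inr i, ξ => fun x => nabla B (sp i) ξ x
      - (1 / 2 : ℂ) • Gam plus (clAct (sMap c d i) (sigmaPlus (ξ x)))

theorem connD_add (B : Fin 9 → ℝ) (c d : Cl) (A : Idx) {ξ η : SField} {x : Spacetime}
    (hξ : DifferentiableAt ℝ ξ x) (hη : DifferentiableAt ℝ η x) :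
    connD B c d A (ξ + η) x = connD B c d A ξ x + connD B c d A η x := by
  have h : ∀ A, nabla B A (ξ + η) x = nabla B A ξ x + nabla B A η x := by
    intro A
    simp only [nabla, pd, fderiv_add hξ hη, _root_.add_apply, Pi.add_apply, map_add]
    abel
  rcases A with a | i
  · fin_cases a
    · exact h plus
    · simp only [connD, h, Pi.add_apply, map_add]
      abel
  · simp only [connD, h, Pi.add_apply, map_add, smul_add]
    abel

theorem connD_smul (B : Fin 9 → ℝ) (c d : Cl) (A : Idx) (a : ℂ) {ξ : SField} {x : Spacetime}
    (hξ : DifferentiableAt ℝ ξ x) : connD B c d A (a • ξ) x = a • connD B c d A ξ x := by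
  have h : ∀ A, nabla B A (a • ξ) x = a • nabla B A ξ x := by
    intro A
    simp only [nabla, pd, fderiv_const_smul hξ a, _root_.smul_apply, Pi.smul_apply,
      map_smul, smul_add]
  rcases A with b | i
  · fin_cases b
    · exact h plus
    · simp only [connD, h, Pi.smul_apply, map_smul, smul_add]
  · simp only [connD, h, Pi.smul_apply, map_smul, smul_sub]
    rw [smul_comm]

/-- The space of (smooth) spinor fields that are parallel with respect to `D`. -/
def parallel (B : Fin 9 → ℝ) (c d : Cl) : Submodule ℂ SField where
  carrier := {ξ | ContDiff ℝ ∞ ξ ∧ ∀ A x, connD B c d A ξ x = 0}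
  zero_mem' := by
    refine ⟨contDiff_const, fun A x => ?_⟩
    have h := connD_smul B c d A 0 (ξ := 0) (x := x) (differentiableAt_const 0)
    simpa using h
  add_mem' := by
    rintro ξ η ⟨hξ, hξ'⟩ ⟨hη, hη'⟩
    refine ⟨hξ.add hη, fun A x => ?_⟩
    rw [connD_add B c d A (hξ.differentiable (by simp) x) (hη.differentiable (by simp) x),
      hξ', hη', add_zero]
  smul_mem' := by
    rintro a ξ ⟨hξ, hξ'⟩
    refine ⟨contDiff_const.smul hξ, fun A x => ?_⟩
    rw [connD_smul B c d A a (hξ.differentiable (by simp) x), hξ', smul_zero]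

/-! ## Killing vector fields -/

/-- `K₍₊₎ = -∂₊`. -/
def Kplus : VField := fun _ => Pi.single plus (-1)

/-- `K₍₋₎ = -∂₋`. -/
def Kminus : VField := fun _ => Pi.single minus (-1)

/-- `K₍ᵢ₎ = cos(λᵢ x⁻) ∂ᵢ + λᵢ sin(λᵢ x⁻) xⁱ ∂₊`. -/
def Ksp (lam : Fin 9 → ℂ) (i : Fin 9) : VField := fun x =>
  Pi.single (sp i) (cos (lam i * x minus)) +
    Pi.single plus (lam i * sin (lam i * x minus) * x (sp i))

/-- `K₍ᵢ*₎ = -λᵢ sin(λᵢ x⁻) ∂ᵢ + λᵢ² cos(λᵢ x⁻) xⁱ ∂₊`. -/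
def Kstar (lam : Fin 9 → ℂ) (i : Fin 9) : VField := fun x =>
  Pi.single (sp i) (-lam i * sin (lam i * x minus)) +
    Pi.single plus (lam i ^ 2 * cos (lam i * x minus) * x (sp i))

/-- `K₍ᵢⱼ₎ = xʲ ∂ᵢ - xⁱ ∂ⱼ`. -/
def Krot (i j : Fin 9) : VField := fun x =>
  Pi.single (sp i) (x (sp j) : ℂ) - Pi.single (sp j) (x (sp i) : ℂ)

/-- The even part `𝒦₀`: the span of `K₍₊₎`, `K₍₋₎`, `K₍ᵢ₎`, `K₍ᵢ*₎`, and of the rotations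
`K₍ᵢⱼ₎` for which `i` and `j` belong to the same block. -/
def evenPart (lam : Fin 9 → ℂ) (blk : Fin 9 → Fin 4) : Submodule ℂ VField :=
  Submodule.span ℂ ({Kplus, Kminus} ∪ Set.range (Ksp lam) ∪ Set.range (Kstar lam)
    ∪ {X | ∃ i j, blk i = blk j ∧ X = Krot i j})

/-! ## The odd-odd bracket -/

/-- The antisymmetrized product `Γ_ij`. -/
def Gam2 (i j : Fin 9) : Module.End ℂ Spinor :=
  (1 / 2 : ℂ) • (Gam (sp i) * Gam (sp j) - Gam (sp j) * Gam (sp i))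

/-- `Γ₁₂₃` on `S`. -/
def Gam123 : Module.End ℂ Spinor := Gam (sp 0) * Gam (sp 1) * Gam (sp 2)

/-- The value of `{ξ, ξ}` in terms of the constant spinor `ψ = (ξ₁⁰, ξ₂⁰)`. -/
def bracketQuad (lam : Fin 9 → ℂ) (blk : Fin 9 → Fin 4) (ψ : Spinor) : VField :=
  let ψ₁ := sigmaMinus ψ
  let ψ₂ := sigmaPlus ψ
  chargeConj ψ₁ (Gam minus ψ₁) • Kplus + chargeConj ψ₂ (Gam plus ψ₂) • Kminus
    + ∑ i, (-2 * chargeConj ψ₁ (Gam (sp i) ψ₂)) • Ksp lam i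
    + ∑ i, (2 * I / lam i * chargeConj ψ₁ (Gam123 (Gam (sp i) ψ₂))) • Kstar lam i
    + (1 / 2 : ℂ) • ∑ i, ∑ j,
      if blk i = blk j then
        ((if i < 3 then 1 else -1) * (I * lam i)
          * chargeConj ψ₂ (Gam plus (Gam123 (Gam2 i j ψ₂)))) • Krot i j
      else 0

/-- The bracket `{ξ, η}` by polarization. A parallel spinor field `ξ = ξ(ξ₁⁰, ξ₂⁰)` has the
constant spinor `(ξ₁⁰, ξ₂⁰)` as its value at the origin. -/
def bracket (lam : Fin 9 → ℂ) (blk : Fin 9 → Fin 4) (ξ η : SField) : VField :=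
  (1 / 2 : ℂ) • (bracketQuad lam blk (ξ 0 + η 0) - bracketQuad lam blk (ξ 0)
    - bracketQuad lam blk (η 0))

/-! ## Geometric superalgebras -/

/-- The data of an extension `𝒦₀ ⊕ 𝒦₁`: a diagonal Cahen-Wallach space, a pair `(c, d)`, the even
and the odd part, and the odd-odd bracket. -/
structure SuperData where
  B : Fin 9 → ℝ
  c : Cl
  d : Cl
  even : Submodule ℂ VField
  odd : Submodule ℂ SField
  br : SField → SField → VField

/-- The data form a geometric superalgebra: `𝒦₀` is a Lie algebra of Killing vector fields, `𝒦₁`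
consists of parallel spinor fields, the spinorial Lie derivative is a representation of `𝒦₀` on
`𝒦₁`, and the bracket is a symmetric bilinear map `𝒦₁ × 𝒦₁ → 𝒦₀` with
`2 {ℒ_X ξ, ξ} = [X, {ξ, ξ}]`. -/
def SuperData.IsGeometricSuperalgebra (K : SuperData) : Prop :=
  (∀ X ∈ K.even, ContDiff ℝ ∞ X ∧ IsKilling K.B X) ∧
  (∀ X ∈ K.even, ∀ Y ∈ K.even, lieBracket X Y ∈ K.even) ∧
  K.odd ≤ parallel K.B K.c K.d ∧
  ∃ (L : K.even →ₗ[ℂ] Module.End ℂ K.odd) (b : K.odd →ₗ[ℂ] K.odd →ₗ[ℂ] K.even),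
    (∀ X ξ, (L X ξ : SField) = spinLie K.B X ξ) ∧
    (∀ X Y Z : K.even, (Z : VField) = lieBracket X Y → L X * L Y - L Y * L X = L Z) ∧
    (∀ ξ η, (b ξ η : VField) = K.br ξ η) ∧
    (∀ ξ η, b ξ η = b η ξ) ∧
    (∀ X ξ, (2 : ℂ) • (b (L X ξ) ξ : VField) = lieBracket X (b ξ ξ))

/-- The cubic condition `ℒ_{ξ,ξ} ξ = 0` for all `ξ ∈ 𝒦₁`. -/
def SuperData.Cubic (K : SuperData) : Prop :=
  ∀ ξ ∈ K.odd, spinLie K.B (K.br ξ ξ) ξ = 0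

/-- Geometric supersymmetry: a geometric superalgebra that is a super Lie algebra. -/
def SuperData.IsSupersymmetry (K : SuperData) : Prop :=
  K.IsGeometricSuperalgebra ∧ K.Cubic

/-- The odd part contains all parallel spinor fields. -/
def SuperData.NonRestricted (K : SuperData) : Prop :=
  parallel K.B K.c K.d ≤ K.odd

/-- The quotient `ν` of the dimensions of `𝒦₁` and of `S`. -/
def SuperData.nu (K : SuperData) : ℚ :=
  (Module.finrank ℂ K.odd : ℚ) / Module.finrank ℂ Spinor

/-! ## The two families -/

/-- `μ_i = i λ_i` for the first family. -/
def mu1 (α β : ℂ) (i : Fin 9) : ℂ := if i < 3 then α - β else α + β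

/-- The first family; `B = -diag((α - β)² 1₃, (α + β)² 1₆)` is imposed where it is used. -/
def family1 (α β : ℂ) (B : Fin 9 → ℝ) : SuperData where
  B := B
  c := α • gam123
  d := β • gam123
  even := evenPart (fun i => -I * mu1 α β i) ![0, 0, 0, 1, 1, 1, 1, 1, 1]
  odd := parallel B (α • gam123) (β • gam123)
  br := bracket (fun i => -I * mu1 α β i) ![0, 0, 0, 1, 1, 1, 1, 1, 1]

/-- `μ_i = i λ_i` for the second family, with parameters `p = α₊`, `m = α₋`, `q = α'₊`. -/
def mu2 (p m q : ℂ) : Fin 9 → ℂ :=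
  ![m - q, m - q, p - q, m + q, m + q, p + q, p + q, p + q, p + q]

/-- The spinor fields `ξ` with `X⁻₁₂₄₅ ξ₂⁰ = 0`. -/
def chiral : Submodule ℂ SField where
  carrier := {ξ | clAct Xm (sigmaPlus (ξ 0)) = 0}
  zero_mem' := by simp
  add_mem' := by
    intro ξ η hξ hη
    simp only [Set.mem_ofPred_eq, Pi.add_apply, map_add] at *
    rw [hξ, hη, add_zero]
  smul_mem' := by
    intro a ξ hξ
    simp only [Set.mem_ofPred_eq, Pi.smul_apply, map_smul] at *
    rw [hξ, smul_zero]

/-- The second family. -/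
def family2 (p m q : ℂ) (B : Fin 9 → ℝ) : SuperData where
  B := B
  c := (p • Xp + m • Xm) * gam123
  d := (q • Xp) * gam123
  even := evenPart (fun i => -I * mu2 p m q i) ![0, 0, 1, 2, 2, 3, 3, 3, 3]
  odd := parallel B ((p • Xp + m • Xm) * gam123) ((q • Xp) * gam123) ⊓ chiral
  br := bracket (fun i => -I * mu2 p m q i) ![0, 0, 1, 2, 2, 3, 3, 3, 3]

end CahenWallach

end

set_option linter.unusedSimpArgs false

noncomputable section

namespace CahenWallach

open Matrix Complex
open scoped Kronecker ContDiff

/-! ## The algebra of the gamma matrices -/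

/-! Everything is transported to the values at the origin. Being parallel means that ξ₂ evolves by
exp(-x⁻d), and that ξ₁ is exp(-x⁻c) applied to a constant plus ½ ∑ xⁱ s_i ξ₂, where s_i = cΓ_i - Γ_i
d. Such a field solves all equations as soon as c s_i - s_i d = -B_i Γ_i on the admitted ξ₂. In both
families s_i = μ_i Γ₁₂₃Γ_i there, c commutes with Γ₁₂₃, and μ_i² = -B_i, which yields this relation
(`Admissible.c_s_mulVec`). Hence `sol` parametrizes the odd part by constant spinors whose second
component is fixed by a projection `Pr`: the identity in the first family, X⁺ in the second.

The Killing fields are coded by tuples (a, b, u, v, W), where (u, v) are initial data of oscillators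
of frequencies λ_i and W is a block-diagonal rotation. In these terms the Lie bracket becomes
`bracketParam`, the spinorial Lie derivative becomes the action `rep` on constant spinors
(`Admissible.spinLie_sol`), and the odd bracket becomes the bilinear map `pol`. The axioms of a
geometric superalgebra turn into gamma matrix identities, which are proved for both families at once
from the conditions collected in `Admissible`. The central one is the equivariance `two_pol_rep`. It
rests on the skewness of c and d, on λ being constant on blocks, and on the vanishing of (w,
Γ_iΓ₁₂₃Γ_j w) when i and j lie in different blocks. So both families are geometric superalgebras for
all admitted parameters, and only the cubic condition remains to be decided.

By `AdmissibleData.cubic_iff` that condition says that `rep` of `pol` ψ ψ annihilates ψ. On a single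
basis spinor one coordinate of this expression is, up to a nonzero factor, α + 3β or α₊ + 3α'₊,
which proves necessity. Conversely, at this ratio both components vanish identically: these are
Fierz identities, cubic in the coordinates of the spinor, and they are verified in an explicit model
of the gamma matrices with entries 0 and ±i.

The odd parts have dimensions 32 and 16 + 8 = 24. Non-restrictedness of the second family comes from
the equality of mixed derivatives of a parallel field. Followed by X⁻, it gives (B_i + α₋²) Γ_i X⁻ξ₂
= 0 for i = 3 and i = 6, and the two coefficients vanish together only if α₋ = α'₊ = 0. -/

/-- A fourfold Kronecker product of two by two matrices. -/
def kron4 (a b c d : Matrix (Fin 2) (Fin 2) ℂ) : Cl := a ⊗ₖ (b ⊗ₖ (c ⊗ₖ d))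

/-- The rotation by a right angle. -/
def mE : Matrix (Fin 2) (Fin 2) ℂ := !![0, 1; -1, 0]

/-- The exchange of the two coordinates. -/
def mS : Matrix (Fin 2) (Fin 2) ℂ := !![0, 1; 1, 0]

/-- The reflection in the first axis. -/
def mT : Matrix (Fin 2) (Fin 2) ℂ := !![1, 0; 0, -1]

theorem mE_mE : mE * mE = -1 := by
  ext i j; fin_cases i <;> fin_cases j <;> simp [mE]
theorem mS_mS : mS * mS = 1 := by
  ext i j; fin_cases i <;> fin_cases j <;> simp [mS]
theorem mT_mT : mT * mT = 1 := by
  ext i j; fin_cases i <;> fin_cases j <;> simp [mT]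
theorem mE_mS : mE * mS = mT := by
  ext i j; fin_cases i <;> fin_cases j <;> simp [mE, mS, mT]
theorem mS_mE : mS * mE = -mT := by
  ext i j; fin_cases i <;> fin_cases j <;> simp [mE, mS, mT]
theorem mE_mT : mE * mT = -mS := by
  ext i j; fin_cases i <;> fin_cases j <;> simp [mE, mS, mT]
theorem mT_mE : mT * mE = mS := by
  ext i j; fin_cases i <;> fin_cases j <;> simp [mE, mS, mT]
theorem mS_mT : mS * mT = -mE := by
  ext i j; fin_cases i <;> fin_cases j <;> simp [mE, mS, mT]
theorem mT_mS : mT * mS = mE := by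
  ext i j; fin_cases i <;> fin_cases j <;> simp [mE, mS, mT]
theorem mE_transpose : mEᵀ = -mE := by
  ext i j; fin_cases i <;> fin_cases j <;> simp [mE]
theorem mS_transpose : mSᵀ = mS := by
  ext i j; fin_cases i <;> fin_cases j <;> simp [mS]
theorem mT_transpose : mTᵀ = mT := by
  ext i j; fin_cases i <;> fin_cases j <;> simp [mT]

theorem kron4_mul (a b c d a' b' c' d' : Matrix (Fin 2) (Fin 2) ℂ) :
    kron4 a b c d * kron4 a' b' c' d' = kron4 (a * a') (b * b') (c * c') (d * d') := by
  simp only [kron4, Matrix.mul_kronecker_mul]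

theorem kron4_transpose (a b c d : Matrix (Fin 2) (Fin 2) ℂ) :
    (kron4 a b c d)ᵀ = kron4 aᵀ bᵀ cᵀ dᵀ := by
  ext ⟨i, j, k, l⟩ ⟨i', j', k', l'⟩; rfl

theorem kron4_neg₁ (a b c d : Matrix (Fin 2) (Fin 2) ℂ) :
    kron4 (-a) b c d = -kron4 a b c d := by
  ext ⟨i, j, k, l⟩ ⟨i', j', k', l'⟩; simp [kron4]
theorem kron4_neg₂ (a b c d : Matrix (Fin 2) (Fin 2) ℂ) :
    kron4 a (-b) c d = -kron4 a b c d := by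
  ext ⟨i, j, k, l⟩ ⟨i', j', k', l'⟩; simp [kron4]
theorem kron4_neg₃ (a b c d : Matrix (Fin 2) (Fin 2) ℂ) :
    kron4 a b (-c) d = -kron4 a b c d := by
  ext ⟨i, j, k, l⟩ ⟨i', j', k', l'⟩; simp [kron4]
theorem kron4_neg₄ (a b c d : Matrix (Fin 2) (Fin 2) ℂ) :
    kron4 a b c (-d) = -kron4 a b c d := by
  ext ⟨i, j, k, l⟩ ⟨i', j', k', l'⟩; simp [kron4]
theorem kron4_one : kron4 1 1 1 1 = 1 := by
  simp [kron4]

/-- With complex Kronecker factors, every Clifford relation reduces to the multiplication table of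
the three two by two matrices, since `kron4` is multiplicative and signs can be pulled out of each
factor. -/
theorem gam_eq_kron4 (i : Fin 9) : gam i = I • (![kron4 mE mE mE mE, kron4 mE 1 mS mE,
    kron4 mE 1 mT mE, kron4 mE mS mE 1, kron4 mE mT mE 1, kron4 mE mE 1 mS, kron4 mE mE 1 mT,
    kron4 mS 1 1 1, kron4 mT 1 1 1] : Fin 9 → Cl) i := by
  have hE : mE = (!![0, 1; -1, 0] : Matrix (Fin 2) (Fin 2) ℤ).map (Int.castRingHom ℂ) := by
    ext i j; fin_cases i <;> fin_cases j <;> simp [mE]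
  have hS : mS = (!![0, 1; 1, 0] : Matrix (Fin 2) (Fin 2) ℤ).map (Int.castRingHom ℂ) := by
    ext i j; fin_cases i <;> fin_cases j <;> simp [mS]
  have hT : mT = (!![1, 0; 0, -1] : Matrix (Fin 2) (Fin 2) ℤ).map (Int.castRingHom ℂ) := by
    ext i j; fin_cases i <;> fin_cases j <;> simp [mT]
  have h1 : (1 : Matrix (Fin 2) (Fin 2) ℂ)
      = (1 : Matrix (Fin 2) (Fin 2) ℤ).map (Int.castRingHom ℂ) := by simp
  have hk : ∀ a b c d : Matrix (Fin 2) (Fin 2) ℤ,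
      kron4 (a.map (Int.castRingHom ℂ)) (b.map (Int.castRingHom ℂ)) (c.map (Int.castRingHom ℂ))
        (d.map (Int.castRingHom ℂ)) = (a ⊗ₖ (b ⊗ₖ (c ⊗ₖ d))).map (Int.cast : ℤ → ℂ) := by
    intro a b c d
    ext ⟨i, j, k, l⟩ ⟨i', j', k', l'⟩
    simp [kron4]
  rw [gam, hE, hS, hT, h1]
  simp only [hk]
  congr 1
  fin_cases i <;> rfl

theorem gam_mul_self (i : Fin 9) : gam i * gam i = -1 := by
  fin_cases i <;>
  simp [gam_eq_kron4, kron4_mul, mE_mE, mS_mS, mT_mT, kron4_neg₁, kron4_neg₂, kron4_neg₃,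
    kron4_neg₄, kron4_one, smul_smul]

theorem gam_anticomm {i j : Fin 9} (h : i ≠ j) : gam i * gam j = -(gam j * gam i) := by
  revert h
  fin_cases i <;> fin_cases j <;>
  simp [gam_eq_kron4, kron4_mul, mE_mE, mS_mS, mT_mT, mE_mS, mS_mE, mE_mT, mT_mE, mS_mT, mT_mS,
    kron4_neg₁, kron4_neg₂, kron4_neg₃, kron4_neg₄, kron4_one, smul_smul]

theorem gam_transpose (i : Fin 9) : (gam i)ᵀ = gam i := by
  fin_cases i <;>
  simp [gam_eq_kron4, kron4_transpose, mE_transpose, mS_transpose, mT_transpose, kron4_neg₁,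
    kron4_neg₂, kron4_neg₃, kron4_neg₄]

theorem gam123_eq : gam123 = -I • kron4 mE mE 1 mE := by
  simp [gam123, gam_eq_kron4, kron4_mul, mE_mE, mS_mS, mT_mT, mE_mS, mS_mE, mE_mT, mT_mE, mS_mT,
    mT_mS, kron4_neg₁, kron4_neg₂, kron4_neg₃, kron4_neg₄, kron4_one, smul_smul]

theorem gam1245_eq : gam1245 = kron4 1 1 mT 1 := by
  simp [gam1245, gam_eq_kron4, kron4_mul, mE_mE, mS_mS, mT_mT, mE_mS, mS_mE, mE_mT, mT_mE, mS_mT,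
    mT_mS, kron4_neg₁, kron4_neg₂, kron4_neg₃, kron4_neg₄, kron4_one, smul_smul]

theorem gam123_mul_self : gam123 * gam123 = 1 := by
  simp [gam123_eq, kron4_mul, mE_mE, kron4_neg₁, kron4_neg₂, kron4_neg₄, kron4_one, smul_smul]

theorem gam123_transpose : gam123ᵀ = -gam123 := by
  simp [gam123_eq, kron4_transpose, mE_transpose, kron4_neg₁, kron4_neg₂, kron4_neg₄]

/-- The sign with which `Γ_i` commutes with `Γ₁₂₃`. -/
def eps (i : Fin 9) : ℂ := if i < 3 then 1 else -1

/-- Γ_i anticommutes with every factor of Γ₁₂₃ other than itself: two sign changes if it occurs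
there, three otherwise. -/
theorem gam123_mul_gam (i : Fin 9) : gam123 * gam i = eps i • (gam i * gam123) := by
  fin_cases i <;>
  simp [eps, gam123_eq, gam_eq_kron4, kron4_mul, mE_mE, mS_mS, mT_mT, mE_mS, mS_mE, mE_mT, mT_mE,
    mS_mT, mT_mS, kron4_neg₁, kron4_neg₂, kron4_neg₃, kron4_neg₄, kron4_one, smul_smul]

theorem gam1245_mul_self : gam1245 * gam1245 = 1 := by
  simp [gam1245_eq, kron4_mul, mT_mT, kron4_one]

theorem gam1245_transpose : gam1245ᵀ = gam1245 := by
  simp [gam1245_eq, kron4_transpose, mT_transpose]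

theorem gam1245_comm_gam123 : gam1245 * gam123 = gam123 * gam1245 := by
  simp [gam123_eq, gam1245_eq, kron4_mul]

/-- The sign with which `Γ_i` commutes with `Γ₁₂₄₅`. -/
def eta1245 : Fin 9 → ℂ := ![-1, -1, 1, -1, -1, 1, 1, 1, 1]

/-- Moving Γ_i through Γ₁₂₄₅ costs three sign changes if it is one of the four factors, and four
otherwise. -/
theorem gam1245_mul_gam (i : Fin 9) : gam1245 * gam i = eta1245 i • (gam i * gam1245) := by
  fin_cases i <;>
  simp [eta1245, gam1245_eq, gam_eq_kron4, kron4_mul, mE_mS, mS_mE, mE_mT, mT_mE,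
    mS_mT, mT_mS, mE_mE, mS_mS, mT_mT, kron4_neg₁, kron4_neg₂, kron4_neg₃, kron4_neg₄, smul_smul]

/-! ### Gamma matrices acting on the coordinates of a spinor -/

theorem kron4_mulVec (a b c d : Matrix (Fin 2) (Fin 2) ℂ) (ψ : SIdx → ℂ) (k : SIdx) :
    (kron4 a b c d *ᵥ ψ) k = ∑ w, ∑ x, ∑ y, ∑ z,
      a k.1 w * b k.2.1 x * c k.2.2.1 y * d k.2.2.2 z * ψ (w, x, y, z) := by
  simp only [Matrix.mulVec, dotProduct, Fintype.sum_prod_type, kron4, kroneckerMap_apply]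
  simp only [mul_assoc]

theorem dotProduct_eq (ψ φ : SIdx → ℂ) :
    ψ ⬝ᵥ φ = ∑ w, ∑ x, ∑ y, ∑ z, ψ (w, x, y, z) * φ (w, x, y, z) := by
  simp only [dotProduct, Fintype.sum_prod_type]

/-- The sign `1` of `0` and `-1` of `1`. -/
def sgn (a : Fin 2) : ℂ := if a = 0 then 1 else -1

/-- A factor `mS` flips its index, `mT` contributes the sign of its index, and `mE` does both. Each
Γ_i is therefore a signed permutation of coordinates times i, which is what makes the Fierz
identities computable. -/
theorem gam_mulVec (i : Fin 9) (ψ : SIdx → ℂ) (a b c d : Fin 2) : (gam i *ᵥ ψ) (a, b, c, d) =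
  (![I * (sgn a * sgn b * sgn c * sgn d * ψ (1 - a, 1 - b, 1 - c, 1 - d)),
     I * (sgn a * sgn d * ψ (1 - a, b, 1 - c, 1 - d)),
     I * (sgn a * sgn c * sgn d * ψ (1 - a, b, c, 1 - d)),
     I * (sgn a * sgn c * ψ (1 - a, 1 - b, 1 - c, d)),
     I * (sgn a * sgn b * sgn c * ψ (1 - a, b, 1 - c, d)),
     I * (sgn a * sgn b * ψ (1 - a, 1 - b, c, 1 - d)),
     I * (sgn a * sgn b * sgn d * ψ (1 - a, 1 - b, c, d)),
     I * ψ (1 - a, b, c, d),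
     I * (sgn a * ψ (a, b, c, d))] : Fin 9 → ℂ) i := by
  fin_cases i <;> simp [gam_eq_kron4, smul_mulVec, kron4_mulVec] <;>
  fin_cases a <;> fin_cases b <;> fin_cases c <;> fin_cases d <;>
  simp [mE, mS, mT, Fin.sum_univ_two, sgn, Matrix.one_apply]

theorem gam123_mulVec (ψ : SIdx → ℂ) (a b c d : Fin 2) : (gam123 *ᵥ ψ) (a, b, c, d) =
     -I * (sgn a * sgn b * sgn d * ψ (1 - a, 1 - b, c, 1 - d)) := by
  simp only [gam123_eq, smul_mulVec, neg_mulVec, kron4_mulVec, Pi.smul_apply, Pi.neg_apply]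
  fin_cases a <;> fin_cases b <;> fin_cases c <;> fin_cases d <;>
  simp [mE, mS, mT, Fin.sum_univ_two, sgn, Matrix.one_apply]

/-! ## Coordinate derivatives -/

section Derivatives

variable {F : Type*} [NormedAddCommGroup F] [NormedSpace ℝ F] {x : Spacetime} (A : Idx)

theorem pd_const (v : F) : pd A (fun _ => v) x = 0 := by
  simp [pd]

theorem pd_add {f g : Spacetime → F} (hf : DifferentiableAt ℝ f x) (hg : DifferentiableAt ℝ g x) :
    pd A (fun y => f y + g y) x = pd A f x + pd A g x := by
  simp only [pd]
  rw [fderiv_fun_add hf hg]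
  rfl

theorem pd_sub {f g : Spacetime → F} (hf : DifferentiableAt ℝ f x) (hg : DifferentiableAt ℝ g x) :
    pd A (fun y => f y - g y) x = pd A f x - pd A g x := by
  simp only [pd]
  rw [fderiv_fun_sub hf hg]
  rfl

theorem pd_neg {f : Spacetime → F} : pd A (fun y => -f y) x = -pd A f x := by
  simp only [pd]
  rw [fderiv_fun_neg]
  rfl

theorem pd_sum {ι : Type*} (u : Finset ι) {f : ι → Spacetime → F}
    (hf : ∀ i ∈ u, DifferentiableAt ℝ (f i) x) :
    pd A (fun y => ∑ i ∈ u, f i y) x = ∑ i ∈ u, pd A (f i) x := by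
  simp only [pd]
  rw [fderiv_fun_sum hf]
  simp

theorem pd_mul {R : Type*} [NormedCommRing R] [NormedAlgebra ℝ R] {f g : Spacetime → R}
    (hf : DifferentiableAt ℝ f x) (hg : DifferentiableAt ℝ g x) :
    pd A (fun y => f y * g y) x = f x * pd A g x + pd A f x * g x := by
  simp only [pd]
  rw [fderiv_fun_mul hf hg]
  simp [mul_comm]

theorem pd_smul [NormedSpace ℂ F] {f : Spacetime → ℂ} {g : Spacetime → F}
    (hf : DifferentiableAt ℝ f x) (hg : DifferentiableAt ℝ g x) :
    pd A (fun y => f y • g y) x = f x • pd A g x + pd A f x • g x := by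
  simp only [pd]
  rw [fderiv_fun_smul hf hg]
  simp

theorem pd_clm {G : Type*} [NormedAddCommGroup G] [NormedSpace ℝ G] (L : F →L[ℝ] G)
    {f : Spacetime → F} (hf : DifferentiableAt ℝ f x) :
    pd A (fun y => L (f y)) x = L (pd A f x) := by
  simp only [pd]
  have := (L.hasFDerivAt.comp x hf.hasFDerivAt).fderiv
  simp only [Function.comp_def] at this
  rw [this]
  rfl

theorem hasFDerivAt_coord (E : Idx) :
    HasFDerivAt (fun y : Spacetime => y E) (ContinuousLinearMap.proj (R := ℝ) E) x :=
  (ContinuousLinearMap.proj (R := ℝ) (φ := fun _ : Idx => ℝ) E).hasFDerivAt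

theorem pd_time {g : ℝ → F} {g' : F} (hg : HasDerivAt g g' (x minus)) :
    pd A (fun y => g (y minus)) x = if A = minus then g' else 0 := by
  simp only [pd]
  have h := hg.hasFDerivAt.comp x (hasFDerivAt_coord (x := x) minus)
  simp only [Function.comp_def] at h
  rw [h.fderiv]
  rcases A with a | i
  · fin_cases a <;> simp
  · simp

theorem pd_coord (E : Idx) : pd A (fun y : Spacetime => y E) x = if E = A then 1 else 0 := by
  simp only [pd]
  rw [(hasFDerivAt_coord E).fderiv]
  simp [Pi.single_apply]

theorem pd_coord_complex (E : Idx) :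
    pd A (fun y : Spacetime => (y E : ℂ)) x = if E = A then 1 else 0 := by
  have := pd_clm (x := x) A Complex.ofRealCLM (hasFDerivAt_coord E).differentiableAt
  simp only [Complex.ofRealCLM_apply] at this
  rw [this, pd_coord]
  split_ifs <;> simp

theorem differentiableAt_coord_complex (E : Idx) :
    DifferentiableAt ℝ (fun y : Spacetime => (y E : ℂ)) x :=
  (Complex.ofRealCLM.hasFDerivAt.comp x (hasFDerivAt_coord E)).differentiableAt

theorem differentiableAt_time {g : ℝ → F} (hg : DifferentiableAt ℝ g (x minus)) :
    DifferentiableAt ℝ (fun y : Spacetime => g (y minus)) x :=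
  hg.comp (f := fun y : Spacetime => y minus) x (hasFDerivAt_coord minus).differentiableAt

end Derivatives

/-! ## The Levi-Civita connection -/

theorem sum_idx {M : Type*} [AddCommMonoid M] (f : Idx → M) :
    ∑ A, f A = f plus + f minus + ∑ i, f (sp i) := by
  rw [Fintype.sum_sum_type, Fin.sum_univ_two]

theorem eta_apply (E F : Idx) : eta E F =
    (match E, F with
      | Sum.inl a, Sum.inl b => if a = b then 0 else 1
      | Sum.inr i, Sum.inr j => if i = j then 1 else 0
      | _, _ => 0) := by
  rcases E with a | i <;> rcases F with b | j
  · fin_cases a <;> fin_cases b <;> simp [eta]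
  · simp [eta]
  · simp [eta]
  · simp [eta, Matrix.one_apply]

theorem metric_apply (B : Fin 9 → ℝ) (x : Spacetime) (E F : Idx) : metric B x E F =
    eta E F + if E = minus ∧ F = minus then -∑ i, B i * x (sp i) ^ 2 else 0 := by
  simp only [metric, Matrix.add_apply, Matrix.single_apply]
  congr 2
  simp [eq_comm]

/-- The metric is η + N with N supported on the null direction dx⁻, so NηN = 0 and the inverse is η
- ηNη. -/
theorem metric_inv (B : Fin 9 → ℝ) (x : Spacetime) :
    (metric B x)⁻¹ = eta + Matrix.single plus plus (∑ i, B i * x (sp i) ^ 2) := by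
  apply Matrix.inv_eq_right_inv
  ext E F
  rw [Matrix.mul_apply, sum_idx]
  simp only [metric_apply, Matrix.add_apply, Matrix.single_apply]
  rcases E with a | i <;> rcases F with b | j
  · fin_cases a <;> fin_cases b <;> simp [eta_apply]
  · fin_cases a <;> simp [eta_apply]
  · fin_cases b <;> simp [eta_apply]
  · simp [eta_apply, Matrix.one_apply]

theorem pd_metric (B : Fin 9 → ℝ) (x : Spacetime) (A E F : Idx) :
    pd A (fun y => metric B y E F) x =
      if E = minus ∧ F = minus then -2 * Sum.elim (0 : Fin 2 → ℝ) (fun i => B i * x (sp i)) A else 0 := by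
  simp only [metric_apply]
  by_cases h : E = minus ∧ F = minus
  · simp only [h, and_self, if_true]
    have hc : ∀ E : Idx, DifferentiableAt ℝ (fun y : Spacetime => y E) x :=
      fun E => (hasFDerivAt_coord E).differentiableAt
    have hd : ∀ i : Fin 9, DifferentiableAt ℝ (fun y : Spacetime => B i * y (sp i) ^ 2) x :=
      fun i => ((hc _).pow 2).const_mul _
    rw [pd_add A (differentiableAt_const _) (DifferentiableAt.fun_sum fun i _ => hd i).fun_neg, pd_neg,
      pd_sum A _ (fun i _ => hd i), pd_const]
    have h2 : ∀ i, pd A (fun y : Spacetime => B i * y (sp i) ^ 2) x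
        = B i * (2 * x (sp i) * if sp i = A then 1 else 0) := by
      intro i
      simp only [sq]
      rw [pd_mul A (differentiableAt_const _) ((hc _).fun_mul (hc _)), pd_mul A (hc _) (hc _),
        pd_coord, pd_const]
      ring
    simp only [h2]
    rcases A with a | i
    · simp
    · simp; ring
  · simp only [h, if_false, pd_const]

/-- The only nonzero derivatives of the metric are ∂_i g₋₋ = -2B_i xⁱ, which leaves Γ⁺₋ᵢ = Γ⁺ᵢ₋ and
Γⁱ₋₋. -/
theorem christoffel_eq (B : Fin 9 → ℝ) (x : Spacetime) (E F G : Idx) : christoffel B x E F G =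
    (match E, F, G with
      | Sum.inl 0, Sum.inl 1, Sum.inr i => -(B i * x (sp i))
      | Sum.inl 0, Sum.inr i, Sum.inl 1 => -(B i * x (sp i))
      | Sum.inr i, Sum.inl 1, Sum.inl 1 => B i * x (sp i)
      | _, _, _ => 0) := by
  simp only [christoffel, metric_inv, pd_metric, sum_idx, Matrix.add_apply, Matrix.single_apply]
  rcases E with a | i <;> rcases F with b | j <;> rcases G with c | k
  all_goals try fin_cases a
  all_goals try fin_cases b
  all_goals try fin_cases c
  all_goals simp [eta_apply]

theorem covDeriv_plus (B : Fin 9 → ℝ) (X : VField) (x : Spacetime) (E : Idx) :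
    covDeriv B plus X x E = pd plus (fun y => X y E) x := by
  simp only [covDeriv, sum_idx, christoffel_eq]
  rcases E with a | i
  · fin_cases a <;> simp
  · simp

theorem covDeriv_minus (B : Fin 9 → ℝ) (X : VField) (x : Spacetime) (E : Idx) :
    covDeriv B minus X x E = pd minus (fun y => X y E) x +
      (match E with
        | Sum.inl 0 => -∑ i, (B i * x (sp i) : ℂ) * X x (sp i)
        | Sum.inl 1 => 0
        | Sum.inr i => (B i * x (sp i) : ℂ) * X x minus) := by
  simp only [covDeriv, sum_idx, christoffel_eq]
  rcases E with a | i
  · fin_cases a <;> simp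
  · simp

theorem covDeriv_sp (B : Fin 9 → ℝ) (j : Fin 9) (X : VField) (x : Spacetime) (E : Idx) :
    covDeriv B (sp j) X x E = pd (sp j) (fun y => X y E) x +
      (if E = plus then -(B j * x (sp j) : ℂ) * X x minus else 0) := by
  simp only [covDeriv, sum_idx, christoffel_eq]
  rcases E with a | i
  · fin_cases a <;> simp
  · simp

theorem metricInner_frame (B : Fin 9 → ℝ) (x : Spacetime) (w : Idx → ℂ) (a : Idx) :
    metricInner B x (frame B a x) w =
      (match a with
        | Sum.inl 0 => w minus
        | Sum.inl 1 => w plus - (1 / 2) * (∑ i, B i * x (sp i) ^ 2 : ℝ) * w minus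
        | Sum.inr i => w (sp i)) := by
  simp only [metricInner, frame, metric_apply, sum_idx]
  rcases a with a | i
  · fin_cases a
    · simp [eta_apply]
    · simp [eta_apply]; ring
  · simp [eta_apply, apply_ite Complex.ofReal]

/-! ## The spinor connection and the spinorial Lie derivative -/

theorem Gam_plus_apply (ψ : Spinor) : Gam plus ψ = (ψ.2, 0) := by
  simp [Gam]

theorem Gam_minus_apply (ψ : Spinor) : Gam minus ψ = (0, (-2 : ℂ) • ψ.1) := by
  simp [Gam]

theorem Gam_sp_apply (i : Fin 9) (ψ : Spinor) :
    Gam (sp i) ψ = (-(gam i *ᵥ ψ.1), gam i *ᵥ ψ.2) := by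
  simp [Gam]

theorem sigmaMinus_apply (ψ : Spinor) : sigmaMinus ψ = (ψ.1, 0) := by
  simp [sigmaMinus, Module.End.mul_apply, Gam_plus_apply, Gam_minus_apply, smul_smul]

theorem sigmaPlus_apply (ψ : Spinor) : sigmaPlus ψ = (0, ψ.2) := by
  simp [sigmaPlus, Module.End.mul_apply, Gam_plus_apply, Gam_minus_apply, smul_smul]

theorem clAct_apply (c : Cl) (ψ : Spinor) : clAct c ψ = (c *ᵥ ψ.1, c *ᵥ ψ.2) := by
  simp [clAct]

theorem GamUp_minus : GamUp minus = Gam plus := by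
  simp [GamUp, sum_idx, eta_apply]

theorem GamUp_sp (i : Fin 9) : GamUp (sp i) = Gam (sp i) := by
  simp [GamUp, sum_idx, eta_apply, apply_ite Complex.ofReal]

/-- The spin representation `¼ ∑ W_ij γ_i γ_j` of an infinitesimal rotation of `V`. -/
def rot (W : Matrix (Fin 9) (Fin 9) ℂ) : Cl :=
  (1 / 4 : ℂ) • ∑ i, ∑ j, W i j • (gam i * gam j)

/-- The hypotheses express that A annihilates the null vector e₊, so A consists of a rotation of V
and a null rotation. Then Γ⁺ = Γ₋ never occurs, and the action is block triangular with respect to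
S₋ ⊕ S₊. -/
theorem spinRep_apply {A : Idx → Idx → ℂ} (h₁ : ∀ a, A plus a = 0) (h₂ : ∀ a, A a plus = 0)
    (h₃ : A minus minus = 0) (h₄ : ∀ i, A minus (sp i) = -A (sp i) minus) (ψ : Spinor) :
    spinRep A ψ = (-(rot (fun i j => A (sp i) (sp j)) *ᵥ ψ.1)
        + (1 / 2 : ℂ) • ∑ i, A (sp i) minus • (gam i *ᵥ ψ.2),
      -(rot (fun i j => A (sp i) (sp j)) *ᵥ ψ.2)) := by
  simp only [spinRep, sum_idx, h₁, h₂, h₃, h₄, GamUp_minus, GamUp_sp, rot, zero_smul, zero_add,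
    add_zero, Finset.sum_const_zero, LinearMap.smul_apply, LinearMap.add_apply,
    LinearMap.sum_apply, Module.End.mul_apply, Gam_plus_apply, Gam_sp_apply, Finset.sum_add_distrib,
    smul_mulVec, Matrix.sum_mulVec, ← Matrix.mulVec_mulVec]
  refine Prod.ext ?_ ?_
  · simp only [Prod.fst_neg, Prod.smul_fst, Prod.fst_add, Prod.fst_sum, mulVec_neg, neg_neg, Prod.smul_mk,
      mulVec_zero, smul_neg, neg_smul, Finset.sum_neg_distrib]
    module
  · simp only [Prod.smul_snd, Prod.snd_add, Prod.snd_sum, mulVec_zero, smul_zero,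
      Finset.sum_const_zero, zero_add]
    exact neg_smul _ _

theorem pd_frame (B : Fin 9 → ℝ) (A b E : Idx) (x : Spacetime) :
    pd A (fun y => frame B b y E) x = if b = minus ∧ E = plus then
      ((Sum.elim (0 : Fin 2 → ℝ) (fun i => B i * x (sp i)) A : ℝ) : ℂ) else 0 := by
  -- The ∂₊ coefficient of e₋ is -½ g₋₋, so its derivative is already known from `pd_metric`.
  have hm : ∀ y, frame B b y E = (if E = b then 1 else 0) + if b = minus ∧ E = plus then
      -(1 / 2 : ℂ) * Complex.ofRealCLM (metric B y minus minus) else 0 := by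
    intro y
    simp only [frame, metric_apply, eta_apply, Complex.ofRealCLM_apply]
    congr 2
    simp
  have hd : DifferentiableAt ℝ (fun y => metric B y minus minus) x := by
    simp only [metric_apply]
    refine (differentiableAt_const _).add ?_
    simp only [and_self, if_true]
    exact (DifferentiableAt.fun_sum fun i _ =>
      ((hasFDerivAt_coord (sp i)).differentiableAt.pow 2).const_mul _).fun_neg
  simp only [hm]
  by_cases h : b = minus ∧ E = plus
  · simp only [h, and_self, if_true]
    have hd' := Complex.ofRealCLM.differentiableAt.comp x hd
    simp only [Function.comp_def] at hd'
    rw [pd_add A (differentiableAt_const _) (hd'.const_mul _), pd_const,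
      pd_mul A (differentiableAt_const _) hd', pd_clm A Complex.ofRealCLM hd, pd_metric, pd_const]
    simp
  · simp only [h, if_false, pd_const]

/-- Along ∂_i the derivative of the ∂₊ coefficient of e₋ cancels the Christoffel symbol Γ⁺ᵢ₋. The
frame therefore rotates only along ∂₋, and the spinor connection is the ordinary derivative in all
other directions. -/
theorem covDeriv_frame (B : Fin 9 → ℝ) (A b : Idx) (x : Spacetime) :
    covDeriv B A (frame B b) x =
      (match A, b with
        | Sum.inl 1, Sum.inl 1 =>
          fun E => Sum.elim (0 : Fin 2 → ℂ) (fun i => (B i * x (sp i) : ℂ)) E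
        | Sum.inl 1, Sum.inr i => Pi.single plus (-(B i * x (sp i) : ℂ))
        | _, _ => 0) := by
  ext E
  rcases A with a | k
  · fin_cases a
    · refine (covDeriv_plus B _ x E).trans ?_
      rw [pd_frame]
      simp
    · refine (covDeriv_minus B _ x E).trans ?_
      rw [pd_frame]
      rcases b with b | j
      · fin_cases b <;> rcases E with e | i
        · fin_cases e <;> simp [frame]
        · simp [frame]
        · fin_cases e <;> simp [frame]
        · simp [frame]
      · rcases E with e | i
        · fin_cases e <;> simp [frame]
        · simp [frame]
  · refine (covDeriv_sp B k _ x E).trans ?_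
    rw [pd_frame]
    rcases b with b | j
    · fin_cases b <;> rcases E with e | i
      · fin_cases e <;> simp [frame]
      · simp [frame]
      · fin_cases e <;> simp [frame]
      · simp [frame]
    · rcases E with e | i
      · fin_cases e <;> simp [frame]
      · simp [frame]

theorem spinRep_zero : spinRep (fun _ _ => 0) = 0 := by
  simp [spinRep]

theorem metricInner_zero (B : Fin 9 → ℝ) (x : Spacetime) (v : Idx → ℂ) :
    metricInner B x v 0 = 0 := by
  simp [metricInner]

theorem nabla_plus (B : Fin 9 → ℝ) (ξ : SField) (x : Spacetime) :
    nabla B plus ξ x = pd plus ξ x := by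
  simp [nabla, covDeriv_frame, metricInner_zero, spinRep_zero]

theorem nabla_sp (B : Fin 9 → ℝ) (i : Fin 9) (ξ : SField) (x : Spacetime) :
    nabla B (sp i) ξ x = pd (sp i) ξ x := by
  simp [nabla, covDeriv_frame, metricInner_zero, spinRep_zero]

theorem rot_zero : rot 0 = 0 := by
  simp [rot]

theorem nabla_minus (B : Fin 9 → ℝ) (ξ : SField) (x : Spacetime) :
    nabla B minus ξ x = pd minus ξ x +
      ((1 / 2 : ℂ) • ∑ i, (B i * x (sp i) : ℂ) • (gam i *ᵥ (ξ x).2), 0) := by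
  rw [nabla]
  congr 1
  rw [spinRep_apply]
  · have : rot (fun i j => metricInner B x (frame B (sp i) x)
        (covDeriv B minus (frame B (sp j)) x)) = 0 := by
      rw [← rot_zero]
      congr 1
      ext i j
      simp [covDeriv_frame, metricInner_frame]
    rw [this]
    simp [covDeriv_frame, metricInner_frame]
  · intro a
    rcases a with a | i
    · fin_cases a <;> simp [covDeriv_frame, metricInner_frame]
    · simp [covDeriv_frame, metricInner_frame]
  · intro a
    rcases a with a | i
    · fin_cases a <;> simp [covDeriv_frame, metricInner_frame]
    · simp [covDeriv_frame, metricInner_frame]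
  · simp [covDeriv_frame, metricInner_frame]
  · intro i
    simp [covDeriv_frame, metricInner_frame]

/-! ## A parametrization of the Killing vector fields -/

/-- Parameters `(a, b, u, v, W)` of the vector fields
`a K₍₊₎ + b K₍₋₎ + ∑ u_i K₍ᵢ₎ + ∑ v_i λ_i⁻¹ K₍ᵢ*₎ + ½ ∑ W_ij K₍ᵢⱼ₎`. -/
abbrev Param : Type := ℂ × ℂ × (Fin 9 → ℂ) × (Fin 9 → ℂ) × Matrix (Fin 9) (Fin 9) ℂ

namespace Param

/-- The coefficient of `K₍₊₎`. -/
def a (P : Param) : ℂ := P.1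

/-- The coefficient of `K₍₋₎`. -/
def b (P : Param) : ℂ := P.2.1

/-- The coefficients of `K₍ᵢ₎`. -/
def u (P : Param) : Fin 9 → ℂ := P.2.2.1

/-- The coefficients of `λ_i⁻¹ K₍ᵢ*₎`. -/
def v (P : Param) : Fin 9 → ℂ := P.2.2.2.1

/-- The infinitesimal rotation. -/
def W (P : Param) : Matrix (Fin 9) (Fin 9) ℂ := P.2.2.2.2

variable (P Q : Param) (z p q : ℂ) (w y : Fin 9 → ℂ) (Z : Matrix (Fin 9) (Fin 9) ℂ)

@[simp] theorem a_add : (P + Q).a = P.a + Q.a := rfl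
@[simp] theorem b_add : (P + Q).b = P.b + Q.b := rfl
@[simp] theorem u_add : (P + Q).u = P.u + Q.u := rfl
@[simp] theorem v_add : (P + Q).v = P.v + Q.v := rfl
@[simp] theorem W_add : (P + Q).W = P.W + Q.W := rfl
@[simp] theorem a_smul : (z • P).a = z • P.a := rfl
@[simp] theorem b_smul : (z • P).b = z • P.b := rfl
@[simp] theorem u_smul : (z • P).u = z • P.u := rfl
@[simp] theorem v_smul : (z • P).v = z • P.v := rfl
@[simp] theorem W_smul : (z • P).W = z • P.W := rfl
@[simp] theorem W_zero : (0 : Param).W = 0 := rfl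
@[simp] theorem a_mk : Param.a (p, q, w, y, Z) = p := rfl
@[simp] theorem b_mk : Param.b (p, q, w, y, Z) = q := rfl
@[simp] theorem u_mk : Param.u (p, q, w, y, Z) = w := rfl
@[simp] theorem v_mk : Param.v (p, q, w, y, Z) = y := rfl
@[simp] theorem W_mk : Param.W (p, q, w, y, Z) = Z := rfl

end Param

variable (lam : Fin 9 → ℂ)

/-- The solution `u_i cos (λ_i t) - v_i sin (λ_i t)` of the oscillator equation. -/
def osc (P : Param) (i : Fin 9) (t : ℝ) : ℂ :=
  P.u i * cos (lam i * t) - P.v i * sin (lam i * t)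

/-- The derivative of `osc`. -/
def oscDeriv (P : Param) (i : Fin 9) (t : ℝ) : ℂ :=
  -lam i * (P.u i * sin (lam i * t) + P.v i * cos (lam i * t))

theorem hasDerivAt_cos_mul (l : ℂ) (t : ℝ) :
    HasDerivAt (fun s : ℝ => cos (l * s)) (-l * sin (l * t)) t := by
  have h : HasDerivAt (fun s : ℝ => l * (s : ℂ)) l t := by
    simpa using (Complex.ofRealCLM.hasDerivAt (x := t)).const_mul l
  have := (Complex.hasDerivAt_cos _).comp t h
  exact this.congr_deriv (by ring)

theorem hasDerivAt_sin_mul (l : ℂ) (t : ℝ) :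
    HasDerivAt (fun s : ℝ => sin (l * s)) (l * cos (l * t)) t := by
  have h : HasDerivAt (fun s : ℝ => l * (s : ℂ)) l t := by
    simpa using (Complex.ofRealCLM.hasDerivAt (x := t)).const_mul l
  have := (Complex.hasDerivAt_sin _).comp t h
  exact this.congr_deriv (by ring)

theorem hasDerivAt_osc (P : Param) (i : Fin 9) (t : ℝ) :
    HasDerivAt (osc lam P i) (oscDeriv lam P i t) t := by
  have := ((hasDerivAt_cos_mul (lam i) t).const_mul (P.u i)).sub
    ((hasDerivAt_sin_mul (lam i) t).const_mul (P.v i))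
  exact this.congr_deriv (by simp only [oscDeriv]; ring)

theorem hasDerivAt_oscDeriv (P : Param) (i : Fin 9) (t : ℝ) :
    HasDerivAt (oscDeriv lam P i) (-lam i ^ 2 * osc lam P i t) t := by
  have := (((hasDerivAt_sin_mul (lam i) t).const_mul (P.u i)).add
    ((hasDerivAt_cos_mul (lam i) t).const_mul (P.v i))).const_mul (-lam i)
  exact this.congr_deriv (by simp only [osc]; ring)

theorem contDiff_cos_mul (l : ℂ) : ContDiff ℝ ∞ (fun s : ℝ => cos (l * s)) :=
  (Complex.contDiff_cos.restrict_scalars ℝ).comp (contDiff_const.mul Complex.ofRealCLM.contDiff)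

theorem contDiff_sin_mul (l : ℂ) : ContDiff ℝ ∞ (fun s : ℝ => sin (l * s)) :=
  (Complex.contDiff_sin.restrict_scalars ℝ).comp (contDiff_const.mul Complex.ofRealCLM.contDiff)

theorem contDiff_osc (P : Param) (i : Fin 9) : ContDiff ℝ ∞ (osc lam P i) :=
  (contDiff_const.mul (contDiff_cos_mul _)).sub (contDiff_const.mul (contDiff_sin_mul _))

theorem contDiff_oscDeriv (P : Param) (i : Fin 9) : ContDiff ℝ ∞ (oscDeriv lam P i) :=
  contDiff_const.mul
    ((contDiff_const.mul (contDiff_sin_mul _)).add (contDiff_const.mul (contDiff_cos_mul _)))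

/-- The vector field with the given parameters. -/
def kfield (P : Param) : VField := fun x A =>
  match A with
  | Sum.inl 0 => -P.a - ∑ i, oscDeriv lam P i (x minus) * x (sp i)
  | Sum.inl 1 => -P.b
  | Sum.inr i => osc lam P i (x minus) + ∑ j, P.W i j * x (sp j)

theorem kfield_add (P Q : Param) : kfield lam (P + Q) = kfield lam P + kfield lam Q := by
  ext x A
  rcases A with c | i
  · fin_cases c
    · simp only [kfield, oscDeriv, Pi.add_apply, Param.a_add, Param.b_add, Param.u_add,
        Param.v_add, Param.W_add]
      have : ∀ f g : Fin 9 → ℂ, ∀ p q : ℂ, -p - ∑ i, f i + (-q - ∑ i, g i) =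
          -(p + q) - ∑ i, (f i + g i) := by
        intro f g p q
        rw [Finset.sum_add_distrib]
        ring
      simp only [Fin.zero_eta, this]
      congr 1
      exact Finset.sum_congr rfl fun i _ => by ring
    · simp [kfield]
      ring
  · simp only [kfield, osc, Pi.add_apply, Param.a_add, Param.b_add, Param.u_add,
      Param.v_add, Param.W_add, Matrix.add_apply, add_mul,
      Finset.sum_add_distrib]
    ring

theorem kfield_smul (z : ℂ) (P : Param) : kfield lam (z • P) = z • kfield lam P := by
  ext x A
  rcases A with c | i
  · fin_cases c
    · simp only [kfield, oscDeriv, Pi.smul_apply, Param.a_smul, Param.b_smul, Param.u_smul,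
        Param.v_smul,
      Param.W_smul, smul_eq_mul,
        Fin.zero_eta, mul_sub, Finset.mul_sum]
      congr 1
      · ring
      · exact Finset.sum_congr rfl fun i _ => by ring
    · simp [kfield]
  · simp only [kfield, osc, Pi.smul_apply, Param.a_smul, Param.b_smul, Param.u_smul, Param.v_smul,
      Param.W_smul, smul_eq_mul,
        Matrix.smul_apply, mul_add, Finset.mul_sum]
    congr 1
    · ring
    · exact Finset.sum_congr rfl fun i _ => by ring

/-- `kfield` as a linear map. -/
def kfieldₗ : Param →ₗ[ℂ] VField where
  toFun := kfield lam
  map_add' := kfield_add lam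
  map_smul' := kfield_smul lam

/-- Parameters whose infinitesimal rotation preserves the blocks. -/
def blockParam (blk : Fin 9 → Fin 4) : Submodule ℂ Param where
  carrier := {P | (∀ i j, P.W j i = -P.W i j) ∧ ∀ i j, blk i ≠ blk j → P.W i j = 0}
  zero_mem' := by simp
  add_mem' := by
    rintro P Q ⟨hP, hP'⟩ ⟨hQ, hQ'⟩
    refine ⟨fun i j => ?_, fun i j h => ?_⟩
    · simp only [Param.W_add, Matrix.add_apply, hP i j, hQ i j]
      ring
    · simp [hP' i j h, hQ' i j h]
  smul_mem' := by
    rintro z P ⟨hP, hP'⟩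
    refine ⟨fun i j => ?_, fun i j h => ?_⟩
    · simp [hP i j]
    · simp [hP' i j h]

theorem Kplus_eq : Kplus = kfield lam (1, 0, 0, 0, 0) := by
  ext x A
  rcases A with c | i
  · fin_cases c <;> simp [Kplus, kfield, oscDeriv]
  · simp [Kplus, kfield, osc]

theorem Kminus_eq : Kminus = kfield lam (0, 1, 0, 0, 0) := by
  ext x A
  rcases A with c | i
  · fin_cases c <;> simp [Kminus, kfield, oscDeriv]
  · simp [Kminus, kfield, osc]

theorem Ksp_eq (i : Fin 9) : Ksp lam i = kfield lam (0, 0, Pi.single i 1, 0, 0) := by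
  ext x A
  rcases A with c | j
  · fin_cases c <;> simp [Ksp, kfield, oscDeriv, Pi.single_apply]
  · simp only [Ksp, kfield, osc, Pi.single_apply, Pi.add_apply]
    by_cases h : j = i <;> simp [h]

theorem Kstar_eq (i : Fin 9) :
    Kstar lam i = lam i • kfield lam (0, 0, 0, Pi.single i 1, 0) := by
  ext x A
  rcases A with c | j
  · fin_cases c
    · simp [Kstar, kfield, oscDeriv, Pi.single_apply]
      ring
    · simp [Kstar, kfield, oscDeriv, Pi.single_apply]
  · simp only [Kstar, kfield, osc, Pi.single_apply, Pi.add_apply, Pi.smul_apply]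
    by_cases h : j = i <;> simp [h]

theorem Krot_eq (i j : Fin 9) : Krot i j =
    kfield lam (0, 0, 0, 0, Matrix.single i j 1 - Matrix.single j i 1) := by
  ext x A
  rcases A with c | k
  · fin_cases c <;> simp [Krot, kfield, oscDeriv]
  · simp [Krot, kfield, osc, sub_mul, Matrix.single_apply, Pi.single_apply,
      ite_and, eq_comm]

/-- If λ_i = 0, the field on the left vanishes because it is built from sin 0 and a factor λ_i, and
the right side vanishes because 0⁻¹ = 0. This matches the convention that such terms are omitted
from the odd bracket. -/
theorem single_v_eq (i : Fin 9) :
    kfield lam (0, 0, 0, Pi.single i 1, 0) = (lam i)⁻¹ • Kstar lam i := by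
  rw [Kstar_eq, smul_smul]
  by_cases h : lam i = 0
  · ext x A
    rcases A with c | j
    · fin_cases c <;> simp [kfield, oscDeriv, Pi.single_apply, h]
    · by_cases hj : j = i <;> simp [kfield, osc, h, hj]
  · rw [inv_mul_cancel₀ h, one_smul]

/-- The factor ½ accounts for the double sum meeting each rotation plane twice, with equal
contributions as W is skew. -/
theorem param_eq_sum (P : Param) (hP : ∀ i j, P.W j i = -P.W i j) :
    P = P.a • ((1, 0, 0, 0, 0) : Param) + P.b • ((0, 1, 0, 0, 0) : Param)
      + ∑ i, P.u i • ((0, 0, Pi.single i 1, 0, 0) : Param)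
      + ∑ i, P.v i • ((0, 0, 0, Pi.single i 1, 0) : Param)
      + (1 / 2 : ℂ) • ∑ i, ∑ j, P.W i j •
        ((0, 0, 0, 0, Matrix.single i j 1 - Matrix.single j i 1) : Param) := by
  refine Prod.ext ?_ (Prod.ext ?_ (Prod.ext ?_ (Prod.ext ?_ ?_)))
  · simp [Prod.fst_sum, Param.a]
  · simp [Prod.fst_sum, Prod.snd_sum, Param.b]
  · ext k
    simp [Prod.fst_sum, Prod.snd_sum, Pi.single_apply, Param.u]
  · ext k
    simp [Prod.fst_sum, Prod.snd_sum, Pi.single_apply, Param.v]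
  · ext k l
    change P.W k l = _
    simp [Prod.fst_sum, Prod.snd_sum, Matrix.sum_apply, Matrix.single_apply, mul_sub,
      Finset.sum_sub_distrib, ite_and, hP k l]
    ring

/-- This replaces the span of the generators by a linear image of parameters, so that closure under
brackets and linearity can be checked on parameters. -/
theorem evenPart_eq (blk : Fin 9 → Fin 4) :
    evenPart lam blk = (blockParam blk).map (kfieldₗ lam) := by
  apply le_antisymm
  · rw [evenPart, Submodule.span_le]
    have h0 : ∀ P : Param, P.W = 0 → kfield lam P ∈ (blockParam blk).map (kfieldₗ lam) :=
      fun P hP => ⟨P, ⟨by simp [hP], by simp [hP]⟩, rfl⟩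
    rintro X (((hX | ⟨i, rfl⟩) | ⟨i, rfl⟩) | ⟨i, j, hij, rfl⟩)
    · rcases hX with rfl | rfl
      · rw [Kplus_eq lam]; exact h0 _ rfl
      · rw [Kminus_eq lam]; exact h0 _ rfl
    · rw [Ksp_eq lam]; exact h0 _ rfl
    · rw [Kstar_eq lam]; exact Submodule.smul_mem _ _ (h0 _ rfl)
    · rw [Krot_eq lam]
      refine ⟨_, ⟨fun k l => ?_, fun k l hkl => ?_⟩, rfl⟩
      · simp [Matrix.single_apply, and_comm]
      · have h1 : ¬ (i = k ∧ j = l) := by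
          rintro ⟨rfl, rfl⟩; exact hkl hij
        have h2 : ¬ (j = k ∧ i = l) := by
          rintro ⟨rfl, rfl⟩; exact hkl hij.symm
        simp [Matrix.single_apply, h1, h2]
  · rintro _ ⟨P, ⟨hP, hP'⟩, rfl⟩
    have hg : ∀ X ∈ ({Kplus, Kminus} ∪ Set.range (Ksp lam) ∪ Set.range (Kstar lam)
        ∪ {X | ∃ i j, blk i = blk j ∧ X = Krot i j} : Set VField), X ∈ evenPart lam blk :=
      fun X hX => Submodule.subset_span hX
    rw [param_eq_sum P hP]
    simp only [map_add, map_sum, map_smul]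
    refine Submodule.add_mem _ (Submodule.add_mem _ (Submodule.add_mem _ (Submodule.add_mem _
      (Submodule.smul_mem _ _ ?_) (Submodule.smul_mem _ _ ?_))
      (Submodule.sum_mem _ fun i _ => Submodule.smul_mem _ _ ?_))
      (Submodule.sum_mem _ fun i _ => Submodule.smul_mem _ _ ?_))
      (Submodule.smul_mem _ _ (Submodule.sum_mem _ fun i _ => Submodule.sum_mem _ fun j _ => ?_))
    · exact hg _ (by simp [← Kplus_eq lam, kfieldₗ])
    · exact hg _ (by simp [← Kminus_eq lam, kfieldₗ])
    · exact hg _ (by simp [← Ksp_eq lam, kfieldₗ])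
    · simp only [kfieldₗ, LinearMap.coe_mk, AddHom.coe_mk, single_v_eq]
      exact Submodule.smul_mem _ _ (hg _ (by simp))
    · by_cases hij : blk i = blk j
      · refine Submodule.smul_mem _ _ (hg _ (Or.inr ⟨i, j, hij, (Krot_eq lam i j).symm⟩))
      · rw [hP' i j hij, zero_smul]
        exact Submodule.zero_mem _

/-! ## The geometry of the fields `kfield` -/

section KField

variable (lam : Fin 9 → ℂ)

theorem contDiff_kfield (P : Param) : ContDiff ℝ ∞ (kfield lam P) := by
  have hc : ∀ E : Idx, ContDiff ℝ ∞ (fun y : Spacetime => y E) := fun E => contDiff_apply ℝ ℝ E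
  have hcc : ∀ E : Idx, ContDiff ℝ ∞ (fun y : Spacetime => (y E : ℂ)) :=
    fun E => Complex.ofRealCLM.contDiff.comp (hc E)
  refine contDiff_pi.2 fun A => ?_
  rcases A with a | i
  · fin_cases a
    · exact contDiff_const.sub (ContDiff.sum fun i _ =>
        ((contDiff_oscDeriv lam P i).comp (hc minus)).mul (hcc (sp i)))
    · exact contDiff_const
  · exact ((contDiff_osc lam P i).comp (hc minus)).add
      (ContDiff.sum fun j _ => contDiff_const.mul (hcc (sp j)))

theorem pd_kfield (P : Param) (A E : Idx) (x : Spacetime) :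
    pd A (fun y => kfield lam P y E) x =
      (match E, A with
        | Sum.inl 0, Sum.inl 1 => ∑ i, lam i ^ 2 * osc lam P i (x minus) * x (sp i)
        | Sum.inl 0, Sum.inr j => -oscDeriv lam P j (x minus)
        | Sum.inr i, Sum.inl 1 => oscDeriv lam P i (x minus)
        | Sum.inr i, Sum.inr j => P.W i j
        | _, _ => 0) := by
  rcases E with e | i
  · fin_cases e
    · simp only [kfield, Fin.zero_eta]
      have h1 : ∀ i, DifferentiableAt ℝ (fun y : Spacetime => oscDeriv lam P i (y minus)) x :=
        fun i => differentiableAt_time (hasDerivAt_oscDeriv lam P i _).differentiableAt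
      have h2 : ∀ i, DifferentiableAt ℝ
          (fun y : Spacetime => oscDeriv lam P i (y minus) * y (sp i)) x :=
        fun i => (h1 i).fun_mul (differentiableAt_coord_complex _)
      rw [pd_sub A (differentiableAt_const _) (DifferentiableAt.fun_sum fun i _ => h2 i), pd_const,
        pd_sum A _ fun i _ => h2 i]
      simp only [pd_mul A (h1 _) (differentiableAt_coord_complex _), pd_coord_complex,
        pd_time A (hasDerivAt_oscDeriv lam P _ _)]
      rcases A with a | j
      · fin_cases a <;> simp
      · simp
    · simp only [kfield, Fin.mk_one, pd_const]
  · simp only [kfield]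
    have h2 : ∀ j, DifferentiableAt ℝ (fun y : Spacetime => P.W i j * y (sp j)) x :=
        fun j => (differentiableAt_coord_complex _).const_mul _
    rw [pd_add A (differentiableAt_time (hasDerivAt_osc lam P i _).differentiableAt)
        (DifferentiableAt.fun_sum fun j _ => h2 j), pd_sum A _ fun j _ => h2 j,
        pd_time A (hasDerivAt_osc lam P i _)]
    simp only [pd_mul A (differentiableAt_const _) (differentiableAt_coord_complex _),
      pd_coord_complex, pd_const]
    rcases A with a | j
    · fin_cases a <;> simp
    · simp

variable {lam} {blk : Fin 9 → Fin 4} {B : Fin 9 → ℝ}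

/-- If the diagonal matrix of k commutes with the skew matrix W, their product is skew, and the
quadratic form of a skew matrix is zero. -/
theorem sum_skew_eq_zero {P : Param} (hW : ∀ i j, P.W j i = -P.W i j) {k : Fin 9 → ℂ}
    (hk : ∀ i j, k i * P.W i j = k j * P.W i j) (y : Fin 9 → ℂ) :
    ∑ i, k i * y i * ∑ j, P.W i j * y j = 0 := by
  have h : ∑ i, k i * y i * ∑ j, P.W i j * y j = -∑ i, k i * y i * ∑ j, P.W i j * y j := by
    simp only [Finset.mul_sum]
    conv_lhs => rw [Finset.sum_comm]
    rw [← Finset.sum_neg_distrib]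
    refine Finset.sum_congr rfl fun i _ => ?_
    rw [← Finset.sum_neg_distrib]
    refine Finset.sum_congr rfl fun j _ => ?_
    rw [hW i j]
    linear_combination (y i * y j) * hk i j
  exact self_eq_neg.1 h

/-- Since λ is constant on blocks and W is block diagonal, W commutes with every function of λ, in
particular with the oscillator evolution. -/
theorem mul_W_comm (hlam : ∀ i j, blk i = blk j → lam i = lam j) {P : Param}
    (hP : P ∈ blockParam blk) (f : ℂ → ℂ) (i j : Fin 9) :
    f (lam i) * P.W i j = f (lam j) * P.W i j := by
  by_cases h : blk i = blk j
  · rw [hlam i j h]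
  · rw [hP.2 i j h, mul_zero, mul_zero]

/-- The parameters of the Lie bracket. -/
def bracketParam (lam : Fin 9 → ℂ) (P Q : Param) : Param :=
  (∑ i, lam i * (P.v i * Q.u i - P.u i * Q.v i), 0,
    fun i => P.b * lam i * Q.v i - Q.b * lam i * P.v i
      + ∑ j, Q.W i j * P.u j - ∑ j, P.W i j * Q.u j,
    fun i => Q.b * lam i * P.u i - P.b * lam i * Q.u i
      + ∑ j, Q.W i j * P.v j - ∑ j, P.W i j * Q.v j,
    Q.W * P.W - P.W * Q.W)

theorem bracketParam_mem {P Q : Param} (hP : P ∈ blockParam blk) (hQ : Q ∈ blockParam blk) :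
    bracketParam lam P Q ∈ blockParam blk := by
  refine ⟨fun i j => ?_, fun i j h => ?_⟩
  · simp only [bracketParam, Param.W_mk, Matrix.sub_apply, Matrix.mul_apply]
    rw [← Finset.sum_sub_distrib, ← Finset.sum_sub_distrib, ← Finset.sum_neg_distrib]
    refine Finset.sum_congr rfl fun k _ => ?_
    rw [hP.1 k j, hP.1 i k, hQ.1 k j, hQ.1 i k]
    ring
  · simp only [bracketParam, Param.W_mk, Matrix.sub_apply, Matrix.mul_apply]
    rw [← Finset.sum_sub_distrib]
    refine Finset.sum_eq_zero fun k _ => ?_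
    by_cases hk : blk i = blk k
    · rw [hP.2 k j (hk ▸ h), hQ.2 k j (hk ▸ h)]
      ring
    · rw [hP.2 i k hk, hQ.2 i k hk]
      ring

/-- Solutions of the oscillator equations are stable under time differentiation and under W, so the
bracket acts on them through their initial data alone. -/
theorem osc_bracketParam (hlam : ∀ i j, blk i = blk j → lam i = lam j) {P Q : Param}
    (hP : P ∈ blockParam blk) (hQ : Q ∈ blockParam blk) (i : Fin 9) (t : ℝ) :
    osc lam (bracketParam lam P Q) i t = -P.b * oscDeriv lam Q i t + Q.b * oscDeriv lam P i t
      + ∑ j, Q.W i j * osc lam P j t - ∑ j, P.W i j * osc lam Q j t := by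
  have hPc := mul_W_comm hlam hP (fun z => cos (z * t)) i
  have hPs := mul_W_comm hlam hP (fun z => sin (z * t)) i
  have hQc := mul_W_comm hlam hQ (fun z => cos (z * t)) i
  have hQs := mul_W_comm hlam hQ (fun z => sin (z * t)) i
  have h : ∀ R S : Param, (∀ j, cos (lam i * t) * R.W i j = cos (lam j * t) * R.W i j) →
      (∀ j, sin (lam i * t) * R.W i j = sin (lam j * t) * R.W i j) →
      ∑ j, R.W i j * osc lam S j t = (∑ j, R.W i j * S.u j) * cos (lam i * t)
        - (∑ j, R.W i j * S.v j) * sin (lam i * t) := by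
    intro R S hc hs
    rw [Finset.sum_mul, Finset.sum_mul, ← Finset.sum_sub_distrib]
    refine Finset.sum_congr rfl fun j _ => ?_
    simp only [osc]
    linear_combination (-S.u j) * hc j + S.v j * hs j
  rw [h Q P hQc hQs, h P Q hPc hPs]
  simp only [osc, oscDeriv, bracketParam, Param.u_mk, Param.v_mk]
  ring

/-- Differentiate the identity of `osc_bracketParam` in time; uniqueness of the derivative then
replaces a second computation with sines and cosines. -/
theorem oscDeriv_bracketParam (hlam : ∀ i j, blk i = blk j → lam i = lam j) {P Q : Param}
    (hP : P ∈ blockParam blk) (hQ : Q ∈ blockParam blk) (i : Fin 9) (t : ℝ) :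
    oscDeriv lam (bracketParam lam P Q) i t =
      lam i ^ 2 * (P.b * osc lam Q i t - Q.b * osc lam P i t)
      + ∑ j, Q.W i j * oscDeriv lam P j t - ∑ j, P.W i j * oscDeriv lam Q j t := by
  have h1 := (hasDerivAt_osc lam (bracketParam lam P Q) i t)
  have h2 := ((((hasDerivAt_oscDeriv lam Q i t).const_mul (-P.b)).add
    ((hasDerivAt_oscDeriv lam P i t).const_mul Q.b)).add
    (HasDerivAt.fun_sum (u := Finset.univ) fun j _ =>
      (hasDerivAt_osc lam P j t).const_mul (Q.W i j))).sub
    (HasDerivAt.fun_sum (u := Finset.univ) fun j _ =>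
      (hasDerivAt_osc lam Q j t).const_mul (P.W i j))
  have h3 : osc lam (bracketParam lam P Q) i = _ :=
    funext fun s => osc_bracketParam hlam hP hQ i s
  rw [h3] at h1
  rw [h1.unique h2]
  ring

/-- The Wronskian of two solutions is constant in time. It is the reason why brackets of the
translational fields are constant multiples of K₍₊₎, as in a Heisenberg algebra. -/
theorem wronskian (P Q : Param) (i : Fin 9) (t : ℝ) :
    osc lam P i t * oscDeriv lam Q i t - osc lam Q i t * oscDeriv lam P i t
      = lam i * (P.v i * Q.u i - P.u i * Q.v i) := by
  simp only [osc, oscDeriv]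
  linear_combination (lam i * (P.v i * Q.u i - P.u i * Q.v i)) * sin_sq_add_cos_sq (lam i * t)

theorem lieBracket_kfield (hlam : ∀ i j, blk i = blk j → lam i = lam j) {P Q : Param}
    (hP : P ∈ blockParam blk) (hQ : Q ∈ blockParam blk) :
    lieBracket (kfield lam P) (kfield lam Q) = kfield lam (bracketParam lam P Q) := by
  ext x A
  simp only [lieBracket, pd_kfield, sum_idx]
  rcases A with a | i
  · fin_cases a
    · simp only [kfield, oscDeriv_bracketParam hlam hP hQ]
      simp only [bracketParam, Param.a_mk, ← wronskian _ _ _ (x minus)]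
      -- Skewness moves the rotation from the oscillator velocities to the coordinates.
      have h : ∀ R S : Param, (∀ i j, R.W j i = -R.W i j) →
          ∑ i, (∑ j, R.W i j * oscDeriv lam S j (x minus)) * x (sp i)
            = -∑ i, (∑ j, R.W i j * x (sp j)) * oscDeriv lam S i (x minus) := by
        intro R S hR
        simp only [Finset.sum_mul]
        rw [Finset.sum_comm, ← Finset.sum_neg_distrib]
        refine Finset.sum_congr rfl fun i _ => ?_
        rw [← Finset.sum_neg_distrib]
        refine Finset.sum_congr rfl fun j _ => ?_
        rw [hR i j]
        ring
      simp only [add_mul, sub_mul, Finset.sum_add_distrib, Finset.sum_sub_distrib, h P Q hP.1,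
        h Q P hQ.1]
      have h' : ∑ i, lam i ^ 2 * (P.b * osc lam Q i (x minus) - Q.b * osc lam P i (x minus))
          * x (sp i) = P.b * ∑ i, lam i ^ 2 * osc lam Q i (x minus) * x (sp i)
            - Q.b * ∑ i, lam i ^ 2 * osc lam P i (x minus) * x (sp i) := by
        rw [Finset.mul_sum, Finset.mul_sum, ← Finset.sum_sub_distrib]
        exact Finset.sum_congr rfl fun i _ => by ring
      rw [h']
      simp only [Fin.zero_eta, mul_neg, mul_zero, add_zero, zero_add, Finset.sum_neg_distrib]
      ring
    · simp [kfield, bracketParam]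
  · simp only [kfield, osc_bracketParam hlam hP hQ]
    simp only [bracketParam, Param.W_mk, Matrix.sub_apply, Matrix.mul_apply]
    have h : ∀ R S : Param, ∑ j, (∑ k, R.W i k * S.W k j) * (x (sp j) : ℂ)
        = ∑ k, R.W i k * ∑ j, S.W k j * x (sp j) := by
      intro R S
      simp only [Finset.sum_mul, Finset.mul_sum]
      rw [Finset.sum_comm]
      exact Finset.sum_congr rfl fun k _ => Finset.sum_congr rfl fun j _ => by ring
    simp only [sub_mul, Finset.sum_sub_distrib, h]
    simp only [add_mul, Finset.sum_add_distrib, mul_comm (Param.W _ _ _)]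
    ring

/-- Only the (-,-) component needs more than the skewness of W: there the oscillator equation with
λ_i² = B_i cancels the derivative of the metric, and the rotation leaves ∑ B_i xⁱxʲ untouched, as
recorded by `sum_skew_eq_zero` with coefficients λ_i². -/
theorem isKilling_kfield (hB : ∀ i, (B i : ℂ) = lam i ^ 2)
    (hlam : ∀ i j, blk i = blk j → lam i = lam j) {P : Param} (hP : P ∈ blockParam blk) :
    IsKilling B (kfield lam P) := by
  intro x E F
  have h0 := sum_skew_eq_zero hP.1 (mul_W_comm hlam hP (fun z => z ^ 2)) (fun i => (x (sp i) : ℂ))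
  simp only [pd_kfield, pd_metric, sum_idx]
  simp only [metric_apply]
  rcases E with e | i <;> rcases F with f | j
  · fin_cases e <;> fin_cases f
    · simp [eta_apply]
    · simp [eta_apply]
    · simp [eta_apply]
    · simp [eta_apply, kfield, hB]
      have : ∑ i, (osc lam P i (x minus) + ∑ j, P.W i j * ↑(x (sp j))) *
          (2 * (lam i ^ 2 * ↑(x (sp i)))) =
          2 * ∑ i, lam i ^ 2 * osc lam P i (x minus) * x (sp i)
            + 2 * ∑ i, lam i ^ 2 * x (sp i) * ∑ j, P.W i j * ↑(x (sp j)) := by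
        rw [Finset.mul_sum, Finset.mul_sum, ← Finset.sum_add_distrib]
        exact Finset.sum_congr rfl fun i _ => by ring
      rw [this, h0]
      ring
  · fin_cases e <;> simp [eta_apply, apply_ite Complex.ofReal]
  · fin_cases f <;> simp [eta_apply, apply_ite Complex.ofReal]
  · simp [eta_apply, apply_ite Complex.ofReal, Finset.sum_add_distrib, hP.1 i j]

theorem covDeriv_kfield (hB : ∀ i, (B i : ℂ) = lam i ^ 2)
    (hlam : ∀ i j, blk i = blk j → lam i = lam j) {P : Param} (hP : P ∈ blockParam blk)
    (A : Idx) (x : Spacetime) :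
    covDeriv B A (kfield lam P) x =
      (match A with
        | Sum.inl 0 => 0
        | Sum.inl 1 => Sum.elim (0 : Fin 2 → ℂ)
            (fun i => oscDeriv lam P i (x minus) - P.b * (B i * x (sp i)))
        | Sum.inr j => Sum.elim
            ![-(oscDeriv lam P j (x minus) - P.b * (B j * x (sp j))), 0] (fun i => P.W i j)) := by
  ext E
  rcases A with a | k
  · fin_cases a
    · refine (covDeriv_plus B _ x E).trans ?_
      rw [pd_kfield]
      rcases E with e | i
      · fin_cases e <;> simp
      · simp
    · refine (covDeriv_minus B _ x E).trans ?_
      rw [pd_kfield]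
      rcases E with e | i
      · fin_cases e
        · have h0 := sum_skew_eq_zero hP.1 (mul_W_comm hlam hP (fun z => z ^ 2))
            (fun i => (x (sp i) : ℂ))
          simp only [kfield, hB, Fin.zero_eta, Sum.elim_inl, Pi.zero_apply, mul_add,
            Finset.sum_add_distrib, h0]
          rw [add_zero, add_neg_eq_zero]
          exact Finset.sum_congr rfl fun i _ => by ring
        · simp
      · simp [kfield]
        ring
  · refine (covDeriv_sp B k _ x E).trans ?_
    rw [pd_kfield]
    rcases E with e | i
    · fin_cases e
      · simp [kfield]
        ring
      · simp
    · simp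

/-- Frame and coordinate vectors differ by multiples of ∂₊, and the covariant derivative of these
fields along ∂₊ is zero. -/
theorem sum_frame_covDeriv (hB : ∀ i, (B i : ℂ) = lam i ^ 2)
    (hlam : ∀ i j, blk i = blk j → lam i = lam j) {P : Param} (hP : P ∈ blockParam blk)
    (b : Idx) (x : Spacetime) :
    ∑ A, frame B b x A • covDeriv B A (kfield lam P) x = covDeriv B b (kfield lam P) x := by
  have hp : covDeriv B plus (kfield lam P) x = 0 := covDeriv_kfield hB hlam hP plus x
  rw [sum_idx, hp, smul_zero, zero_add]
  rcases b with b | i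
  · fin_cases b <;> simp [frame, hp]
  · simp [frame]

/-- The terms in B_i xⁱ coming from ∇₋ and those coming from ∇X both carry the factor b and cancel,
so only partial derivatives, the rotation, and the oscillator velocities remain. -/
theorem spinLie_kfield (hB : ∀ i, (B i : ℂ) = lam i ^ 2)
    (hlam : ∀ i j, blk i = blk j → lam i = lam j) {P : Param} (hP : P ∈ blockParam blk)
    (ξ : SField) (x : Spacetime) :
    spinLie B (kfield lam P) ξ x = kfield lam P x plus • pd plus ξ x - P.b • pd minus ξ x
      + ∑ i, kfield lam P x (sp i) • pd (sp i) ξ x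
      + (rot P.W *ᵥ (ξ x).1 - (1 / 2 : ℂ) • ∑ i, oscDeriv lam P i (x minus) • (gam i *ᵥ (ξ x).2),
        rot P.W *ᵥ (ξ x).2) := by
  have hm : kfield lam P x minus = -P.b := rfl
  have hs : spinRep (fun a b => metricInner B x (frame B a x)
      (∑ A, frame B b x A • covDeriv B A (kfield lam P) x)) (ξ x) =
      (-(rot P.W *ᵥ (ξ x).1) + (1 / 2 : ℂ) •
        ∑ i, (oscDeriv lam P i (x minus) - P.b * (B i * x (sp i))) • (gam i *ᵥ (ξ x).2),
      -(rot P.W *ᵥ (ξ x).2)) := by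
    simp only [sum_frame_covDeriv hB hlam hP]
    simp only [metricInner_frame, covDeriv_kfield hB hlam hP]
    rw [spinRep_apply]
    · rfl
    · intro a
      rcases a with a | i
      · fin_cases a <;> simp
      · simp
    · intro a
      rcases a with a | i
      · fin_cases a <;> simp
      · simp
    · simp
    · intro i
      simp
  simp only [spinLie]
  rw [hs]
  simp only [sum_idx, nabla_plus, nabla_minus, nabla_sp, hm]
  refine Prod.ext ?_ ?_
  · simp only [sub_smul, Finset.sum_sub_distrib, mul_smul, ← Finset.smul_sum, Prod.fst_add,
      Prod.fst_sub, Prod.smul_fst]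
    module
  · simp only [Prod.snd_add, Prod.snd_sub, Prod.smul_snd]
    module

end KField

/-! ## Infinitesimal rotations and the representation on constant spinors -/

/-- This is the infinitesimal spin covering: the commutator with `rot W` acts on vectors as -W. The
products Γ_iΓ_jΓ_k contribute only where i or j equals k. -/
theorem rot_mul_gam {W : Matrix (Fin 9) (Fin 9) ℂ} (hW : ∀ i j, W j i = -W i j) (k : Fin 9) :
    rot W * gam k = gam k * rot W - ∑ i, W i k • gam i := by
  have h : ∀ i j, gam i * gam j * gam k = gam k * (gam i * gam j)
      + (if j = k then (-2 : ℂ) else 0) • gam i + (if i = k then (2 : ℂ) else 0) • gam j := by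
    intro i j
    by_cases hj : j = k
    · subst hj
      by_cases hi : i = j
      · subst hi
        simp only [if_true, gam_mul_self, neg_mul, one_mul, mul_neg, mul_one]
        module
      · simp only [hi, if_true, if_false, mul_assoc, gam_mul_self, zero_smul, add_zero,
          gam_anticomm (Ne.symm hi), mul_neg, mul_one]
        rw [← mul_assoc, gam_anticomm (Ne.symm hi), neg_mul, mul_assoc, gam_mul_self]
        simp only [mul_neg, mul_one, neg_neg]
        module
    · by_cases hi : i = k
      · subst hi
        simp only [hj, if_true, if_false, zero_smul, add_zero]
        rw [mul_assoc, gam_anticomm hj, ← mul_assoc, mul_neg, ← mul_assoc, gam_mul_self]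
        simp only [neg_mul, one_mul]
        module
      · simp only [hi, hj, if_false, zero_smul, add_zero]
        rw [mul_assoc, gam_anticomm hj, mul_neg, ← mul_assoc, gam_anticomm hi, neg_mul, neg_neg,
          mul_assoc]
  simp only [rot, smul_mul_assoc, mul_smul_comm, Finset.sum_mul, Finset.mul_sum, h, smul_add,
    Finset.sum_add_distrib]
  have h1 : ∑ i, ∑ j, W i j • (if j = k then (-2 : ℂ) else 0) • gam i
      = (-2 : ℂ) • ∑ i, W i k • gam i := by
    rw [Finset.smul_sum]
    refine Finset.sum_congr rfl fun i _ => ?_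
    rw [Finset.sum_eq_single k (by intro j _ hj; simp [hj]) (by simp), if_pos rfl, smul_comm]
  have h2 : ∑ i, ∑ j, W i j • (if i = k then (2 : ℂ) else 0) • gam j
      = (-2 : ℂ) • ∑ i, W i k • gam i := by
    rw [Finset.sum_comm, Finset.smul_sum]
    refine Finset.sum_congr rfl fun i _ => ?_
    rw [Finset.sum_eq_single k (by intro j _ hj; simp [hj]) (by simp), if_pos rfl, hW i k]
    module
  rw [h1, h2]
  module

theorem rot_transpose {W : Matrix (Fin 9) (Fin 9) ℂ} (hW : ∀ i j, W j i = -W i j) :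
    (rot W)ᵀ = -rot W := by
  simp only [rot, Matrix.transpose_smul, Matrix.transpose_sum, Matrix.transpose_mul, gam_transpose]
  rw [Finset.sum_comm, ← smul_neg, ← Finset.sum_neg_distrib]
  congr 1
  refine Finset.sum_congr rfl fun i _ => ?_
  rw [← Finset.sum_neg_distrib]
  refine Finset.sum_congr rfl fun j _ => ?_
  rw [hW i j, neg_smul]

theorem rot_comm {blk : Fin 9 → Fin 4} {P : Param} (hP : P ∈ blockParam blk) {M : Cl}
    (hM : ∀ i j, blk i = blk j → M * (gam i * gam j) = gam i * gam j * M) :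
    M * rot P.W = rot P.W * M := by
  simp only [rot, smul_mul_assoc, mul_smul_comm, Finset.sum_mul, Finset.mul_sum]
  congr 1
  refine Finset.sum_congr rfl fun i _ => Finset.sum_congr rfl fun j _ => ?_
  by_cases h : blk i = blk j
  · rw [hM i j h]
  · rw [hP.2 i j h, zero_smul, zero_smul]

/-- Apply `rot_mul_gam` to both factors of each Γ_iΓ_j in `rot Z`. The order Z W - W Z is opposite
to that of the spinor commutator and agrees with the rotation part of `bracketParam`. -/
theorem rot_bracket {W Z : Matrix (Fin 9) (Fin 9) ℂ} (hW : ∀ i j, W j i = -W i j) :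
    rot W * rot Z - rot Z * rot W = rot (Z * W - W * Z) := by
  have h : ∀ i j, rot W * (gam i * gam j) = gam i * gam j * rot W
      - ∑ k, W k j • (gam i * gam k) - ∑ k, W k i • (gam k * gam j) := by
    intro i j
    rw [← mul_assoc, rot_mul_gam hW, sub_mul, mul_assoc, rot_mul_gam hW, mul_sub, mul_assoc]
    simp only [Finset.sum_mul, Finset.mul_sum, smul_mul_assoc, mul_smul_comm]
  have e : rot W * rot Z - rot Z * rot W = -((1 / 4 : ℂ) • ((∑ i, ∑ j, ∑ k,
      (Z i j * W k j) • (gam i * gam k)) + ∑ i, ∑ j, ∑ k, (Z i j * W k i) • (gam k * gam j))) := by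
    conv_lhs => rw [show rot Z = (1 / 4 : ℂ) • ∑ i, ∑ j, Z i j • (gam i * gam j) from rfl]
    simp only [smul_mul_assoc, mul_smul_comm, Finset.sum_mul, Finset.mul_sum, h, smul_sub,
      Finset.sum_sub_distrib, Finset.smul_sum, smul_smul, smul_add, mul_assoc]
    abel
  rw [e]
  have h1 : ∑ i, ∑ j, ∑ k, (Z i j * W k j) • (gam i * gam k)
      = -∑ i, ∑ k, (Z * W) i k • (gam i * gam k) := by
    rw [← Finset.sum_neg_distrib]
    refine Finset.sum_congr rfl fun i _ => ?_
    rw [Finset.sum_comm, ← Finset.sum_neg_distrib]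
    refine Finset.sum_congr rfl fun k _ => ?_
    rw [← Finset.sum_smul, ← neg_smul, Matrix.mul_apply, ← Finset.sum_neg_distrib]
    congr 1
    refine Finset.sum_congr rfl fun j _ => ?_
    rw [hW j k]
    ring
  have h2 : ∑ i, ∑ j, ∑ k, (Z i j * W k i) • (gam k * gam j)
      = ∑ k, ∑ j, (W * Z) k j • (gam k * gam j) := by
    have h3 : ∀ i, ∑ j, ∑ k, (Z i j * W k i) • (gam k * gam j)
        = ∑ k, ∑ j, (Z i j * W k i) • (gam k * gam j) := fun i => Finset.sum_comm
    simp only [h3]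
    rw [Finset.sum_comm]
    refine Finset.sum_congr rfl fun k _ => ?_
    rw [Finset.sum_comm]
    refine Finset.sum_congr rfl fun j _ => ?_
    rw [← Finset.sum_smul, Matrix.mul_apply]
    congr 1
    exact Finset.sum_congr rfl fun i _ => mul_comm _ _
  rw [h1, h2]
  simp only [rot, Matrix.sub_apply, sub_smul, Finset.sum_sub_distrib]
  module

theorem gam_mul_gam123 (i : Fin 9) : gam i * gam123 = eps i • (gam123 * gam i) := by
  have : eps i * eps i = 1 := by
    unfold eps; split_ifs <;> norm_num
  rw [gam123_mul_gam, smul_smul, this, one_smul]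

theorem gam123_comm_of_eps_eq {i j : Fin 9} (h : eps i = eps j) :
    gam123 * (gam i * gam j) = gam i * gam j * gam123 := by
  have : eps j * eps j = 1 := by
    unfold eps; split_ifs <;> norm_num
  rw [mul_assoc, gam_mul_gam123, mul_smul_comm, ← mul_assoc (gam i), gam_mul_gam123,
    smul_mul_assoc, smul_smul, h, mul_assoc, this, one_smul]

/-- The algebraic conditions on `λ`, on the blocks, on the pair `(c, d)`, and on the projection `Pr`
whose range contains the components `ξ₂`, on which the construction of the superalgebra rests. -/
structure Admissible (lam : Fin 9 → ℂ) (blk : Fin 9 → Fin 4) (c d Pr : Cl) : Prop where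
  lam_blk : ∀ i j, blk i = blk j → lam i = lam j
  eps_blk : ∀ i j, blk i = blk j → eps i = eps j
  c_transpose : cᵀ = -c
  d_transpose : dᵀ = -d
  c_gam123 : c * gam123 = gam123 * c
  c_rot : ∀ i j, blk i = blk j → c * (gam i * gam j) = gam i * gam j * c
  d_gam123 : d * gam123 = gam123 * d
  d_rot : ∀ i j, blk i = blk j → d * (gam i * gam j) = gam i * gam j * d
  pr_d : Pr * d = d * Pr
  pr_rot : ∀ i j, blk i = blk j → Pr * (gam i * gam j) = gam i * gam j * Pr
  s_pr : ∀ i, sMap c d i * Pr = (I * lam i) • (gam123 * gam i * Pr)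
  block_orth : ∀ i j, blk i ≠ blk j → ∀ w, Pr *ᵥ w = w →
    w ⬝ᵥ ((gam i * gam123 * gam j) *ᵥ w) = 0

/-- The action of the vector field with parameters `P` on constant spinors. -/
def rep (lam : Fin 9 → ℂ) (c d : Cl) (P : Param) (ψ : Spinor) : Spinor :=
  (P.b • (c *ᵥ ψ.1) + (1 / 2 : ℂ) • ∑ i, (P.u i • (sMap c d i *ᵥ ψ.2)
      + (lam i * P.v i) • (gam i *ᵥ ψ.2)) + rot P.W *ᵥ ψ.1,
    P.b • (d *ᵥ ψ.2) + rot P.W *ᵥ ψ.2)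

namespace Admissible

variable {lam : Fin 9 → ℂ} {blk : Fin 9 → Fin 4} {c d Pr : Cl}

theorem gam123_rot (h : Admissible lam blk c d Pr) (i j : Fin 9) (hij : blk i = blk j) :
    gam123 * (gam i * gam j) = gam i * gam j * gam123 :=
  gam123_comm_of_eps_eq (h.eps_blk i j hij)

theorem s_mulVec (h : Admissible lam blk c d Pr) {w : SIdx → ℂ} (hw : Pr *ᵥ w = w) (i : Fin 9) :
    sMap c d i *ᵥ w = (I * lam i) • (gam123 *ᵥ (gam i *ᵥ w)) := by
  have := congrArg (· *ᵥ w) (h.s_pr i)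
  simpa only [← mulVec_mulVec, hw, smul_mulVec] using this

theorem pr_d_mulVec (h : Admissible lam blk c d Pr) {w : SIdx → ℂ} (hw : Pr *ᵥ w = w) :
    Pr *ᵥ (d *ᵥ w) = d *ᵥ w := by
  rw [mulVec_mulVec, h.pr_d, ← mulVec_mulVec, hw]

/-- On the range of `Pr`, s_i = iλ_i Γ₁₂₃Γ_i, and both c and `Pr` are compatible with this form: c
passes through Γ₁₂₃ and d preserves the range. Hence c s_i - s_i d = iλ_i Γ₁₂₃ s_i, and Γ₁₂₃² = 1
gives -λ_i² Γ_i. This is the integrability condition that makes `sol` parallel. -/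
theorem c_s_mulVec (h : Admissible lam blk c d Pr) {w : SIdx → ℂ} (hw : Pr *ᵥ w = w) (i : Fin 9) :
    c *ᵥ (sMap c d i *ᵥ w) = sMap c d i *ᵥ (d *ᵥ w) - lam i ^ 2 • (gam i *ᵥ w) := by
  have hs : c *ᵥ (gam i *ᵥ w) - gam i *ᵥ (d *ᵥ w) = (I * lam i) • (gam123 *ᵥ (gam i *ᵥ w)) := by
    rw [← h.s_mulVec hw, sMap, sub_mulVec, mulVec_mulVec, mulVec_mulVec]
  rw [h.s_mulVec hw, h.s_mulVec (h.pr_d_mulVec hw), mulVec_smul, mulVec_mulVec (M := c),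
    h.c_gam123, ← mulVec_mulVec, eq_sub_iff_add_eq', ← eq_sub_iff_add_eq, ← smul_sub,
    ← mulVec_sub, ← neg_sub, hs, mulVec_neg, mulVec_smul, mulVec_mulVec (M := gam123) (N := gam123),
    gam123_mul_self, one_mulVec, smul_neg, smul_smul, ← neg_smul]
  congr 1
  linear_combination lam i ^ 2 * I_sq

/-- Block rotations commute with c and d, so s transforms as a vector under them, just as Γ does. -/
theorem rot_s (h : Admissible lam blk c d Pr) {P : Param} (hP : P ∈ blockParam blk) (k : Fin 9) :
    rot P.W * sMap c d k = sMap c d k * rot P.W - ∑ i, P.W i k • sMap c d i := by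
  have hc := rot_comm hP h.c_rot
  have hd := rot_comm hP h.d_rot
  simp only [sMap, smul_sub, Finset.sum_sub_distrib]
  rw [mul_sub, ← mul_assoc, ← hc, mul_assoc, rot_mul_gam hP.1, ← mul_assoc (rot P.W),
    rot_mul_gam hP.1, sub_mul, sub_mul, mul_assoc _ d, hd, mul_sub]
  simp only [Finset.mul_sum, Finset.sum_mul, mul_smul_comm, smul_mul_assoc, mul_assoc]
  abel

theorem pr_rep (h : Admissible lam blk c d Pr) {P : Param} (hP : P ∈ blockParam blk)
    {ψ : Spinor} (hψ : Pr *ᵥ ψ.2 = ψ.2) :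
    Pr *ᵥ (rep lam c d P ψ).2 = (rep lam c d P ψ).2 := by
  simp only [rep, mulVec_add, mulVec_smul, h.pr_d_mulVec hψ]
  rw [mulVec_mulVec (N := rot P.W), rot_comm hP h.pr_rot, ← mulVec_mulVec, hψ]

end Admissible

/-- The part of `rep` that maps `ξ₂` to `ξ₁`. -/
def repOff (lam : Fin 9 → ℂ) (c d : Cl) (P : Param) : Cl :=
  (1 / 2 : ℂ) • ∑ i, (P.u i • sMap c d i + (lam i * P.v i) • gam i)

theorem rep_eq (lam : Fin 9 → ℂ) (c d : Cl) (P : Param) (ψ : Spinor) : rep lam c d P ψ =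
    (P.b • (c *ᵥ ψ.1) + repOff lam c d P *ᵥ ψ.2 + rot P.W *ᵥ ψ.1,
      P.b • (d *ᵥ ψ.2) + rot P.W *ᵥ ψ.2) := by
  simp only [rep, repOff, smul_mulVec, Matrix.sum_mulVec, add_mulVec]

theorem repOff_add (lam : Fin 9 → ℂ) (c d : Cl) (P Q : Param) :
    repOff lam c d (P + Q) = repOff lam c d P + repOff lam c d Q := by
  simp only [repOff, ← smul_add, ← Finset.sum_add_distrib, Param.u_add, Param.v_add, Pi.add_apply]
  congr 1
  exact Finset.sum_congr rfl fun i _ => by module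

theorem repOff_smul (lam : Fin 9 → ℂ) (c d : Cl) (z : ℂ) (P : Param) :
    repOff lam c d (z • P) = z • repOff lam c d P := by
  simp only [repOff, Param.u_smul, Param.v_smul, Pi.smul_apply, Finset.smul_sum, smul_eq_mul]
  exact Finset.sum_congr rfl fun i _ => by module

theorem rot_add (W Z : Matrix (Fin 9) (Fin 9) ℂ) : rot (W + Z) = rot W + rot Z := by
  simp only [rot, Matrix.add_apply, add_smul, Finset.sum_add_distrib, smul_add]

theorem rot_smul (z : ℂ) (W : Matrix (Fin 9) (Fin 9) ℂ) : rot (z • W) = z • rot W := by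
  simp only [rot, Matrix.smul_apply, smul_assoc, Finset.smul_sum, smul_comm z]

theorem rep_add_left (lam : Fin 9 → ℂ) (c d : Cl) (P Q : Param) (ψ : Spinor) :
    rep lam c d (P + Q) ψ = rep lam c d P ψ + rep lam c d Q ψ := by
  simp only [rep_eq, repOff_add, Param.b_add, Param.W_add, rot_add, add_mulVec, Prod.mk_add_mk]
  refine Prod.ext ?_ ?_ <;> dsimp only <;> module

theorem rep_smul_left (lam : Fin 9 → ℂ) (c d : Cl) (z : ℂ) (P : Param) (ψ : Spinor) :
    rep lam c d (z • P) ψ = z • rep lam c d P ψ := by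
  simp only [rep_eq, repOff_smul, Param.b_smul, Param.W_smul, rot_smul, smul_mulVec, Prod.smul_mk,
    smul_eq_mul]
  refine Prod.ext ?_ ?_ <;> dsimp only <;> module

theorem rep_add_right (lam : Fin 9 → ℂ) (c d : Cl) (P : Param) (ψ φ : Spinor) :
    rep lam c d P (ψ + φ) = rep lam c d P ψ + rep lam c d P φ := by
  simp only [rep_eq, Prod.fst_add, Prod.snd_add, mulVec_add, Prod.mk_add_mk]
  refine Prod.ext ?_ ?_ <;> dsimp only <;> module

theorem rep_smul_right (lam : Fin 9 → ℂ) (c d : Cl) (P : Param) (z : ℂ) (ψ : Spinor) :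
    rep lam c d P (z • ψ) = z • rep lam c d P ψ := by
  simp only [rep_eq, Prod.smul_fst, Prod.smul_snd, mulVec_smul, Prod.smul_mk]
  refine Prod.ext ?_ ?_ <;> dsimp only <;> module

namespace Admissible

variable {lam : Fin 9 → ℂ} {blk : Fin 9 → Fin 4} {c d Pr : Cl}

/-- Commuting with (c, d) sends the oscillator data (u, v) to (λv, -λu), which is the action of K₍₋₎
in `bracketParam`. The relation c s_i - s_i d = -λ_i² Γ_i supplies the second entry. -/
theorem c_repOff (h : Admissible lam blk c d Pr) {w : SIdx → ℂ} (hw : Pr *ᵥ w = w) (P : Param) :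
    c *ᵥ (repOff lam c d P *ᵥ w) = repOff lam c d P *ᵥ (d *ᵥ w) + (1 / 2 : ℂ) •
      ∑ i, ((lam i * P.v i) • (sMap c d i *ᵥ w) - (lam i * (lam i * P.u i)) • (gam i *ᵥ w)) := by
  have hs : ∀ i, c *ᵥ (gam i *ᵥ w) = gam i *ᵥ (d *ᵥ w) + sMap c d i *ᵥ w := by
    intro i
    rw [sMap, sub_mulVec, mulVec_mulVec, mulVec_mulVec]
    abel
  simp only [repOff, smul_mulVec, Matrix.sum_mulVec, add_mulVec, mulVec_smul, mulVec_sum,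
    mulVec_add, h.c_s_mulVec hw, hs]
  rw [← smul_add, ← Finset.sum_add_distrib]
  congr 1
  exact Finset.sum_congr rfl fun i _ => by module

theorem rot_repOff (h : Admissible lam blk c d Pr) {P : Param} (hP : P ∈ blockParam blk)
    (Q : Param) : rot P.W * repOff lam c d Q = repOff lam c d Q * rot P.W - (1 / 2 : ℂ) •
      ∑ i, ((∑ j, P.W i j * Q.u j) • sMap c d i + (lam i * ∑ j, P.W i j * Q.v j) • gam i) := by
  have e : ∑ i, ((∑ j, P.W i j * Q.u j) • sMap c d i + (lam i * ∑ j, P.W i j * Q.v j) • gam i)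
      = ∑ k, (Q.u k • ∑ i, P.W i k • sMap c d i + (lam k * Q.v k) • ∑ i, P.W i k • gam i) := by
    simp only [Finset.mul_sum, Finset.sum_smul, Finset.smul_sum, ← Finset.sum_add_distrib]
    rw [Finset.sum_comm]
    refine Finset.sum_congr rfl fun k _ => Finset.sum_congr rfl fun i _ => ?_
    have := mul_W_comm h.lam_blk hP id i k
    simp only [id] at this
    rw [smul_smul, smul_smul]
    congr 2
    · ring
    · linear_combination Q.v k * this
  rw [e]
  simp only [repOff, smul_mul_assoc, mul_smul_comm, Finset.sum_mul, Finset.mul_sum, mul_add,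
    add_mul, h.rot_s hP, rot_mul_gam hP.1]
  rw [← smul_sub, ← Finset.sum_sub_distrib]
  congr 1
  exact Finset.sum_congr rfl fun i _ => by module

/-- The commutator splits into the brackets of time translation with translations (`c_repOff`), of
rotations with translations (`rot_repOff`), and of rotations with each other (`rot_bracket`). Two
translations commute on spinors because both map S₊ to S₋, in accordance with K₍₊₎ acting by zero.
-/
theorem rep_bracketParam (h : Admissible lam blk c d Pr) {P Q : Param}
    (hP : P ∈ blockParam blk) (hQ : Q ∈ blockParam blk) {ψ : Spinor} (hψ : Pr *ᵥ ψ.2 = ψ.2) :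
    rep lam c d P (rep lam c d Q ψ) - rep lam c d Q (rep lam c d P ψ)
      = rep lam c d (bracketParam lam P Q) ψ := by
  have hcP := fun x : SIdx → ℂ => congrArg (· *ᵥ x) (rot_comm hP h.c_rot)
  have hcQ := fun x : SIdx → ℂ => congrArg (· *ᵥ x) (rot_comm hQ h.c_rot)
  have hdP := fun x : SIdx → ℂ => congrArg (· *ᵥ x) (rot_comm hP h.d_rot)
  have hdQ := fun x : SIdx → ℂ => congrArg (· *ᵥ x) (rot_comm hQ h.d_rot)
  have hPQ := fun x : SIdx → ℂ => congrArg (· *ᵥ x) (h.rot_repOff hP Q)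
  have hQP := fun x : SIdx → ℂ => congrArg (· *ᵥ x) (h.rot_repOff hQ P)
  have hR := fun x : SIdx → ℂ => congrArg (· *ᵥ x) (rot_bracket (Z := Q.W) hP.1)
  have hW : (bracketParam lam P Q).W = Q.W * P.W - P.W * Q.W := rfl
  have hb : (bracketParam lam P Q).b = 0 := rfl
  have hoff : repOff lam c d (bracketParam lam P Q) *ᵥ ψ.2 =
      P.b • ((1 / 2 : ℂ) • ∑ i, ((lam i * Q.v i) • (sMap c d i *ᵥ ψ.2)
        - (lam i * (lam i * Q.u i)) • (gam i *ᵥ ψ.2)))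
      - Q.b • ((1 / 2 : ℂ) • ∑ i, ((lam i * P.v i) • (sMap c d i *ᵥ ψ.2)
        - (lam i * (lam i * P.u i)) • (gam i *ᵥ ψ.2)))
      + (1 / 2 : ℂ) • (∑ i, ((∑ j, Q.W i j * P.u j) • sMap c d i
        + (lam i * ∑ j, Q.W i j * P.v j) • gam i)) *ᵥ ψ.2
      - (1 / 2 : ℂ) • (∑ i, ((∑ j, P.W i j * Q.u j) • sMap c d i
        + (lam i * ∑ j, P.W i j * Q.v j) • gam i)) *ᵥ ψ.2 := by
    simp only [repOff, bracketParam, Param.u_mk, Param.v_mk, Matrix.sum_mulVec, add_mulVec,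
      smul_mulVec, Finset.smul_sum]
    rw [← Finset.sum_sub_distrib, ← Finset.sum_add_distrib, ← Finset.sum_sub_distrib]
    exact Finset.sum_congr rfl fun i _ => by module
  simp only [← mulVec_mulVec, sub_mulVec, smul_mulVec] at hcP hcQ hdP hdQ hPQ hQP hR
  simp only [rep_eq]
  rw [hoff, hW, hb]
  simp only [mulVec_add, mulVec_smul, h.c_repOff hψ, hcP, hcQ, hdP, hdQ, hPQ, hQP, ← hR]
  refine Prod.ext ?_ ?_
  · simp only [Prod.fst_sub, ← hR]
    module
  · simp only [Prod.snd_sub, ← hR]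
    module

end Admissible

/-! ## The odd-odd bracket -/

theorem dotProduct_mulVec_transpose (M : Cl) (x y : SIdx → ℂ) :
    (M *ᵥ x) ⬝ᵥ y = x ⬝ᵥ (Mᵀ *ᵥ y) := by
  rw [dotProduct_mulVec, vecMul_transpose]

theorem gam_dotProduct (i : Fin 9) (x y : SIdx → ℂ) :
    (gam i *ᵥ x) ⬝ᵥ y = x ⬝ᵥ (gam i *ᵥ y) := by
  rw [dotProduct_mulVec_transpose, gam_transpose]

theorem skew_dotProduct {M : Cl} (hM : Mᵀ = -M) (x y : SIdx → ℂ) :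
    (M *ᵥ x) ⬝ᵥ y = -(x ⬝ᵥ (M *ᵥ y)) := by
  rw [dotProduct_mulVec_transpose, hM, neg_mulVec, dotProduct_neg]

theorem skew_dotProduct_self {M : Cl} (hM : Mᵀ = -M) (x : SIdx → ℂ) : x ⬝ᵥ (M *ᵥ x) = 0 := by
  have := skew_dotProduct hM x x
  rw [dotProduct_comm] at this
  exact self_eq_neg.1 this

/-- The bilinear form `(x, Γ_i Γ₁₂₃ Γ_j y)`. -/
def tri (i j : Fin 9) (x y : SIdx → ℂ) : ℂ := x ⬝ᵥ (gam i *ᵥ (gam123 *ᵥ (gam j *ᵥ y)))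

theorem tri_swap (i j : Fin 9) (x y : SIdx → ℂ) : tri i j x y = -tri j i y x := by
  rw [tri, ← gam_dotProduct, ← neg_eq_iff_eq_neg, ← skew_dotProduct gam123_transpose,
    ← dotProduct_comm, gam_dotProduct, tri]

/-- The polarized bracket in terms of parameters. -/
def pol (lam : Fin 9 → ℂ) (blk : Fin 9 → Fin 4) (ψ φ : Spinor) : Param :=
  (-2 * (ψ.1 ⬝ᵥ φ.1), -(ψ.2 ⬝ᵥ φ.2),
    fun i => -(ψ.1 ⬝ᵥ (gam i *ᵥ φ.2) + φ.1 ⬝ᵥ (gam i *ᵥ ψ.2)),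
    fun i => I * (ψ.1 ⬝ᵥ (gam123 *ᵥ (gam i *ᵥ φ.2)) + φ.1 ⬝ᵥ (gam123 *ᵥ (gam i *ᵥ ψ.2))),
    Matrix.of fun i j => if blk i = blk j then
      -(I / 2) * lam i * (tri i j ψ.2 φ.2 - tri j i ψ.2 φ.2) else 0)

theorem Param.ext {P Q : Param} (ha : P.a = Q.a) (hb : P.b = Q.b) (hu : ∀ i, P.u i = Q.u i)
    (hv : ∀ i, P.v i = Q.v i) (hW : ∀ i j, P.W i j = Q.W i j) : P = Q :=
  Prod.ext ha (Prod.ext hb (Prod.ext (funext hu) (Prod.ext (funext hv) (Matrix.ext hW))))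

section Pol

variable (lam : Fin 9 → ℂ) (blk : Fin 9 → Fin 4)

theorem pol_a (ψ φ : Spinor) : (pol lam blk ψ φ).a = -2 * (ψ.1 ⬝ᵥ φ.1) := rfl

theorem pol_b (ψ φ : Spinor) : (pol lam blk ψ φ).b = -(ψ.2 ⬝ᵥ φ.2) := rfl

theorem pol_u (ψ φ : Spinor) (i : Fin 9) : (pol lam blk ψ φ).u i =
    -(ψ.1 ⬝ᵥ (gam i *ᵥ φ.2) + φ.1 ⬝ᵥ (gam i *ᵥ ψ.2)) := rfl

theorem pol_v (ψ φ : Spinor) (i : Fin 9) : (pol lam blk ψ φ).v i =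
    I * (ψ.1 ⬝ᵥ (gam123 *ᵥ (gam i *ᵥ φ.2)) + φ.1 ⬝ᵥ (gam123 *ᵥ (gam i *ᵥ ψ.2))) := rfl

theorem pol_W (ψ φ : Spinor) (i j : Fin 9) : (pol lam blk ψ φ).W i j =
    if blk i = blk j then
      -(I / 2) * lam i * (tri i j ψ.2 φ.2 - tri j i ψ.2 φ.2) else 0 := rfl

theorem pol_add_left (ψ ψ' φ : Spinor) :
    pol lam blk (ψ + ψ') φ = pol lam blk ψ φ + pol lam blk ψ' φ := by
  refine Param.ext ?_ ?_ (fun i => ?_) (fun i => ?_) fun i j => ?_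
  · simp [pol_a]; ring
  · simp [pol_b]; ring
  · simp [pol_u, mulVec_add]; ring
  · simp [pol_v, mulVec_add]; ring
  · simp only [Param.W_add, Matrix.add_apply, pol_W, tri, Prod.snd_add, add_dotProduct]
    split_ifs <;> ring

theorem pol_smul_left (z : ℂ) (ψ φ : Spinor) :
    pol lam blk (z • ψ) φ = z • pol lam blk ψ φ := by
  refine Param.ext ?_ ?_ (fun i => ?_) (fun i => ?_) fun i j => ?_
  · simp [pol_a]; ring
  · simp [pol_b]
  · simp [pol_u, mulVec_smul]; ring
  · simp [pol_v, mulVec_smul]; ring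
  · simp only [Param.W_smul, Matrix.smul_apply, pol_W, tri, Prod.smul_snd, smul_dotProduct,
      smul_eq_mul]
    split_ifs <;> ring

theorem pol_comm (ψ φ : Spinor) : pol lam blk ψ φ = pol lam blk φ ψ := by
  refine Param.ext ?_ ?_ (fun i => ?_) (fun i => ?_) fun i j => ?_
  · rw [pol_a, pol_a, dotProduct_comm]
  · rw [pol_b, pol_b, dotProduct_comm]
  · rw [pol_u, pol_u]; ring
  · rw [pol_v, pol_v]; ring
  · simp only [pol_W, tri_swap _ _ ψ.2 φ.2]
    split_ifs <;> ring

/-- `pol` as a bilinear map. -/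
def polₗ : Spinor →ₗ[ℂ] Spinor →ₗ[ℂ] Param :=
  LinearMap.mk₂ ℂ (pol lam blk) (pol_add_left lam blk) (pol_smul_left lam blk)
    (fun ψ φ φ' => by
      rw [pol_comm, pol_add_left, pol_comm _ _ φ, pol_comm _ _ φ'])
    (fun z ψ φ => by rw [pol_comm, pol_smul_left, pol_comm])

theorem pol_mem (hlam : ∀ i j, blk i = blk j → lam i = lam j) (ψ φ : Spinor) :
    pol lam blk ψ φ ∈ blockParam blk := by
  refine ⟨fun i j => ?_, fun i j hij => ?_⟩
  · simp only [pol_W]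
    by_cases hij : blk i = blk j
    · rw [if_pos hij, if_pos hij.symm, hlam i j hij]
      ring
    · rw [if_neg hij, if_neg (Ne.symm hij), neg_zero]
  · simp only [pol_W, if_neg hij]

variable {lam blk}

/-- On the diagonal the restriction to blocks is automatic, because `block_orth` kills the form
across blocks. Sums over W may then run over all indices, as equivariance needs. -/
theorem pol_self_W {c d Pr : Cl} (h : Admissible lam blk c d Pr) {ψ : Spinor}
    (hψ : Pr *ᵥ ψ.2 = ψ.2) (i j : Fin 9) :
    (pol lam blk ψ ψ).W i j = -(I * lam i) * tri i j ψ.2 ψ.2 := by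
  simp only [pol_W]
  split_ifs with hij
  · rw [tri_swap j i]
    ring
  · have := h.block_orth i j hij ψ.2 hψ
    rw [← mulVec_mulVec, ← mulVec_mulVec] at this
    rw [tri, this, mul_zero]

theorem bracketQuad_eq (heps : ∀ i j, blk i = blk j → eps i = eps j)
    (hlam : ∀ i j, blk i = blk j → lam i = lam j) (ψ : Spinor) :
    bracketQuad lam blk ψ = kfield lam (pol lam blk ψ ψ) := by
  have hk : kfield lam (pol lam blk ψ ψ) = kfieldₗ lam (pol lam blk ψ ψ) := rfl
  rw [hk, param_eq_sum _ (pol_mem lam blk hlam ψ ψ).1]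
  simp only [map_add, map_sum, map_smul]
  simp only [kfieldₗ, LinearMap.coe_mk, AddHom.coe_mk, ← Kplus_eq, ← Kminus_eq, ← Ksp_eq,
    ← Krot_eq, single_v_eq, bracketQuad, sigmaMinus_apply, sigmaPlus_apply]
  congr 1
  · congr 1
    · congr 1
      · congr 1
        · simp [pol_a, chargeConj, Gam_minus_apply]
        · simp [pol_b, chargeConj, Gam_plus_apply]
      · refine Finset.sum_congr rfl fun i _ => ?_
        congr 1
        simp [pol_u, chargeConj, Gam_sp_apply]
        ring
    · refine Finset.sum_congr rfl fun i _ => ?_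
      rw [smul_smul]
      congr 1
      simp [pol_v, chargeConj, Gam123, Gam_sp_apply, gam123, mul_assoc]
      ring
  · congr 1
    refine Finset.sum_congr rfl fun i _ => Finset.sum_congr rfl fun j _ => ?_
    simp only [pol_W]
    by_cases hij : blk i = blk j
    · rw [if_pos hij, if_pos hij]
      congr 1
      -- The sign ε_i of the bracket is exactly what moves Γ₁₂₃ between Γ_i and Γ_j, so that
      -- Γ₁₂₃Γ_ij becomes the antisymmetrized form `tri`.
      have e1 : ∀ k l, blk k = blk l → ∀ x : SIdx → ℂ, eps k •
          (gam 0 *ᵥ (gam 1 *ᵥ (gam 2 *ᵥ (gam k *ᵥ (gam l *ᵥ x)))))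
            = gam k *ᵥ (gam123 *ᵥ (gam l *ᵥ x)) := by
        intro k l hkl x
        have h1 := congrArg (· *ᵥ (gam l *ᵥ x)) (gam123_mul_gam k)
        simp only [smul_mulVec, ← mulVec_mulVec, gam123] at h1
        have h2 : eps k * eps k = 1 := by
          unfold eps; split_ifs <;> norm_num
        rw [h1, smul_smul, h2, one_smul]
        simp only [gam123, ← mulVec_mulVec]
      have e3 : (if i < 3 then (1 : ℂ) else -1) = eps i := rfl
      rw [e3]
      simp only [tri, ← e1 i j hij, ← e1 j i hij.symm, ← heps i j hij]
      simp only [chargeConj, Gam123, Gam2, Gam_sp_apply, Gam_plus_apply, Module.End.mul_apply,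
        LinearMap.smul_apply, LinearMap.sub_apply, Prod.smul_snd, Prod.snd_sub, mulVec_sub,
        mulVec_smul, dotProduct_smul, zero_dotProduct, smul_eq_mul, dotProduct_comm _ ψ.2,
        dotProduct_sub]
      ring
    · simp only [if_neg hij, zero_smul]

theorem bracket_eq (heps : ∀ i j, blk i = blk j → eps i = eps j)
    (hlam : ∀ i j, blk i = blk j → lam i = lam j) (ξ η : SField) :
    bracket lam blk ξ η = kfield lam (pol lam blk (ξ 0) (η 0)) := by
  have hk : ∀ P, kfield lam P = kfieldₗ lam P := fun P => rfl
  have hp : ∀ ψ φ, pol lam blk ψ φ = polₗ lam blk ψ φ := fun ψ φ => rfl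
  rw [bracket, bracketQuad_eq heps hlam, bracketQuad_eq heps hlam, bracketQuad_eq heps hlam,
    hk, hk, hk, hk, ← map_sub, ← map_sub, ← map_smul]
  congr 1
  simp only [hp, map_add, LinearMap.add_apply]
  rw [← hp (η 0) (ξ 0), pol_comm, hp]
  module

/-- The bracket is equivariant. -/
theorem two_pol_rep {c d Pr : Cl} (h : Admissible lam blk c d Pr) {P : Param}
    (hP : P ∈ blockParam blk) {ψ : Spinor} (hψ : Pr *ᵥ ψ.2 = ψ.2) :
    (2 : ℂ) • pol lam blk (rep lam c d P ψ) ψ = bracketParam lam P (pol lam blk ψ ψ) := by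
  have hR := rot_transpose hP.1
  -- Within a block the frequencies agree; across blocks the form vanishes.
  have hlamT : ∀ i k, lam i * tri i k ψ.2 ψ.2 = lam k * tri i k ψ.2 ψ.2 := by
    intro i k
    by_cases hik : blk i = blk k
    · rw [h.lam_blk i k hik]
    · have := h.block_orth i k hik ψ.2 hψ
      rw [← mulVec_mulVec, ← mulVec_mulVec] at this
      rw [tri, this, mul_zero, mul_zero]
  have hRg : ∀ i (x : SIdx → ℂ), gam i *ᵥ (rot P.W *ᵥ x) = rot P.W *ᵥ (gam i *ᵥ x)
      + ∑ k, P.W k i • (gam k *ᵥ x) := by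
    intro i x
    have := congrArg (· *ᵥ x) (rot_mul_gam hP.1 i)
    simp only [sub_mulVec, ← mulVec_mulVec, Matrix.sum_mulVec, smul_mulVec] at this
    rw [this]
    abel
  have hR3 : ∀ x : SIdx → ℂ, gam123 *ᵥ (rot P.W *ᵥ x) = rot P.W *ᵥ (gam123 *ᵥ x) := by
    intro x
    rw [mulVec_mulVec, rot_comm hP h.gam123_rot, ← mulVec_mulVec]
  -- For k ≠ i the product Γ_kΓ_i is skew. The diagonal terms produce the contributions of the K₍₋₎
  -- coefficient of {ξ, ξ}.
  have hgg : ∀ i k, (gam k *ᵥ ψ.2) ⬝ᵥ (gam i *ᵥ ψ.2)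
      = if k = i then -(ψ.2 ⬝ᵥ ψ.2) else 0 := by
    intro i k
    rw [gam_dotProduct, mulVec_mulVec]
    split_ifs with hik
    · rw [hik, gam_mul_self, neg_mulVec, one_mulVec, dotProduct_neg]
    · apply skew_dotProduct_self
      rw [Matrix.transpose_mul, gam_transpose, gam_transpose, gam_anticomm hik, neg_neg]
  have h1 : (rep lam c d P ψ).1 = P.b • (c *ᵥ ψ.1) + (1 / 2 : ℂ) • ∑ k,
      ((lam k * (I * P.u k)) • (gam123 *ᵥ (gam k *ᵥ ψ.2)) + (lam k * P.v k) • (gam k *ᵥ ψ.2))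
      + rot P.W *ᵥ ψ.1 := by
    simp only [rep, h.s_mulVec hψ]
    congr 3
    exact Finset.sum_congr rfl fun i _ => by module
  have h2 : (rep lam c d P ψ).2 = P.b • (d *ᵥ ψ.2) + rot P.W *ᵥ ψ.2 := rfl
  -- Trading d for c makes the terms with c cancel by skewness; the remaining multiple of Γ₁₂₃Γ_i
  -- interchanges the u and v coefficients.
  have hs : ∀ i, gam i *ᵥ (d *ᵥ ψ.2)
      = c *ᵥ (gam i *ᵥ ψ.2) - (I * lam i) • (gam123 *ᵥ (gam i *ᵥ ψ.2)) := by
    intro i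
    rw [← h.s_mulVec hψ, sMap, sub_mulVec, mulVec_mulVec, mulVec_mulVec]
    abel
  have hc3 : ∀ x : SIdx → ℂ, gam123 *ᵥ (c *ᵥ x) = c *ᵥ (gam123 *ᵥ x) := by
    intro x
    rw [mulVec_mulVec, ← h.c_gam123, ← mulVec_mulVec]
  have h33 : ∀ x : SIdx → ℂ, gam123 *ᵥ (gam123 *ᵥ x) = x := by
    intro x
    rw [mulVec_mulVec, gam123_mul_self, one_mulVec]
  refine Param.ext ?_ ?_ (fun i => ?_) (fun i => ?_) fun i j => ?_
  · change 2 * (-2 * ((rep lam c d P ψ).1 ⬝ᵥ ψ.1)) =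
      ∑ i, lam i * (P.v i * (pol lam blk ψ ψ).u i - P.u i * (pol lam blk ψ ψ).v i)
    rw [h1]
    simp only [add_dotProduct, smul_dotProduct, sum_dotProduct, skew_dotProduct h.c_transpose,
      skew_dotProduct_self h.c_transpose, skew_dotProduct hR, skew_dotProduct_self hR, smul_eq_mul,
      Finset.mul_sum, neg_zero, mul_zero, add_zero, zero_add]
    refine Finset.sum_congr rfl fun i _ => ?_
    rw [dotProduct_comm _ ψ.1, dotProduct_comm _ ψ.1]
    simp only [pol_u, pol_v]
    ring
  · change 2 * (-((rep lam c d P ψ).2 ⬝ᵥ ψ.2)) = 0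
    rw [h2]
    simp only [add_dotProduct, smul_dotProduct, skew_dotProduct h.d_transpose,
      skew_dotProduct_self h.d_transpose, skew_dotProduct hR, skew_dotProduct_self hR, smul_zero,
      neg_zero, add_zero, mul_zero]
  · have e1 : ∑ j, (pol lam blk ψ ψ).W i j * P.u j
        = -∑ k, lam k * (I * P.u k) * tri i k ψ.2 ψ.2 := by
      rw [← Finset.sum_neg_distrib]
      refine Finset.sum_congr rfl fun j _ => ?_
      rw [pol_self_W h hψ]
      linear_combination (-I * P.u j) * hlamT i j
    have e2 : ∑ j, P.W i j * (pol lam blk ψ ψ).u j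
        = 2 * ∑ k, P.W k i * (ψ.1 ⬝ᵥ (gam k *ᵥ ψ.2)) := by
      rw [Finset.mul_sum]
      refine Finset.sum_congr rfl fun j _ => ?_
      rw [hP.1 j i]
      simp only [pol_u]
      ring
    have e3 : ∀ k, (gam123 *ᵥ (gam k *ᵥ ψ.2)) ⬝ᵥ (gam i *ᵥ ψ.2) = tri i k ψ.2 ψ.2 := by
      intro k
      rw [dotProduct_comm, gam_dotProduct, tri]
    change 2 * (-((rep lam c d P ψ).1 ⬝ᵥ (gam i *ᵥ ψ.2)
      + ψ.1 ⬝ᵥ (gam i *ᵥ (rep lam c d P ψ).2)))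
      = P.b * lam i * (pol lam blk ψ ψ).v i - (pol lam blk ψ ψ).b * lam i * P.v i
      + ∑ j, (pol lam blk ψ ψ).W i j * P.u j - ∑ j, P.W i j * (pol lam blk ψ ψ).u j
    rw [e1, e2, h1, h2]
    simp only [add_dotProduct, smul_dotProduct, sum_dotProduct, skew_dotProduct h.c_transpose,
      skew_dotProduct hR, mulVec_add, mulVec_smul, hs, hRg, dotProduct_add, dotProduct_smul,
      dotProduct_sub, dotProduct_sum, smul_eq_mul, hgg, e3, Finset.sum_add_distrib, mul_ite,
      mul_zero, Finset.sum_ite_eq', Finset.mem_univ, if_true]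
    simp only [pol_b, pol_v]
    ring
  · have e1 : ∑ j, (pol lam blk ψ ψ).W i j * P.v j
        = -∑ k, I * (lam k * P.v k * tri i k ψ.2 ψ.2) := by
      rw [← Finset.sum_neg_distrib]
      refine Finset.sum_congr rfl fun j _ => ?_
      rw [pol_self_W h hψ]
      linear_combination (-I * P.v j) * hlamT i j
    have e2 : ∑ j, P.W i j * (pol lam blk ψ ψ).v j
        = -(2 * ∑ k, I * (P.W k i * (ψ.1 ⬝ᵥ (gam123 *ᵥ (gam k *ᵥ ψ.2))))) := by
      rw [Finset.mul_sum, ← Finset.sum_neg_distrib]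
      refine Finset.sum_congr rfl fun j _ => ?_
      rw [hP.1 j i]
      simp only [pol_v]
      ring
    have e3 : ∀ k, (gam123 *ᵥ (gam k *ᵥ ψ.2)) ⬝ᵥ (gam123 *ᵥ (gam i *ᵥ ψ.2))
        = -((gam k *ᵥ ψ.2) ⬝ᵥ (gam i *ᵥ ψ.2)) := by
      intro k
      rw [skew_dotProduct gam123_transpose, h33]
    have e4 : ∀ k, (gam k *ᵥ ψ.2) ⬝ᵥ (gam123 *ᵥ (gam i *ᵥ ψ.2)) = -tri i k ψ.2 ψ.2 := by
      intro k
      rw [gam_dotProduct, ← tri_swap, tri]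
    change 2 * (I * ((rep lam c d P ψ).1 ⬝ᵥ (gam123 *ᵥ (gam i *ᵥ ψ.2))
      + ψ.1 ⬝ᵥ (gam123 *ᵥ (gam i *ᵥ (rep lam c d P ψ).2))))
      = (pol lam blk ψ ψ).b * lam i * P.u i - P.b * lam i * (pol lam blk ψ ψ).u i
      + ∑ j, (pol lam blk ψ ψ).W i j * P.v j - ∑ j, P.W i j * (pol lam blk ψ ψ).v j
    rw [e1, e2, h1, h2]
    simp only [add_dotProduct, smul_dotProduct, sum_dotProduct, skew_dotProduct h.c_transpose,
      skew_dotProduct hR, mulVec_add, mulVec_smul, mulVec_sub, mulVec_sum, hs, hRg, hR3, hc3, h33,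
      dotProduct_add, dotProduct_smul, dotProduct_neg,
      dotProduct_sub, dotProduct_sum, smul_eq_mul, hgg, e3, e4, Finset.sum_add_distrib, mul_ite,
      mul_zero, Finset.sum_ite_eq', Finset.mem_univ, if_true, ← Finset.mul_sum]
    simp only [pol_b, pol_u]
    simp only [mul_neg, Finset.sum_neg_distrib, mul_ite, mul_zero, Finset.sum_ite_eq',
      Finset.mem_univ, if_true]
    linear_combination (lam i * P.u i * (ψ.2 ⬝ᵥ ψ.2)
      - 2 * P.b * lam i * (ψ.1 ⬝ᵥ (gam i *ᵥ ψ.2))) * I_sq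
  · by_cases hij : blk i = blk j
    · have hd : ∀ x : SIdx → ℂ, d *ᵥ (gam i *ᵥ (gam123 *ᵥ (gam j *ᵥ x)))
          = gam i *ᵥ (gam123 *ᵥ (gam j *ᵥ (d *ᵥ x))) := by
        intro x
        have h1 : gam i * gam123 * gam j = eps i • (gam123 * (gam i * gam j)) := by
          rw [← mul_assoc, gam123_mul_gam, smul_mul_assoc, smul_smul]
          have h2 : eps i * eps i = 1 := by
            unfold eps; split_ifs <;> norm_num
          rw [h2, one_smul]
        have h2 : d * (gam i * gam123 * gam j) = gam i * gam123 * gam j * d := by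
          rw [h1, mul_smul_comm, smul_mul_assoc, ← mul_assoc, h.d_gam123, mul_assoc, mul_assoc,
            h.d_rot i j hij, mul_assoc]
        have h3 := congrArg (· *ᵥ x) h2
        simpa only [← mulVec_mulVec] using h3
      -- As d commutes with Γ_iΓ₁₂₃Γ_j inside a block, the time translation drops out of the
      -- rotation component, matching the fact that K₍₋₎ commutes with rotations.
      have e1 : tri i j (d *ᵥ ψ.2) ψ.2 = tri j i (d *ᵥ ψ.2) ψ.2 := by
        rw [tri, skew_dotProduct h.d_transpose, hd, tri_swap j i, tri]
      have e2 : tri i j (rot P.W *ᵥ ψ.2) ψ.2 - tri j i (rot P.W *ᵥ ψ.2) ψ.2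
          = ∑ k, (P.W k i * tri k j ψ.2 ψ.2 + P.W k j * tri i k ψ.2 ψ.2) := by
        rw [tri_swap j i, tri, tri]
        simp only [skew_dotProduct hR, hRg, hR3, mulVec_add, mulVec_sum, mulVec_smul,
          dotProduct_add, dotProduct_sum, dotProduct_smul, smul_eq_mul, Finset.sum_add_distrib,
          tri]
        ring
      change 2 * (if blk i = blk j then -(I / 2) * lam i *
        (tri i j (rep lam c d P ψ).2 ψ.2 - tri j i (rep lam c d P ψ).2 ψ.2) else 0)
        = ∑ k, (pol lam blk ψ ψ).W i k * P.W k j - ∑ k, P.W i k * (pol lam blk ψ ψ).W k j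
      have e3 : ∀ k l (x y : SIdx → ℂ), tri k l (P.b • x + y) ψ.2
          = P.b * tri k l x ψ.2 + tri k l y ψ.2 := by
        intro k l x y
        simp only [tri, add_dotProduct, smul_dotProduct, smul_eq_mul]
      rw [if_pos hij, h2, e3, e3, e1, add_sub_add_left_eq_sub, e2, ← Finset.sum_sub_distrib,
        Finset.mul_sum, Finset.mul_sum]
      refine Finset.sum_congr rfl fun k _ => ?_
      rw [pol_self_W h hψ, pol_self_W h hψ, hP.1 k i]
      have := mul_W_comm h.lam_blk hP id i k
      simp only [id] at this
      rw [hP.1 k i] at this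
      linear_combination (I * tri k j ψ.2 ψ.2) * this
    · rw [(bracketParam_mem hP (pol_mem lam blk h.lam_blk ψ ψ)).2 i j hij]
      simp [pol_W, hij]

end Pol

/-! ## Parallel spinor fields -/

/-- The action of the Clifford algebra on the spinor space as a continuous linear map. -/
def mulVecCLM (c : Cl) : (SIdx → ℂ) →L[ℂ] (SIdx → ℂ) :=
  LinearMap.toContinuousLinearMap (Matrix.toLin' c)

theorem mulVecCLM_apply (c : Cl) (ψ : SIdx → ℂ) : mulVecCLM c ψ = c *ᵥ ψ := by
  simp [mulVecCLM]

/-- The flow `exp (-t c) ψ`. -/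
def flow (c : Cl) (ψ : SIdx → ℂ) (t : ℝ) : SIdx → ℂ :=
  NormedSpace.exp (t • -mulVecCLM c) ψ

theorem flow_zero (c : Cl) (ψ : SIdx → ℂ) : flow c ψ 0 = ψ := by
  simp [flow]

theorem hasDerivAt_flow (c : Cl) (ψ : SIdx → ℂ) (t : ℝ) :
    HasDerivAt (flow c ψ) (-(c *ᵥ flow c ψ t)) t := by
  have h := hasDerivAt_exp_smul_const' (𝕂 := ℝ) (-mulVecCLM c) t
  have h2 := ((ContinuousLinearMap.apply ℂ (SIdx → ℂ) ψ).restrictScalars ℝ).hasFDerivAt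
    |>.comp_hasDerivAt t h
  refine h2.congr_deriv ?_
  simp [flow, mulVecCLM_apply]

theorem hasDerivAt_mulVec (M : Cl) {f : ℝ → SIdx → ℂ} {f' : SIdx → ℂ} {t : ℝ}
    (hf : HasDerivAt f f' t) : HasDerivAt (fun s => M *ᵥ f s) (M *ᵥ f') t := by
  have := ((mulVecCLM M).restrictScalars ℝ).hasFDerivAt.comp_hasDerivAt t hf
  simpa only [Function.comp_def, ContinuousLinearMap.coe_restrictScalars', mulVecCLM_apply]
    using this

theorem eq_of_hasDerivAt (M : Cl) {f g : ℝ → SIdx → ℂ}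
    (hf : ∀ t, HasDerivAt f (M *ᵥ f t) t) (hg : ∀ t, HasDerivAt g (M *ᵥ g t) t)
    (h0 : f 0 = g 0) : f = g := by
  refine ODE_solution_unique_univ (v := fun _ x => M *ᵥ x) (s := fun _ => Set.univ)
    (K := ‖(mulVecCLM M)‖₊) (fun t => ?_) (fun t => ⟨hf t, trivial⟩) (fun t => ⟨hg t, trivial⟩) h0
  have hM : (fun x => M *ᵥ x) = mulVecCLM M := funext fun x => (mulVecCLM_apply M x).symm
  rw [hM]
  exact (mulVecCLM M).lipschitz.lipschitzOnWith

/-- Uniqueness for linear equations with constant coefficients turns identities between flows into a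
check of the derivative and the initial value. -/
theorem eq_flow {c : Cl} {f : ℝ → SIdx → ℂ} (hf : ∀ t, HasDerivAt f (-(c *ᵥ f t)) t) :
    f = flow c (f 0) := by
  refine eq_of_hasDerivAt (-c) (fun t => ?_) (fun t => ?_) (flow_zero c _).symm
  · simpa only [neg_mulVec] using hf t
  · simpa only [neg_mulVec] using hasDerivAt_flow c (f 0) t

theorem mulVec_flow {M c : Cl} (h : M * c = c * M) (ψ : SIdx → ℂ) (t : ℝ) :
    M *ᵥ flow c ψ t = flow c (M *ᵥ ψ) t := by
  have := eq_flow (c := c) (f := fun t => M *ᵥ flow c ψ t) (fun t => by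
    have := hasDerivAt_mulVec M (hasDerivAt_flow c ψ t)
    rwa [mulVec_neg, mulVec_mulVec, h, ← mulVec_mulVec] at this)
  have := congrFun this t
  simpa only [flow_zero] using this

theorem flow_add (c : Cl) (ψ φ : SIdx → ℂ) (t : ℝ) :
    flow c (ψ + φ) t = flow c ψ t + flow c φ t := by
  simp [flow]

theorem flow_smul (c : Cl) (z : ℂ) (ψ : SIdx → ℂ) (t : ℝ) :
    flow c (z • ψ) t = z • flow c ψ t := by
  simp [flow]

/-- Bootstrapping: the derivative is a linear image of the flow, so it is as regular as the flow
itself. -/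
theorem contDiff_flow (c : Cl) (ψ : SIdx → ℂ) : ContDiff ℝ ∞ (flow c ψ) := by
  have hd : deriv (flow c ψ) = fun t => -(c *ᵥ flow c ψ t) :=
    funext fun t => (hasDerivAt_flow c ψ t).deriv
  rw [contDiff_infty]
  intro n
  induction n with
  | zero =>
    exact contDiff_zero.2
      (continuous_iff_continuousAt.2 fun t => (hasDerivAt_flow c ψ t).continuousAt)
  | succ n ih =>
    rw [Nat.cast_succ, contDiff_succ_iff_deriv]
    refine ⟨fun t => (hasDerivAt_flow c ψ t).differentiableAt, by simp, ?_⟩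
    rw [hd]
    have := (((mulVecCLM c).restrictScalars ℝ).contDiff.comp ih).neg
    simpa only [Function.comp_def, ContinuousLinearMap.coe_restrictScalars', mulVecCLM_apply]
      using this

/-- The parallel spinor field with value `ψ` at the origin. -/
def sol (c d : Cl) (ψ : Spinor) : SField := fun x =>
  (flow c ψ.1 (x minus) + (1 / 2 : ℂ) • ∑ i, (x (sp i) : ℂ) • (sMap c d i *ᵥ flow d ψ.2 (x minus)),
    flow d ψ.2 (x minus))

theorem sol_zero (c d : Cl) (ψ : Spinor) : sol c d ψ 0 = ψ := by
  simp [sol, flow_zero]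

theorem sol_add (c d : Cl) (ψ φ : Spinor) : sol c d (ψ + φ) = sol c d ψ + sol c d φ := by
  funext x
  refine Prod.ext ?_ ?_
  · simp only [sol, Prod.fst_add, Prod.snd_add, Pi.add_apply, flow_add, mulVec_add, smul_add,
      Finset.sum_add_distrib]
    abel
  · simp only [sol, Prod.snd_add, Pi.add_apply, flow_add]

theorem sol_smul (c d : Cl) (z : ℂ) (ψ : Spinor) : sol c d (z • ψ) = z • sol c d ψ := by
  funext x
  refine Prod.ext ?_ ?_
  · simp only [sol, Prod.smul_fst, Prod.smul_snd, Pi.smul_apply, flow_smul, mulVec_smul, smul_add,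
      Finset.smul_sum]
    congr 1
    exact Finset.sum_congr rfl fun i _ => by module
  · simp only [sol, Prod.smul_snd, Pi.smul_apply, flow_smul]

theorem contDiff_sol (c d : Cl) (ψ : Spinor) : ContDiff ℝ ∞ (sol c d ψ) := by
  have hc : ∀ E : Idx, ContDiff ℝ ∞ (fun y : Spacetime => y E) := fun E => contDiff_apply ℝ ℝ E
  have h : ∀ i, ContDiff ℝ ∞ (fun x : Spacetime => sMap c d i *ᵥ flow d ψ.2 (x minus)) := by
    intro i
    have := ((mulVecCLM (sMap c d i)).restrictScalars ℝ).contDiff.comp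
      ((contDiff_flow d ψ.2).comp (hc minus))
    simpa only [Function.comp_def, ContinuousLinearMap.coe_restrictScalars', mulVecCLM_apply]
      using this
  exact (((contDiff_flow c ψ.1).comp (hc minus)).add (ContDiff.const_smul (1 / 2 : ℂ)
    (ContDiff.sum fun i _ => (Complex.ofRealCLM.contDiff.comp (hc (sp i))).smul (h i)))).prodMk
    ((contDiff_flow d ψ.2).comp (hc minus))

theorem pd_prodMk {E F : Type*} [NormedAddCommGroup E] [NormedSpace ℝ E] [NormedAddCommGroup F]
    [NormedSpace ℝ F] (A : Idx) {f : Spacetime → E} {g : Spacetime → F} {x : Spacetime}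
    (hf : DifferentiableAt ℝ f x) (hg : DifferentiableAt ℝ g x) :
    pd A (fun y => (f y, g y)) x = (pd A f x, pd A g x) := by
  simp only [pd]
  rw [(hf.hasFDerivAt.prodMk hg.hasFDerivAt).fderiv]
  rfl

theorem pd_sol (c d : Cl) (ψ : Spinor) (A : Idx) (x : Spacetime) : pd A (sol c d ψ) x =
    (match A with
      | Sum.inl 0 => 0
      | Sum.inl 1 => (-(c *ᵥ flow c ψ.1 (x minus)) - (1 / 2 : ℂ) •
          ∑ i, (x (sp i) : ℂ) • (sMap c d i *ᵥ (d *ᵥ flow d ψ.2 (x minus))),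
          -(d *ᵥ flow d ψ.2 (x minus)))
      | Sum.inr i => ((1 / 2 : ℂ) • (sMap c d i *ᵥ flow d ψ.2 (x minus)), 0)) := by
  have hf : ∀ (c : Cl) (φ : SIdx → ℂ),
      DifferentiableAt ℝ (fun y : Spacetime => flow c φ (y minus)) x :=
    fun c φ => differentiableAt_time (hasDerivAt_flow c φ _).differentiableAt
  have hs : ∀ i, HasDerivAt (fun t => sMap c d i *ᵥ flow d ψ.2 t)
      (sMap c d i *ᵥ -(d *ᵥ flow d ψ.2 (x minus))) (x minus) :=
    fun i => hasDerivAt_mulVec _ (hasDerivAt_flow d ψ.2 _)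
  have hsd : ∀ i, DifferentiableAt ℝ
      (fun y : Spacetime => sMap c d i *ᵥ flow d ψ.2 (y minus)) x :=
    fun i => differentiableAt_time (hs i).differentiableAt
  have hxd : ∀ i, DifferentiableAt ℝ
      (fun y : Spacetime => (y (sp i) : ℂ) • (sMap c d i *ᵥ flow d ψ.2 (y minus))) x :=
    fun i => (differentiableAt_coord_complex _).fun_smul (hsd i)
  have hsum : DifferentiableAt ℝ
      (fun y : Spacetime => ∑ i, (y (sp i) : ℂ) • (sMap c d i *ᵥ flow d ψ.2 (y minus))) x :=
    DifferentiableAt.fun_sum fun i _ => hxd i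
  have hp : ∀ i, pd A (fun y : Spacetime => sMap c d i *ᵥ flow d ψ.2 (y minus)) x = _ :=
    fun i => pd_time A (hs i)
  unfold sol
  rw [pd_prodMk A ((hf _ _).fun_add (hsum.fun_const_smul _)) (hf _ _),
    pd_add A (hf _ _) (hsum.fun_const_smul _), pd_smul A (differentiableAt_const _) hsum, pd_const,
    pd_sum A _ fun i _ => hxd i, pd_time A (hasDerivAt_flow c ψ.1 _),
    pd_time A (hasDerivAt_flow d ψ.2 _)]
  simp only [pd_smul A (differentiableAt_coord_complex _) (hsd _), hp, pd_coord_complex]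
  rcases A with a | i
  · fin_cases a
    · simp
    · simp [mulVec_neg, sub_eq_add_neg]
  · simp

theorem connD_plus (B : Fin 9 → ℝ) (c d : Cl) (ξ : SField) (x : Spacetime) :
    connD B c d plus ξ x = pd plus ξ x := nabla_plus B ξ x

theorem connD_minus (B : Fin 9 → ℝ) (c d : Cl) (ξ : SField) (x : Spacetime) :
    connD B c d minus ξ x = pd minus ξ x
      + ((1 / 2 : ℂ) • ∑ i, (B i * x (sp i) : ℂ) • (gam i *ᵥ (ξ x).2) + c *ᵥ (ξ x).1,
        d *ᵥ (ξ x).2) := by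
  change nabla B minus ξ x + clAct c (sigmaMinus (ξ x)) + clAct d (sigmaPlus (ξ x)) = _
  rw [nabla_minus]
  simp [sigmaMinus_apply, sigmaPlus_apply, clAct_apply, add_assoc]

theorem connD_sp (B : Fin 9 → ℝ) (c d : Cl) (i : Fin 9) (ξ : SField) (x : Spacetime) :
    connD B c d (sp i) ξ x = pd (sp i) ξ x - ((1 / 2 : ℂ) • (sMap c d i *ᵥ (ξ x).2), 0) := by
  change nabla B (sp i) ξ x - (1 / 2 : ℂ) • Gam plus (clAct (sMap c d i) (sigmaPlus (ξ x))) = _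
  rw [nabla_sp]
  simp [sigmaPlus_apply, clAct_apply, Gam_plus_apply]

theorem pd_minus_of_parallel {B : Fin 9 → ℝ} {c d : Cl} {ξ : SField} (hξ : ξ ∈ parallel B c d)
    (y : Spacetime) : pd minus ξ y =
      -((1 / 2 : ℂ) • ∑ i, (B i * y (sp i) : ℂ) • (gam i *ᵥ (ξ y).2) + c *ᵥ (ξ y).1,
        d *ᵥ (ξ y).2) :=
  eq_neg_of_add_eq_zero_left ((connD_minus B c d ξ y).symm.trans (hξ.2 minus y))

theorem pd_sp_of_parallel {B : Fin 9 → ℝ} {c d : Cl} {ξ : SField} (hξ : ξ ∈ parallel B c d)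
    (i : Fin 9) (y : Spacetime) :
    pd (sp i) ξ y = ((1 / 2 : ℂ) • (sMap c d i *ᵥ (ξ y).2), 0) :=
  sub_eq_zero.1 ((connD_sp B c d i ξ y).symm.trans (hξ.2 (sp i) y))

/-- Along the ray τ ↦ τx, ξ₂ solves a linear equation with constant matrix -x⁻d and hence vanishes.
Then ξ₁ solves one with matrix -x⁻c and vanishes too. -/
theorem eq_zero_of_parallel {B : Fin 9 → ℝ} {c d : Cl} {ξ : SField} (hξ : ξ ∈ parallel B c d)
    (h0 : ξ 0 = 0) : ξ = 0 := by
  have hpm := pd_minus_of_parallel hξ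
  have hps := pd_sp_of_parallel hξ
  obtain ⟨hs, hp⟩ := hξ
  have hdiff : ∀ x, DifferentiableAt ℝ ξ x := hs.differentiable (by simp)
  have hpp : ∀ y, pd plus ξ y = 0 := fun y => by rw [← connD_plus B c d, hp]
  funext x
  have hline : ∀ τ : ℝ, HasDerivAt (fun τ : ℝ => ξ (τ • x)) (∑ A, x A • pd A ξ (τ • x)) τ := by
    intro τ
    have h1 : HasDerivAt (fun τ : ℝ => τ • x) x τ := by
      simpa using (hasDerivAt_id τ).smul_const x
    have h2 := (hdiff (τ • x)).hasFDerivAt.comp_hasDerivAt τ h1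
    refine h2.congr_deriv ?_
    have hx : ∑ A, x A • (Pi.single A 1 : Spacetime) = x := by
      ext E
      simp [Pi.single_apply]
    calc fderiv ℝ ξ (τ • x) x = fderiv ℝ ξ (τ • x) (∑ A, x A • (Pi.single A 1 : Spacetime)) := by
          rw [hx]
      _ = _ := by simp only [map_sum, map_smul, pd]
  have hline' : ∀ τ : ℝ, HasDerivAt (fun τ : ℝ => ξ (τ • x)) _ τ := fun τ => hline τ
  simp only [sum_idx, hpp, hpm, hps, smul_zero, zero_add] at hline'
  have h2 : (fun τ : ℝ => (ξ (τ • x)).2) = fun _ => 0 := by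
    refine eq_of_hasDerivAt (((-x minus : ℝ) : ℂ) • d) (fun τ => ?_) (fun τ => ?_) ?_
    · refine (hasFDerivAt_snd.comp_hasDerivAt τ (hline' τ)).congr_deriv ?_
      ext k
      simp [Prod.snd_sum, smul_mulVec, neg_mulVec]
    · simpa using hasDerivAt_const τ (0 : SIdx → ℂ)
    · simp [h0]
  have h1 : (fun τ : ℝ => (ξ (τ • x)).1) = fun _ => 0 := by
    refine eq_of_hasDerivAt (((-x minus : ℝ) : ℂ) • c) (fun τ => ?_) (fun τ => ?_) ?_
    · have h2τ : (ξ (τ • x)).2 = 0 := congrFun h2 τ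
      refine (hasFDerivAt_fst.comp_hasDerivAt τ (hline' τ)).congr_deriv ?_
      rw [h2τ]
      ext k
      simp [Prod.fst_sum, smul_mulVec, neg_mulVec]
    · simpa using hasDerivAt_const τ (0 : SIdx → ℂ)
    · simp [h0]
  have e1 := congrFun h1 1
  have e2 := congrFun h2 1
  simp only [one_smul] at e1 e2
  exact Prod.ext e1 e2

namespace Admissible

variable {lam : Fin 9 → ℂ} {blk : Fin 9 → Fin 4} {c d Pr : Cl} {B : Fin 9 → ℝ}

theorem pr_flow (h : Admissible lam blk c d Pr) {w : SIdx → ℂ} (hw : Pr *ᵥ w = w) (t : ℝ) :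
    Pr *ᵥ flow d w t = flow d w t := by
  rw [mulVec_flow h.pr_d, hw]

theorem sol_mem (h : Admissible lam blk c d Pr) (hB : ∀ i, (B i : ℂ) = lam i ^ 2) {ψ : Spinor}
    (hψ : Pr *ᵥ ψ.2 = ψ.2) : sol c d ψ ∈ parallel B c d := by
  refine ⟨contDiff_sol c d ψ, fun A x => ?_⟩
  rcases A with a | i
  · fin_cases a
    · refine (connD_plus B c d _ x).trans ?_
      rw [pd_sol]
    · refine (connD_minus B c d _ x).trans ?_
      rw [pd_sol]
      refine Prod.ext ?_ ?_
      · simp only [sol, Prod.fst_add, mulVec_add, mulVec_smul, mulVec_sum,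
          h.c_s_mulVec (h.pr_flow hψ _), smul_sub, Finset.sum_sub_distrib, hB, Prod.fst_zero]
        have : ∑ i, (lam i ^ 2 * (x (sp i) : ℂ)) • (gam i *ᵥ flow d ψ.2 (x minus))
            = ∑ i, (x (sp i) : ℂ) • lam i ^ 2 • (gam i *ᵥ flow d ψ.2 (x minus)) :=
          Finset.sum_congr rfl fun i _ => by module
        rw [this]
        module
      · simp [sol]
  · refine (connD_sp B c d i _ x).trans ?_
    rw [pd_sol]
    simp [sol]

theorem eq_sol (h : Admissible lam blk c d Pr) (hB : ∀ i, (B i : ℂ) = lam i ^ 2) {ξ : SField}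
    (hξ : ξ ∈ parallel B c d) (h0 : Pr *ᵥ (ξ 0).2 = (ξ 0).2) : ξ = sol c d (ξ 0) := by
  rw [← sub_eq_zero]
  refine eq_zero_of_parallel (Submodule.sub_mem _ hξ (h.sol_mem hB h0)) ?_
  rw [Pi.sub_apply, sol_zero, sub_self]

/-- The Lie derivative of a parallel field is again the parallel field of its value at the origin,
so the action of the even part is finite-dimensional algebra. -/
theorem spinLie_sol (h : Admissible lam blk c d Pr) (hB : ∀ i, (B i : ℂ) = lam i ^ 2) {P : Param}
    (hP : P ∈ blockParam blk) {ψ : Spinor} (hψ : Pr *ᵥ ψ.2 = ψ.2) :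
    spinLie B (kfield lam P) (sol c d ψ) = sol c d (rep lam c d P ψ) := by
  funext x
  set t := x minus with ht
  have hc : rot P.W *ᵥ flow c ψ.1 t = flow c (rot P.W *ᵥ ψ.1) t :=
    mulVec_flow (rot_comm hP h.c_rot).symm _ _
  have hd : rot P.W *ᵥ flow d ψ.2 t = flow d (rot P.W *ᵥ ψ.2) t :=
    mulVec_flow (rot_comm hP h.d_rot).symm _ _
  have hdd : d *ᵥ flow d ψ.2 t = flow d (d *ᵥ ψ.2) t := mulVec_flow rfl _ _
  have hcc : c *ᵥ flow c ψ.1 t = flow c (c *ᵥ ψ.1) t := mulVec_flow rfl _ _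
  -- Both sides satisfy y' = -cy: the oscillator equation and c s_i - s_i d = -λ_i² Γ_i compensate
  -- each other. It remains to compare them at time zero.
  have hoff : ∑ i, (osc lam P i t • (sMap c d i *ᵥ flow d ψ.2 t)
        - oscDeriv lam P i t • (gam i *ᵥ flow d ψ.2 t))
      = flow c (∑ i, (P.u i • (sMap c d i *ᵥ ψ.2) + (lam i * P.v i) • (gam i *ᵥ ψ.2))) t := by
    have := eq_flow (c := c) (f := fun t => ∑ i, (osc lam P i t • (sMap c d i *ᵥ flow d ψ.2 t)
        - oscDeriv lam P i t • (gam i *ᵥ flow d ψ.2 t))) (fun t => by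
      refine (HasDerivAt.fun_sum fun i _ => ((hasDerivAt_osc lam P i t).fun_smul
        (hasDerivAt_mulVec (sMap c d i) (hasDerivAt_flow d ψ.2 t))).fun_sub
        ((hasDerivAt_oscDeriv lam P i t).fun_smul
        (hasDerivAt_mulVec (gam i) (hasDerivAt_flow d ψ.2 t)))).congr_deriv ?_
      rw [mulVec_sum, ← Finset.sum_neg_distrib]
      refine Finset.sum_congr rfl fun i _ => ?_
      have e1 : c *ᵥ (gam i *ᵥ flow d ψ.2 t) = sMap c d i *ᵥ flow d ψ.2 t
          + gam i *ᵥ (d *ᵥ flow d ψ.2 t) := by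
        rw [sMap, sub_mulVec, mulVec_mulVec, mulVec_mulVec, sub_add_cancel]
      simp only [mulVec_sub, mulVec_smul, h.c_s_mulVec (h.pr_flow hψ _), e1, mulVec_neg]
      module)
    have := congrFun this t
    rw [this]
    congr 1
    refine Finset.sum_congr rfl fun i _ => ?_
    simp only [flow_zero, osc, oscDeriv, ofReal_zero, mul_zero, cos_zero, sin_zero]
    module
  have hs : ∀ i, rot P.W *ᵥ (sMap c d i *ᵥ flow d ψ.2 t)
      = sMap c d i *ᵥ (rot P.W *ᵥ flow d ψ.2 t)
        - ∑ k, P.W k i • (sMap c d k *ᵥ flow d ψ.2 t) := by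
    intro i
    have := congrArg (· *ᵥ flow d ψ.2 t) (h.rot_s hP i)
    simpa only [sub_mulVec, ← mulVec_mulVec, Matrix.sum_mulVec, smul_mulVec] using this
  -- The derivative along the rotational part of the Killing field cancels the commutator of the
  -- rotation with s.
  have hsum : ∑ i, (x (sp i) : ℂ) • ∑ k, P.W k i • (sMap c d k *ᵥ flow d ψ.2 t)
      = ∑ k, (∑ i, P.W k i * (x (sp i) : ℂ)) • (sMap c d k *ᵥ flow d ψ.2 t) := by
    simp only [Finset.smul_sum, Finset.sum_smul]
    rw [Finset.sum_comm]
    exact Finset.sum_congr rfl fun k _ => Finset.sum_congr rfl fun i _ => by module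
  rw [spinLie_kfield hB h.lam_blk hP]
  simp only [pd_sol, ← ht]
  refine Prod.ext ?_ ?_
  · simp only [sol, rep, ← ht, flow_add, flow_smul, ← hoff, ← hc, ← hd, ← hcc, ← hdd]
    have hb : ∀ i, (x (sp i) : ℂ) • P.b • (sMap c d i *ᵥ (d *ᵥ flow d ψ.2 t))
        = P.b • (x (sp i) : ℂ) • (sMap c d i *ᵥ (d *ᵥ flow d ψ.2 t)) := fun i => smul_comm _ _ _
    simp only [kfield, Prod.fst_add, Prod.fst_sub, Prod.fst_neg, Prod.fst_sum, Prod.smul_fst,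
      smul_zero, zero_sub, mulVec_add, mulVec_smul, mulVec_sum, hs, smul_sub, smul_add,
      Finset.sum_sub_distrib, Finset.sum_add_distrib, add_smul, hsum, Prod.fst_zero,
      smul_comm _ (1 / 2 : ℂ), ← Finset.smul_sum, hb]
    module
  · simp [sol, rep, ← ht, flow_add, flow_smul, ← hd, ← hdd, Prod.snd_sum]

end Admissible

/-! ## The superalgebra of an admissible family -/

/-- Spinors whose second component lies in the range of the projection. -/
def rangeSpinor (Pr : Cl) : Submodule ℂ Spinor where
  carrier := {ψ | Pr *ᵥ ψ.2 = ψ.2}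
  zero_mem' := by simp
  add_mem' := by
    intro ψ φ hψ hφ
    simp only [Set.mem_ofPred_eq, Prod.snd_add, mulVec_add] at *
    rw [hψ, hφ]
  smul_mem' := by
    intro z ψ hψ
    simp only [Set.mem_ofPred_eq, Prod.smul_snd, mulVec_smul] at *
    rw [hψ]

theorem mem_rangeSpinor {Pr : Cl} {ψ : Spinor} : ψ ∈ rangeSpinor Pr ↔ Pr *ᵥ ψ.2 = ψ.2 := Iff.rfl

/-- The data form the superalgebra of the family with the given algebraic conditions. -/
structure AdmissibleData (K : SuperData) (lam : Fin 9 → ℂ) (blk : Fin 9 → Fin 4) (Pr : Cl) :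
    Prop where
  admissible : Admissible lam blk K.c K.d Pr
  B_eq : ∀ i, (K.B i : ℂ) = lam i ^ 2
  even_eq : K.even = evenPart lam blk
  mem_odd : ∀ ξ, ξ ∈ K.odd ↔ ξ ∈ parallel K.B K.c K.d ∧ ξ 0 ∈ rangeSpinor Pr
  br_eq : K.br = bracket lam blk

namespace AdmissibleData

variable {K : SuperData} {lam : Fin 9 → ℂ} {blk : Fin 9 → Fin 4} {Pr : Cl}

theorem exists_kfield (h : AdmissibleData K lam blk Pr) {X : VField} (hX : X ∈ K.even) :
    ∃ P ∈ blockParam blk, kfield lam P = X := by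
  rw [h.even_eq, evenPart_eq] at hX
  exact hX

theorem kfield_mem (h : AdmissibleData K lam blk Pr) {P : Param} (hP : P ∈ blockParam blk) :
    kfield lam P ∈ K.even := by
  rw [h.even_eq, evenPart_eq]
  exact ⟨P, hP, rfl⟩

theorem eq_sol (h : AdmissibleData K lam blk Pr) {ξ : SField} (hξ : ξ ∈ K.odd) :
    ξ = sol K.c K.d (ξ 0) :=
  h.admissible.eq_sol h.B_eq ((h.mem_odd ξ).1 hξ).1 ((h.mem_odd ξ).1 hξ).2

theorem sol_mem (h : AdmissibleData K lam blk Pr) {ψ : Spinor} (hψ : ψ ∈ rangeSpinor Pr) :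
    sol K.c K.d ψ ∈ K.odd :=
  (h.mem_odd _).2 ⟨h.admissible.sol_mem h.B_eq hψ, by rwa [sol_zero]⟩

theorem zero_mem_rangeSpinor (h : AdmissibleData K lam blk Pr) {ξ : SField} (hξ : ξ ∈ K.odd) :
    ξ 0 ∈ rangeSpinor Pr :=
  ((h.mem_odd ξ).1 hξ).2

/-- The odd part is parametrized by the values at the origin. -/
def oddEquiv (h : AdmissibleData K lam blk Pr) : K.odd ≃ₗ[ℂ] rangeSpinor Pr where
  toFun ξ := ⟨(ξ : SField) 0, h.zero_mem_rangeSpinor ξ.2⟩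
  map_add' _ _ := rfl
  map_smul' _ _ := rfl
  invFun ψ := ⟨sol K.c K.d ψ, h.sol_mem ψ.2⟩
  left_inv ξ := Subtype.ext (h.eq_sol ξ.2).symm
  right_inv _ := Subtype.ext (sol_zero _ _ _)

theorem spinLie_eq (h : AdmissibleData K lam blk Pr) {P : Param} (hP : P ∈ blockParam blk)
    {ξ : SField} (hξ : ξ ∈ K.odd) :
    spinLie K.B (kfield lam P) ξ = sol K.c K.d (rep lam K.c K.d P (ξ 0)) := by
  conv_lhs => rw [h.eq_sol hξ]
  exact h.admissible.spinLie_sol h.B_eq hP (h.zero_mem_rangeSpinor hξ)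

theorem spinLie_mem (h : AdmissibleData K lam blk Pr) {X : VField} (hX : X ∈ K.even)
    {ξ : SField} (hξ : ξ ∈ K.odd) : spinLie K.B X ξ ∈ K.odd := by
  obtain ⟨P, hP, rfl⟩ := h.exists_kfield hX
  rw [h.spinLie_eq hP hξ]
  exact h.sol_mem (h.admissible.pr_rep hP (h.zero_mem_rangeSpinor hξ))

/-- The spinorial Lie derivative as a representation of the even part on the odd part. -/
def lie (h : AdmissibleData K lam blk Pr) : K.even →ₗ[ℂ] Module.End ℂ K.odd :=
  LinearMap.mk₂ ℂ (fun X ξ => ⟨spinLie K.B X ξ, h.spinLie_mem X.2 ξ.2⟩)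
    (by
      rintro ⟨_, hX⟩ ⟨_, hY⟩ ⟨ξ, hξ⟩
      obtain ⟨P, hP, rfl⟩ := h.exists_kfield hX
      obtain ⟨Q, hQ, rfl⟩ := h.exists_kfield hY
      refine Subtype.ext ?_
      simp only [Submodule.coe_add, ← kfield_add]
      rw [h.spinLie_eq (add_mem hP hQ) hξ, h.spinLie_eq hP hξ, h.spinLie_eq hQ hξ, rep_add_left,
        sol_add])
    (by
      rintro z ⟨_, hX⟩ ⟨ξ, hξ⟩
      obtain ⟨P, hP, rfl⟩ := h.exists_kfield hX
      refine Subtype.ext ?_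
      simp only [Submodule.coe_smul, ← kfield_smul]
      rw [h.spinLie_eq (Submodule.smul_mem _ z hP) hξ, h.spinLie_eq hP hξ, rep_smul_left, sol_smul])
    (by
      rintro ⟨_, hX⟩ ⟨ξ, hξ⟩ ⟨η, hη⟩
      obtain ⟨P, hP, rfl⟩ := h.exists_kfield hX
      refine Subtype.ext ?_
      simp only [Submodule.coe_add]
      rw [h.spinLie_eq hP (add_mem hξ hη), h.spinLie_eq hP hξ, h.spinLie_eq hP hη, Pi.add_apply,
        rep_add_right, sol_add])
    (by
      rintro z ⟨_, hX⟩ ⟨ξ, hξ⟩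
      obtain ⟨P, hP, rfl⟩ := h.exists_kfield hX
      refine Subtype.ext ?_
      simp only [Submodule.coe_smul]
      rw [h.spinLie_eq hP (Submodule.smul_mem _ z hξ), h.spinLie_eq hP hξ, Pi.smul_apply,
        rep_smul_right, sol_smul])

theorem coe_lie (h : AdmissibleData K lam blk Pr) (X : K.even) (ξ : K.odd) :
    (h.lie X ξ : SField) = spinLie K.B X ξ := rfl

theorem br_apply (h : AdmissibleData K lam blk Pr) (ξ η : SField) :
    K.br ξ η = kfield lam (pol lam blk (ξ 0) (η 0)) := by
  rw [h.br_eq]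
  exact bracket_eq h.admissible.eps_blk h.admissible.lam_blk ξ η

/-- The bracket as a bilinear map. -/
def bracketₗ (h : AdmissibleData K lam blk Pr) : K.odd →ₗ[ℂ] K.odd →ₗ[ℂ] K.even :=
  LinearMap.mk₂ ℂ (fun ξ η => ⟨K.br ξ η, by
      rw [h.br_apply]
      exact h.kfield_mem (pol_mem lam blk h.admissible.lam_blk _ _)⟩)
    (fun ξ ξ' η => Subtype.ext (by
      simp only [Submodule.coe_add, h.br_apply, Pi.add_apply, pol_add_left, kfield_add]))
    (fun z ξ η => Subtype.ext (by
      simp only [Submodule.coe_smul, h.br_apply, Pi.smul_apply, pol_smul_left, kfield_smul]))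
    (fun ξ η η' => Subtype.ext (by
      simp only [Submodule.coe_add, h.br_apply, Pi.add_apply, pol_comm _ _ ((ξ : SField) 0),
        pol_add_left, kfield_add]))
    (fun z ξ η => Subtype.ext (by
      simp only [Submodule.coe_smul, h.br_apply, Pi.smul_apply, pol_comm _ _ ((ξ : SField) 0),
        pol_smul_left, kfield_smul]))

theorem coe_bracketₗ (h : AdmissibleData K lam blk Pr) (ξ η : K.odd) :
    (h.bracketₗ ξ η : VField) = K.br ξ η := rfl

theorem lie_lie (h : AdmissibleData K lam blk Pr) {L : K.even →ₗ[ℂ] Module.End ℂ K.odd}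
    (hL : ∀ X ξ, (L X ξ : SField) = spinLie K.B X ξ) (X Y Z : K.even)
    (hZ : (Z : VField) = lieBracket X Y) : L X * L Y - L Y * L X = L Z := by
  obtain ⟨X, hX⟩ := X
  obtain ⟨Y, hY⟩ := Y
  obtain ⟨P, hP, rfl⟩ := h.exists_kfield hX
  obtain ⟨Q, hQ, rfl⟩ := h.exists_kfield hY
  refine LinearMap.ext fun ξ => Subtype.ext ?_
  simp only [LinearMap.sub_apply, Module.End.mul_apply, Submodule.coe_sub, hL, hZ]
  have hP' := h.spinLie_eq hP ξ.2
  have hQ' := h.spinLie_eq hQ ξ.2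
  rw [lieBracket_kfield h.admissible.lam_blk hP hQ,
    h.spinLie_eq hP (h.spinLie_mem hY ξ.2), h.spinLie_eq hQ (h.spinLie_mem hX ξ.2),
    h.spinLie_eq (bracketParam_mem hP hQ) ξ.2, hP', hQ', sol_zero, sol_zero,
    ← h.admissible.rep_bracketParam hP hQ (h.zero_mem_rangeSpinor ξ.2), sub_eq_add_neg,
    sub_eq_add_neg, sol_add, ← neg_one_smul ℂ (rep _ _ _ _ _), sol_smul, neg_one_smul]

theorem br_comm (h : AdmissibleData K lam blk Pr) (ξ η : SField) : K.br ξ η = K.br η ξ := by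
  rw [h.br_apply, h.br_apply, pol_comm]

theorem two_br_spinLie (h : AdmissibleData K lam blk Pr) {X : VField} (hX : X ∈ K.even)
    {ξ : SField} (hξ : ξ ∈ K.odd) :
    (2 : ℂ) • K.br (spinLie K.B X ξ) ξ = lieBracket X (K.br ξ ξ) := by
  obtain ⟨P, hP, rfl⟩ := h.exists_kfield hX
  have hm := pol_mem lam blk h.admissible.lam_blk (ξ 0) (ξ 0)
  rw [h.br_apply, h.br_apply, h.spinLie_eq hP hξ, sol_zero,
    lieBracket_kfield h.admissible.lam_blk hP hm, ← kfield_smul,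
    two_pol_rep h.admissible hP (h.zero_mem_rangeSpinor hξ)]

theorem isGeometricSuperalgebra (h : AdmissibleData K lam blk Pr) : K.IsGeometricSuperalgebra := by
  obtain ⟨L, hL⟩ : ∃ L : K.even →ₗ[ℂ] Module.End ℂ K.odd,
    ∀ X ξ, (L X ξ : SField) = spinLie K.B X ξ := ⟨h.lie, h.coe_lie⟩
  obtain ⟨b, hb⟩ : ∃ b : K.odd →ₗ[ℂ] K.odd →ₗ[ℂ] K.even,
    ∀ ξ η, (b ξ η : VField) = K.br ξ η := ⟨h.bracketₗ, h.coe_bracketₗ⟩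
  refine ⟨?_, ?_, ?_, L, b, hL, h.lie_lie hL, hb, ?_, ?_⟩
  · intro X hX
    obtain ⟨P, hP, rfl⟩ := h.exists_kfield hX
    exact ⟨contDiff_kfield lam P, isKilling_kfield h.B_eq h.admissible.lam_blk hP⟩
  · intro X hX Y hY
    obtain ⟨P, hP, rfl⟩ := h.exists_kfield hX
    obtain ⟨Q, hQ, rfl⟩ := h.exists_kfield hY
    rw [lieBracket_kfield h.admissible.lam_blk hP hQ]
    exact h.kfield_mem (bracketParam_mem hP hQ)
  · exact fun ξ hξ => ((h.mem_odd ξ).1 hξ).1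
  · exact fun ξ η => Subtype.ext (by rw [hb, hb, h.br_comm])
  · exact fun X ξ => by rw [hb, hb, hL, h.two_br_spinLie X.2 ξ.2]

/-- The Lie derivative is itself of the form `sol`, so it vanishes everywhere exactly when its value
at the origin does. -/
theorem cubic_iff (h : AdmissibleData K lam blk Pr) :
    K.Cubic ↔ ∀ ψ ∈ rangeSpinor Pr, rep lam K.c K.d (pol lam blk ψ ψ) ψ = 0 := by
  have hm := fun ψ => pol_mem lam blk h.admissible.lam_blk ψ ψ
  constructor
  · intro hK ψ hψ
    have := hK _ (h.sol_mem hψ)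
    rw [h.br_apply, h.spinLie_eq (hm _) (h.sol_mem hψ), sol_zero] at this
    rw [← sol_zero K.c K.d (rep _ _ _ _ _), this, Pi.zero_apply]
  · intro hr ξ hξ
    rw [h.br_apply, h.spinLie_eq (hm _) hξ, hr _ (h.zero_mem_rangeSpinor hξ),
      ← zero_smul ℂ (0 : Spinor), sol_smul, zero_smul]

theorem finrank_odd (h : AdmissibleData K lam blk Pr) :
    Module.finrank ℂ K.odd = Module.finrank ℂ (rangeSpinor Pr) :=
  h.oddEquiv.finrank_eq

end AdmissibleData

/-! ### Dimensions of the odd parts -/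

theorem finrank_spinor : Module.finrank ℂ Spinor = 32 := by
  simp [Spinor, SIdx]

theorem finrank_rangeSpinor_one : Module.finrank ℂ (rangeSpinor 1) = 32 := by
  have : rangeSpinor 1 = ⊤ := by
    ext ψ
    simp [mem_rangeSpinor]
  rw [this, finrank_top, finrank_spinor]

theorem gam1245_mulVec (ψ : SIdx → ℂ) (a b c d : Fin 2) :
    (gam1245 *ᵥ ψ) (a, b, c, d) = sgn c * ψ (a, b, c, d) := by
  rw [gam1245_eq, kron4_mulVec]
  fin_cases c <;> simp [mT, Matrix.one_apply, sgn]

theorem Xp_mulVec (ψ : SIdx → ℂ) (a b c d : Fin 2) :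
    (Xp *ᵥ ψ) (a, b, c, d) = if c = 0 then ψ (a, b, c, d) else 0 := by
  simp only [Xp, smul_mulVec, add_mulVec, one_mulVec, Pi.smul_apply, Pi.add_apply, gam1245_mulVec]
  fin_cases c <;> simp [sgn, ← two_mul]

theorem mem_rangeSpinor_Xp {ψ : Spinor} :
    ψ ∈ rangeSpinor Xp ↔ ∀ a b d, ψ.2 (a, b, 1, d) = 0 := by
  rw [mem_rangeSpinor]
  constructor
  · intro h a b d
    rw [← h, Xp_mulVec, if_neg one_ne_zero]
  · intro h
    funext ⟨a, b, c, d⟩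
    rw [Xp_mulVec]
    fin_cases c
    · rfl
    · exact (h a b d).symm

/-- Γ₁₂₄₅ is diagonal in this model, with the sign of the third index as eigenvalue. The condition
kills half of the coordinates of ξ₂, leaving 16 + 8. -/
theorem finrank_rangeSpinor_Xp : Module.finrank ℂ (rangeSpinor Xp) = 24 := by
  have e : rangeSpinor Xp ≃ₗ[ℂ] (SIdx → ℂ) × (Fin 2 × Fin 2 × Fin 2 → ℂ) :=
    { toFun := fun ψ => ((ψ : Spinor).1, fun j => (ψ : Spinor).2 (j.1, j.2.1, 0, j.2.2))
      map_add' := fun _ _ => rfl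
      map_smul' := fun _ _ => rfl
      invFun := fun y => ⟨(y.1, fun j => if j.2.2.1 = 0 then y.2 (j.1, j.2.1, j.2.2.2) else 0),
        mem_rangeSpinor_Xp.2 fun a b d => by simp⟩
      left_inv := by
        rintro ⟨ψ, hψ⟩
        refine Subtype.ext (Prod.ext rfl (funext ?_))
        rintro ⟨a, b, c, d⟩
        fin_cases c
        · simp
        · simpa using (mem_rangeSpinor_Xp.1 hψ a b d).symm
      right_inv := by
        rintro ⟨y, z⟩
        simp }
  rw [e.finrank_eq]
  simp [SIdx]

/-! ## The two families are admissible -/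

/-- When exactly one of Γ_i, Γ_j commutes with Γ₁₂₃, the product Γ_iΓ₁₂₃Γ_j is a skew matrix,
whatever the spinor. -/
theorem block_orth_of_eps_ne {i j : Fin 9} (h : eps i ≠ eps j) (w : SIdx → ℂ) :
    w ⬝ᵥ ((gam i * gam123 * gam j) *ᵥ w) = 0 := by
  have he : eps j = -eps i := by
    unfold eps at *
    split_ifs at * <;> simp at *
  have hij : j ≠ i := fun hij => h (by rw [hij])
  refine skew_dotProduct_self ?_ w
  simp only [transpose_mul, gam_transpose, gam123_transpose]
  rw [gam_mul_gam123, neg_mul, mul_neg, ← mul_assoc, gam_mul_gam123, he, smul_mul_assoc,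
    smul_mul_assoc, mul_assoc, gam_anticomm hij, mul_assoc]
  simp

theorem gam1245_comm_of_eta_eq {i j : Fin 9} (h : eta1245 i = eta1245 j) :
    gam1245 * (gam i * gam j) = gam i * gam j * gam1245 := by
  have : eta1245 j * eta1245 j = 1 := by
    fin_cases j <;> simp [eta1245]
  rw [← mul_assoc, gam1245_mul_gam, smul_mul_assoc, mul_assoc, gam1245_mul_gam, mul_smul_comm,
    smul_smul, h, this, one_smul, mul_assoc]

theorem gam1245_mulVec_of_Xp {w : SIdx → ℂ} (hw : Xp *ᵥ w = w) : gam1245 *ᵥ w = w := by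
  have h := hw
  rw [Xp, smul_mulVec, add_mulVec, one_mulVec] at h
  have h2 := congrArg ((2 : ℂ) • ·) h
  simp only [smul_smul] at h2
  norm_num [two_smul] at h2
  exact h2

/-- Here Γ_iΓ₁₂₃Γ_j anticommutes with the symmetric matrix Γ₁₂₄₅, so it sends the range of X⁺ to the
orthogonal range of X⁻. This is where the restriction on ξ₂ enters the bracket. -/
theorem block_orth_of_eta_ne {i j : Fin 9} (h : eta1245 i ≠ eta1245 j) {w : SIdx → ℂ}
    (hw : Xp *ᵥ w = w) : w ⬝ᵥ ((gam i * gam123 * gam j) *ᵥ w) = 0 := by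
  have he : eta1245 i * eta1245 j = -1 := by
    revert h
    fin_cases i <;> fin_cases j <;> simp [eta1245]
  have hG := gam1245_mulVec_of_Xp hw
  have hM : gam1245 * (gam i * gam123 * gam j) = -(gam i * gam123 * gam j * gam1245) := by
    rw [← mul_assoc, ← mul_assoc, gam1245_mul_gam, smul_mul_assoc, mul_assoc (gam i),
      gam1245_comm_gam123, smul_mul_assoc, ← mul_assoc, mul_assoc _ gam1245, gam1245_mul_gam,
      mul_smul_comm, smul_smul, he, neg_one_smul, mul_assoc, mul_assoc, mul_assoc]
  have e : w ⬝ᵥ ((gam i * gam123 * gam j) *ᵥ w) = -(w ⬝ᵥ ((gam i * gam123 * gam j) *ᵥ w)) := by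
    conv_lhs => rw [← hG]
    rw [dotProduct_mulVec_transpose, gam1245_transpose, mulVec_mulVec, hM, neg_mulVec,
      ← mulVec_mulVec, hG, hG, dotProduct_neg]
  exact self_eq_neg.1 e

/-- The blocks of the first family. -/
def blk1 : Fin 9 → Fin 4 := ![0, 0, 0, 1, 1, 1, 1, 1, 1]

/-- The blocks of the second family. -/
def blk2 : Fin 9 → Fin 4 := ![0, 0, 1, 2, 2, 3, 3, 3, 3]

theorem eps_eq_of_blk1 (i j : Fin 9) : blk1 i = blk1 j ↔ eps i = eps j := by
  fin_cases i <;> fin_cases j <;> norm_num [blk1, eps, Fin.lt_def]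

theorem eps_eq_of_blk2 (i j : Fin 9) (h : blk2 i = blk2 j) : eps i = eps j := by
  revert h
  fin_cases i <;> fin_cases j <;> norm_num [blk2, eps, Fin.lt_def] <;> decide

theorem eta_eq_of_blk2 (i j : Fin 9) (h : blk2 i = blk2 j) : eta1245 i = eta1245 j := by
  revert h
  fin_cases i <;> fin_cases j <;> norm_num [blk2, eta1245] <;> decide

theorem eps_ne_or_eta_ne_of_blk2 (i j : Fin 9) (h : blk2 i ≠ blk2 j) :
    eps i ≠ eps j ∨ eta1245 i ≠ eta1245 j := by
  revert h
  fin_cases i <;> fin_cases j <;> norm_num [blk2, eps, eta1245, Fin.lt_def]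

theorem admissible_family1 (α β : ℂ) :
    Admissible (fun i => -I * mu1 α β i) blk1 (α • gam123) (β • gam123) 1 where
  lam_blk i j h := by
    revert h
    fin_cases i <;> fin_cases j <;> simp [blk1, mu1, Fin.lt_def]
  eps_blk i j h := (eps_eq_of_blk1 i j).1 h
  c_transpose := by rw [transpose_smul, gam123_transpose, smul_neg]
  d_transpose := by rw [transpose_smul, gam123_transpose, smul_neg]
  c_gam123 := by rw [smul_mul_assoc, mul_smul_comm]
  d_gam123 := by rw [smul_mul_assoc, mul_smul_comm]
  c_rot i j h := by
    rw [smul_mul_assoc, mul_smul_comm, gam123_comm_of_eps_eq ((eps_eq_of_blk1 i j).1 h)]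
  d_rot i j h := by
    rw [smul_mul_assoc, mul_smul_comm, gam123_comm_of_eps_eq ((eps_eq_of_blk1 i j).1 h)]
  pr_d := by rw [one_mul, mul_one]
  pr_rot i j h := by rw [one_mul, mul_one]
  s_pr i := by
    have hmu : mu1 α β i = α - β * eps i := by
      unfold mu1 eps
      split_ifs <;> ring
    rw [mul_one, mul_one, sMap, smul_mul_assoc, mul_smul_comm, gam_mul_gam123, smul_smul,
      ← sub_smul, ← hmu]
    congr 1
    linear_combination (mu1 α β i) * I_sq
  block_orth i j h w _ := block_orth_of_eps_ne (fun he => h ((eps_eq_of_blk1 i j).2 he)) w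

theorem Xp_transpose : Xpᵀ = Xp := by
  rw [Xp, transpose_smul, transpose_add, transpose_one, gam1245_transpose]

theorem Xm_eq : Xm = 1 - Xp := by
  rw [Xm, Xp]
  module

theorem Xm_transpose : Xmᵀ = Xm := by
  rw [Xm_eq, transpose_sub, transpose_one, Xp_transpose]

theorem Xp_gam123 : Xp * gam123 = gam123 * Xp := by
  rw [Xp, smul_mul_assoc, mul_smul_comm, add_mul, mul_add, one_mul, mul_one, gam1245_comm_gam123]

theorem Xm_gam123 : Xm * gam123 = gam123 * Xm := by
  rw [Xm_eq, sub_mul, mul_sub, one_mul, mul_one, Xp_gam123]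

theorem Xp_rot {i j : Fin 9} (h : eta1245 i = eta1245 j) :
    Xp * (gam i * gam j) = gam i * gam j * Xp := by
  rw [Xp, smul_mul_assoc, mul_smul_comm, add_mul, mul_add, one_mul, mul_one,
    gam1245_comm_of_eta_eq h]

theorem Xm_rot {i j : Fin 9} (h : eta1245 i = eta1245 j) :
    Xm * (gam i * gam j) = gam i * gam j * Xm := by
  rw [Xm_eq, sub_mul, mul_sub, one_mul, mul_one, Xp_rot h]

theorem Xp_mul_Xp : Xp * Xp = Xp := by
  simp only [Xp, smul_mul_assoc, mul_smul_comm, add_mul, mul_add, one_mul, mul_one,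
    gam1245_mul_self]
  module

theorem Xm_mul_Xp : Xm * Xp = 0 := by
  rw [Xm_eq, sub_mul, one_mul, Xp_mul_Xp, sub_self]

theorem Xp_gam {i : Fin 9} (h : eta1245 i = 1) : Xp * gam i = gam i * Xp := by
  rw [Xp, smul_mul_assoc, mul_smul_comm, add_mul, mul_add, one_mul, mul_one, gam1245_mul_gam, h,
    one_smul]

theorem Xp_gam_of_neg {i : Fin 9} (h : eta1245 i = -1) : Xp * gam i = gam i * Xm := by
  rw [Xp, Xm, smul_mul_assoc, mul_smul_comm, add_mul, mul_sub, one_mul, mul_one, gam1245_mul_gam, h,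
    neg_one_smul, sub_eq_add_neg]

theorem Xm_gam {i : Fin 9} (h : eta1245 i = 1) : Xm * gam i = gam i * Xm := by
  rw [Xm_eq, sub_mul, mul_sub, one_mul, mul_one, Xp_gam h]

theorem Xm_gam_of_neg {i : Fin 9} (h : eta1245 i = -1) : Xm * gam i = gam i * Xp := by
  rw [Xm_eq, sub_mul, Xp_gam_of_neg h, Xm_eq, mul_sub, one_mul, mul_one, sub_sub_cancel]

theorem eta1245_eq_one_or (i : Fin 9) : eta1245 i = 1 ∨ eta1245 i = -1 := by
  fin_cases i <;> simp [eta1245]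

/-- Γ_i preserves the range of X⁺ if it commutes with Γ₁₂₄₅ and maps it to that of X⁻ otherwise, so
c contributes α₊ or α₋ accordingly. The term with d contributes α'₊ with the sign of moving Γ₁₂₃
past Γ_i. -/
theorem sMap_family2 (p m q : ℂ) (i : Fin 9) :
    sMap ((p • Xp + m • Xm) * gam123) ((q • Xp) * gam123) i * Xp
      = ((if eta1245 i = 1 then p else m) - q * eps i) • (gam123 * gam i * Xp) := by
  have hd : gam i * ((q • Xp) * gam123) * Xp = (q * eps i) • (gam123 * gam i * Xp) := by
    rw [smul_mul_assoc, Xp_gam123, mul_smul_comm, smul_mul_assoc, mul_assoc, mul_assoc, Xp_mul_Xp,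
      ← mul_assoc, gam_mul_gam123, smul_mul_assoc, smul_smul]
  have hc : (p • Xp + m • Xm) * gam123 * gam i * Xp
      = (if eta1245 i = 1 then p else m) • (gam123 * gam i * Xp) := by
    simp only [add_mul, smul_mul_assoc, Xp_gam123, Xm_gam123]
    rcases eta1245_eq_one_or i with h | h
    · rw [if_pos h, mul_assoc gam123 Xp, mul_assoc gam123 Xm, Xp_gam h, Xm_gam h]
      simp only [mul_assoc, Xp_mul_Xp, Xm_mul_Xp, mul_zero, smul_zero, add_zero]
    · rw [if_neg (by rw [h]; norm_num), mul_assoc gam123 Xp, mul_assoc gam123 Xm, Xp_gam_of_neg h,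
        Xm_gam_of_neg h]
      simp only [mul_assoc, Xp_mul_Xp, Xm_mul_Xp, mul_zero, smul_zero, zero_add]
  rw [sMap, sub_mul, hc, hd, sub_smul]

theorem mu2_eq (p m q : ℂ) (i : Fin 9) :
    mu2 p m q i = (if eta1245 i = 1 then p else m) - q * eps i := by
  fin_cases i <;> norm_num [mu2, eta1245, eps, Fin.lt_def]

theorem admissible_family2 (p m q : ℂ) :
    Admissible (fun i => -I * mu2 p m q i) blk2 ((p • Xp + m • Xm) * gam123)
      ((q • Xp) * gam123) Xp where
  lam_blk i j h := by
    revert h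
    fin_cases i <;> fin_cases j <;> simp [blk2, mu2]
  eps_blk := eps_eq_of_blk2
  c_transpose := by
    simp only [transpose_mul, transpose_add, transpose_smul, Xp_transpose, Xm_transpose,
      gam123_transpose, mul_add, add_mul, mul_smul_comm, smul_mul_assoc, neg_mul, mul_neg,
      Xp_gam123, Xm_gam123, smul_neg, neg_add]
  d_transpose := by
    simp only [transpose_mul, transpose_smul, Xp_transpose, gam123_transpose, mul_smul_comm,
      smul_mul_assoc, neg_mul, mul_neg, Xp_gam123, smul_neg]
  c_gam123 := by
    simp only [add_mul, mul_add, smul_mul_assoc, mul_smul_comm, Xp_gam123, Xm_gam123, mul_assoc]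
  d_gam123 := by
    simp only [smul_mul_assoc, mul_smul_comm, Xp_gam123, mul_assoc]
  c_rot i j h := by
    have hX : (p • Xp + m • Xm) * (gam i * gam j) = gam i * gam j * (p • Xp + m • Xm) := by
      rw [add_mul, mul_add, smul_mul_assoc, smul_mul_assoc, mul_smul_comm, mul_smul_comm,
        Xp_rot (eta_eq_of_blk2 i j h), Xm_rot (eta_eq_of_blk2 i j h)]
    rw [mul_assoc, gam123_comm_of_eps_eq (eps_eq_of_blk2 i j h), ← mul_assoc, hX, mul_assoc]
  d_rot i j h := by
    rw [mul_assoc, gam123_comm_of_eps_eq (eps_eq_of_blk2 i j h), ← mul_assoc, smul_mul_assoc,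
      Xp_rot (eta_eq_of_blk2 i j h), ← mul_smul_comm, mul_assoc]
  pr_d := by
    simp only [smul_mul_assoc, mul_smul_comm, Xp_gam123, mul_assoc, Xp_mul_Xp]
    rw [← mul_assoc, Xp_gam123, mul_assoc, Xp_mul_Xp]
  pr_rot i j h := Xp_rot (eta_eq_of_blk2 i j h)
  s_pr i := by
    rw [sMap_family2, ← mu2_eq]
    congr 1
    linear_combination (mu2 p m q i) * I_sq
  block_orth i j h w hw := (eps_ne_or_eta_ne_of_blk2 i j h).elim
    (fun he => block_orth_of_eps_ne he w) fun he => block_orth_of_eta_ne he hw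

theorem admissibleData_family1 {α β : ℂ} {B : Fin 9 → ℝ}
    (hB : ∀ i, (B i : ℂ) = -(if i < 3 then (α - β) ^ 2 else (α + β) ^ 2)) :
    AdmissibleData (family1 α β B) (fun i => -I * mu1 α β i) blk1 1 where
  admissible := admissible_family1 α β
  B_eq i := by
    change (B i : ℂ) = _
    rw [hB, mul_pow, neg_sq, I_sq, mu1]
    split_ifs <;> ring
  even_eq := rfl
  mem_odd ξ := by
    simp only [mem_rangeSpinor, one_mulVec, and_true]
    rfl
  br_eq := rfl

theorem mem_chiral {ξ : SField} : ξ ∈ chiral ↔ ξ 0 ∈ rangeSpinor Xp := by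
  rw [mem_rangeSpinor]
  change clAct Xm (sigmaPlus (ξ 0)) = 0 ↔ _
  rw [sigmaPlus_apply, clAct_apply, mulVec_zero, Xm_eq, sub_mulVec, one_mulVec, ← Prod.mk_zero_zero,
    Prod.mk.injEq, sub_eq_zero, eq_comm (a := (ξ 0).2)]
  simp

theorem admissibleData_family2 {p m q : ℂ} {B : Fin 9 → ℝ}
    (hB : ∀ i, (B i : ℂ) =
      -(![(m - q) ^ 2, (m - q) ^ 2, (p - q) ^ 2, (m + q) ^ 2, (m + q) ^ 2,
        (p + q) ^ 2, (p + q) ^ 2, (p + q) ^ 2, (p + q) ^ 2] : Fin 9 → ℂ) i) :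
    AdmissibleData (family2 p m q B) (fun i => -I * mu2 p m q i) blk2 Xp where
  admissible := admissible_family2 p m q
  B_eq i := by
    change (B i : ℂ) = _
    rw [hB, mul_pow, neg_sq, I_sq, mu2]
    fin_cases i <;> simp
  even_eq := rfl
  mem_odd ξ := by
    rw [← mem_chiral]
    rfl
  br_eq := rfl

/-! ## The cubic condition in components -/

/-- The matrices `-i Γ_j` in components. -/
def gr (i : Fin 9) (w : SIdx → ℂ) : SIdx → ℂ := fun k =>
  (![sgn k.1 * sgn k.2.1 * sgn k.2.2.1 * sgn k.2.2.2 * w (1 - k.1, 1 - k.2.1, 1 - k.2.2.1, 1 - k.2.2.2),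
     sgn k.1 * sgn k.2.2.2 * w (1 - k.1, k.2.1, 1 - k.2.2.1, 1 - k.2.2.2),
     sgn k.1 * sgn k.2.2.1 * sgn k.2.2.2 * w (1 - k.1, k.2.1, k.2.2.1, 1 - k.2.2.2),
     sgn k.1 * sgn k.2.2.1 * w (1 - k.1, 1 - k.2.1, 1 - k.2.2.1, k.2.2.2),
     sgn k.1 * sgn k.2.1 * sgn k.2.2.1 * w (1 - k.1, k.2.1, 1 - k.2.2.1, k.2.2.2),
     sgn k.1 * sgn k.2.1 * w (1 - k.1, 1 - k.2.1, k.2.2.1, 1 - k.2.2.2),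
     sgn k.1 * sgn k.2.1 * sgn k.2.2.2 * w (1 - k.1, 1 - k.2.1, k.2.2.1, k.2.2.2),
     w (1 - k.1, k.2.1, k.2.2.1, k.2.2.2),
     sgn k.1 * w (k.1, k.2.1, k.2.2.1, k.2.2.2)] : Fin 9 → ℂ) i

/-- The matrix `i Γ₁₂₃` in components. -/
def gr123 (w : SIdx → ℂ) : SIdx → ℂ := fun k =>
  sgn k.1 * sgn k.2.1 * sgn k.2.2.2 * w (1 - k.1, 1 - k.2.1, k.2.2.1, 1 - k.2.2.2)

theorem gam_mulVec_eq (i : Fin 9) (w : SIdx → ℂ) : gam i *ᵥ w = I • gr i w := by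
  funext ⟨a, b, c, d⟩
  rw [gam_mulVec]
  fin_cases i <;> rfl

theorem gam123_mulVec_eq (w : SIdx → ℂ) : gam123 *ᵥ w = -I • gr123 w := by
  funext ⟨a, b, c, d⟩
  rw [gam123_mulVec]
  rfl

theorem gr_smul (i : Fin 9) (z : ℂ) (w : SIdx → ℂ) : gr i (z • w) = z • gr i w := by
  have h := mulVec_smul (gam i) z w
  rw [gam_mulVec_eq, gam_mulVec_eq, smul_comm] at h
  exact smul_right_injective _ I_ne_zero h

theorem gr123_smul (z : ℂ) (w : SIdx → ℂ) : gr123 (z • w) = z • gr123 w := by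
  have h := mulVec_smul gam123 z w
  rw [gam123_mulVec_eq, gam123_mulVec_eq, smul_comm] at h
  exact smul_right_injective _ (neg_ne_zero.2 I_ne_zero) h

/-- The form `tri` without its imaginary unit. -/
def trr (i j : Fin 9) (w : SIdx → ℂ) : ℂ := w ⬝ᵥ gr i (gr123 (gr j w))

theorem tri_eq (i j : Fin 9) (w : SIdx → ℂ) : tri i j w w = I * trr i j w := by
  simp only [tri, trr, gam_mulVec_eq, gam123_mulVec_eq, gr_smul, gr123_smul, smul_smul,
    dotProduct_smul, smul_eq_mul]
  linear_combination (-I * (w ⬝ᵥ gr i (gr123 (gr j w)))) * I_sq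

/-- The infinitesimal rotation of the cubic expression. -/
def cubicRot (mu : Fin 9 → ℂ) (blk : Fin 9 → Fin 4) (φ w : SIdx → ℂ) : SIdx → ℂ := fun k =>
  (1 / 2 : ℂ) * ∑ i, ∑ j, if i < j ∧ blk i = blk j then
    mu i * trr i j φ * gr i (gr j w) k else 0

/-- The part of the cubic expression that is due to the translations. -/
def cubicOff (mu : Fin 9 → ℂ) (ψ φ : SIdx → ℂ) : SIdx → ℂ := fun k =>
  ∑ i, mu i * ((ψ ⬝ᵥ gr123 (gr i φ)) * gr i φ k - (ψ ⬝ᵥ gr i φ) * gr123 (gr i φ) k)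

/-- Used to sum over pairs i < j only, which halves the size of the polynomials in the Fierz
identities. -/
theorem sum_sum_eq_two_mul_of_symm {E : Type*} [AddCommGroup E] [Module ℂ E] (f : Fin 9 → Fin 9 → E)
    (hd : ∀ i, f i i = 0) (hs : ∀ i j, f i j = f j i) :
    ∑ i, ∑ j, f i j = (2 : ℂ) • ∑ i, ∑ j, if i < j then f i j else 0 := by
  have h : ∀ i j, f i j = (if i < j then f i j else 0) + (if j < i then f j i else 0) := by
    intro i j
    rcases lt_trichotomy i j with h | h | h
    · simp [h, h.not_gt]
    · simp [h, hd]
    · simp [h, h.not_gt, hs i j]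
  calc ∑ i, ∑ j, f i j = ∑ i, ∑ j, ((if i < j then f i j else 0) + (if j < i then f j i else 0)) :=
        Finset.sum_congr rfl fun i _ => Finset.sum_congr rfl fun j _ => h i j
    _ = _ := by
      simp only [Finset.sum_add_distrib]
      rw [Finset.sum_comm (f := fun i j => if j < i then f j i else 0), two_smul]

theorem gam_gam_mulVec_eq (i j : Fin 9) (w : SIdx → ℂ) :
    (gam i * gam j) *ᵥ w = -gr i (gr j w) := by
  rw [← mulVec_mulVec, gam_mulVec_eq, gam_mulVec_eq, gr_smul, smul_smul, I_mul_I, neg_one_smul]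

section

variable {lam mu : Fin 9 → ℂ} {blk : Fin 9 → Fin 4} {c d Pr : Cl}

theorem rot_pol (h : Admissible lam blk c d Pr) (hmu : ∀ i, lam i = -I * mu i) {ψ : Spinor}
    (hψ : Pr *ᵥ ψ.2 = ψ.2) (w : SIdx → ℂ) :
    rot (pol lam blk ψ ψ).W *ᵥ w = I • cubicRot mu blk ψ.2 w := by
  have hm := pol_mem lam blk h.lam_blk ψ ψ
  rw [rot, sum_sum_eq_two_mul_of_symm]
  · funext k
    simp only [smul_mulVec, sum_mulVec, Pi.smul_apply, Finset.sum_apply, smul_eq_mul, cubicRot,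
      Finset.mul_sum]
    refine Finset.sum_congr rfl fun i _ => Finset.sum_congr rfl fun j _ => ?_
    by_cases hij : i < j
    · by_cases hb : blk i = blk j
      · rw [if_pos hij, if_pos ⟨hij, hb⟩, pol_self_W h hψ, tri_eq, hmu, smul_mulVec,
          gam_gam_mulVec_eq]
        simp only [Pi.smul_apply, Pi.neg_apply, smul_eq_mul]
        linear_combination (-(1 / 2) * I * mu i * trr i j ψ.2 * gr i (gr j w) k) * I_sq
      · rw [if_pos hij, if_neg (fun h => hb h.2), hm.2 i j hb]
        simp
    · rw [if_neg hij, if_neg (fun h => hij h.1)]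
      simp
  · intro i
    rw [self_eq_neg.1 (hm.1 i i), zero_smul]
  · intro i j
    by_cases hij : i = j
    · rw [hij]
    · rw [hm.1 i j, gam_anticomm hij, smul_neg, neg_smul]

/-- With one imaginary unit factored out, the remaining expression has real structure constants. The
function κ may depend on the coordinate, because in the second family c acts with α₊ or α₋ according
to the third index. -/
theorem rep_pol_fst (h : Admissible lam blk c d Pr) (hmu : ∀ i, lam i = -I * mu i) {ψ : Spinor}
    (hψ : Pr *ᵥ ψ.2 = ψ.2) {κ : SIdx → ℂ} (hκ : ∀ k, (c *ᵥ ψ.1) k = -I * (κ k * gr123 ψ.1 k))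
    (k : SIdx) : (rep lam c d (pol lam blk ψ ψ) ψ).1 k =
      I * (κ k * (ψ.2 ⬝ᵥ ψ.2) * gr123 ψ.1 k + cubicOff mu ψ.1 ψ.2 k
        + cubicRot mu blk ψ.2 ψ.1 k) := by
  have hs : ∀ i, sMap c d i *ᵥ ψ.2 = mu i • gr123 (gr i ψ.2) := by
    intro i
    rw [h.s_mulVec hψ, gam_mulVec_eq, gam123_mulVec_eq, gr123_smul, smul_smul, smul_smul, hmu]
    congr 1
    linear_combination (mu i * (I ^ 2 - 1)) * I_sq
  simp only [rep, rot_pol h hmu hψ, hs, Pi.add_apply, Pi.smul_apply, Finset.sum_apply, smul_eq_mul,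
    hκ, pol_b, pol_u, pol_v, cubicOff, gam_mulVec_eq, gam123_mulVec_eq, gr123_smul, hmu,
    dotProduct_smul, Finset.mul_sum, mul_add]
  have : ∀ A B C A' B' C' : ℂ, A = A' → B = B' → C = C' → A + B + C = A' + B' + C' := by
    rintro _ _ _ _ _ _ rfl rfl rfl
    rfl
  refine this _ _ _ _ _ _ (by ring) (Finset.sum_congr rfl fun i _ => ?_) rfl
  linear_combination (mu i * I * (I ^ 2 - 1) * (ψ.1 ⬝ᵥ gr123 (gr i ψ.2)) * gr i ψ.2 k) * I_sq

theorem rep_pol_snd (h : Admissible lam blk c d Pr) (hmu : ∀ i, lam i = -I * mu i) {ψ : Spinor}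
    (hψ : Pr *ᵥ ψ.2 = ψ.2) {κ : SIdx → ℂ} (hκ : ∀ k, (d *ᵥ ψ.2) k = -I * (κ k * gr123 ψ.2 k))
    (k : SIdx) : (rep lam c d (pol lam blk ψ ψ) ψ).2 k =
      I * (κ k * (ψ.2 ⬝ᵥ ψ.2) * gr123 ψ.2 k + cubicRot mu blk ψ.2 ψ.2 k) := by
  simp only [rep, rot_pol h hmu hψ, Pi.add_apply, Pi.smul_apply, smul_eq_mul, hκ, pol_b]
  ring

end

theorem sum_nine (f : Fin 9 → ℂ) :
    ∑ i, f i = f 0 + f 1 + f 2 + f 3 + f 4 + f 5 + f 6 + f 7 + f 8 := by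
  simp [Fin.sum_univ_succ, ← add_assoc]

theorem sgn_zero : sgn 0 = 1 := by simp [sgn]

theorem sgn_one : sgn 1 = -1 := by simp [sgn]

/-! ## Fierz identities -/

theorem forall_sIdx {p : SIdx → Prop} : (∀ k, p k) ↔ ∀ a b c d, p (a, b, c, d) := by
  simp only [Prod.forall]

section
variable (w : SIdx → ℂ) (a b c d : Fin 2)

theorem gr_0_apply : gr 0 w (a, b, c, d) =
    sgn a * sgn b * sgn c * sgn d * w (1 - a, 1 - b, 1 - c, 1 - d) := rfl

theorem gr_1_apply : gr 1 w (a, b, c, d) = sgn a * sgn d * w (1 - a, b, 1 - c, 1 - d) := rfl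

theorem gr_2_apply : gr 2 w (a, b, c, d) = sgn a * sgn c * sgn d * w (1 - a, b, c, 1 - d) := rfl

theorem gr_3_apply : gr 3 w (a, b, c, d) = sgn a * sgn c * w (1 - a, 1 - b, 1 - c, d) := rfl

theorem gr_4_apply : gr 4 w (a, b, c, d) = sgn a * sgn b * sgn c * w (1 - a, b, 1 - c, d) := rfl

theorem gr_5_apply : gr 5 w (a, b, c, d) = sgn a * sgn b * w (1 - a, 1 - b, c, 1 - d) := rfl

theorem gr_6_apply : gr 6 w (a, b, c, d) = sgn a * sgn b * sgn d * w (1 - a, 1 - b, c, d) := rfl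

theorem gr_7_apply : gr 7 w (a, b, c, d) = w (1 - a, b, c, d) := rfl

theorem gr_8_apply : gr 8 w (a, b, c, d) = sgn a * w (a, b, c, d) := rfl

theorem gr123_apply : gr123 w (a, b, c, d) =
    sgn a * sgn b * sgn d * w (1 - a, 1 - b, c, 1 - d) := rfl

end
set_option maxHeartbeats 4000000 in
set_option maxRecDepth 10000 in
-- Each of the 16 coordinates is an identity between polynomials that are cubic in the coordinates
-- of φ and linear in β; it holds only for the ratio -3 inserted here.
theorem fierz_family1_snd (β : ℂ) (φ : SIdx → ℂ) (k : SIdx) :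
    β * (φ ⬝ᵥ φ) * gr123 φ k + cubicRot (mu1 (-3 * β) β) blk1 φ φ k = 0 := by
  simp only [cubicRot, sum_nine, mu1, blk1, trr]
  simp (decide := true) only [if_true, if_false, add_zero, zero_add]
  simp only [dotProduct_eq, Fin.sum_univ_two, gr_0_apply, gr_1_apply, gr_2_apply, gr_3_apply, gr_4_apply, gr_5_apply,
    gr_6_apply, gr_7_apply, gr_8_apply, gr123_apply, sgn_zero, sgn_one, sub_self, sub_zero,
    one_mul, mul_one, mul_neg, neg_mul, neg_neg]
  revert k
  rw [forall_sIdx]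
  simp only [Fin.forall_fin_two]
  -- One goal for each of the 2⁴ coordinates.
  refine ⟨⟨⟨⟨?_, ?_⟩, ⟨?_, ?_⟩⟩, ⟨⟨?_, ?_⟩, ⟨?_, ?_⟩⟩⟩, ⟨⟨⟨?_, ?_⟩, ⟨?_, ?_⟩⟩, ⟨⟨?_, ?_⟩, ⟨?_, ?_⟩⟩⟩⟩
  all_goals simp only [gr_0_apply, gr_1_apply, gr_2_apply, gr_3_apply, gr_4_apply, gr_5_apply,
    gr_6_apply, gr_7_apply, gr_8_apply, gr123_apply, sgn_zero, sgn_one, sub_self, sub_zero,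
    one_mul, mul_one, mul_neg, neg_mul, neg_neg]
  all_goals ring1

set_option maxHeartbeats 4000000 in
set_option maxRecDepth 10000 in
-- This identity is quadratic in φ and linear in ψ. The translations now contribute as well, since
-- they map ξ₂ to the first component.
theorem fierz_family1_fst (β : ℂ) (ψ φ : SIdx → ℂ) (k : SIdx) :
    -3 * β * (φ ⬝ᵥ φ) * gr123 ψ k + cubicOff (mu1 (-3 * β) β) ψ φ k
      + cubicRot (mu1 (-3 * β) β) blk1 φ ψ k = 0 := by
  simp only [cubicRot, cubicOff, sum_nine, mu1, blk1, trr]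
  simp (decide := true) only [if_true, if_false, add_zero, zero_add]
  simp only [dotProduct_eq, Fin.sum_univ_two, gr_0_apply, gr_1_apply, gr_2_apply, gr_3_apply, gr_4_apply, gr_5_apply,
    gr_6_apply, gr_7_apply, gr_8_apply, gr123_apply, sgn_zero, sgn_one, sub_self, sub_zero,
    one_mul, mul_one, mul_neg, neg_mul, neg_neg]
  revert k
  rw [forall_sIdx]
  simp only [Fin.forall_fin_two]
  refine ⟨⟨⟨⟨?_, ?_⟩, ⟨?_, ?_⟩⟩, ⟨⟨?_, ?_⟩, ⟨?_, ?_⟩⟩⟩, ⟨⟨⟨?_, ?_⟩, ⟨?_, ?_⟩⟩, ⟨⟨?_, ?_⟩, ⟨?_, ?_⟩⟩⟩⟩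
  all_goals simp only [gr_0_apply, gr_1_apply, gr_2_apply, gr_3_apply, gr_4_apply, gr_5_apply,
    gr_6_apply, gr_7_apply, gr_8_apply, gr123_apply, sgn_zero, sgn_one, sub_self, sub_zero,
    one_mul, mul_one, mul_neg, neg_mul, neg_neg]
  all_goals ring1

set_option maxHeartbeats 4000000 in
set_option maxRecDepth 10000 in
-- The hypothesis is X⁻φ = 0 in coordinates. It makes every term carrying α₋ drop out or cancel, so
-- that α₋ remains free.
theorem fierz_family2_snd (m q : ℂ) {φ : SIdx → ℂ} (hφ : ∀ a b d, φ (a, b, 1, d) = 0) (k : SIdx) :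
    q * (φ ⬝ᵥ φ) * gr123 φ k + cubicRot (mu2 (-3 * q) m q) blk2 φ φ k = 0 := by
  simp only [cubicRot, sum_nine, mu2, blk2, trr]
  simp (decide := true) only [Matrix.cons_val, and_true, and_false,
    if_true, if_false, add_zero, zero_add]
  simp only [dotProduct_eq, Fin.sum_univ_two, gr_0_apply, gr_1_apply, gr_2_apply, gr_3_apply, gr_4_apply, gr_5_apply,
    gr_6_apply, gr_7_apply, gr_8_apply, gr123_apply, sgn_zero, sgn_one, sub_self, sub_zero,
    one_mul, mul_one, mul_neg, neg_mul, neg_neg, hφ, mul_zero, zero_mul,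
    add_zero, zero_add, neg_zero]
  revert k
  rw [forall_sIdx]
  simp only [Fin.forall_fin_two]
  refine ⟨⟨⟨⟨?_, ?_⟩, ⟨?_, ?_⟩⟩, ⟨⟨?_, ?_⟩, ⟨?_, ?_⟩⟩⟩, ⟨⟨⟨?_, ?_⟩, ⟨?_, ?_⟩⟩, ⟨⟨?_, ?_⟩, ⟨?_, ?_⟩⟩⟩⟩
  all_goals simp only [gr_0_apply, gr_1_apply, gr_2_apply, gr_3_apply, gr_4_apply, gr_5_apply,
    gr_6_apply, gr_7_apply, gr_8_apply, gr123_apply, sgn_zero, sgn_one, sub_self, sub_zero,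
    one_mul, mul_one, mul_neg, neg_mul, neg_neg, hφ, mul_zero, zero_mul,
    add_zero, zero_add, neg_zero]
  all_goals ring1

set_option maxHeartbeats 4000000 in
set_option maxRecDepth 10000 in
theorem fierz_family2_fst (m q : ℂ) (ψ : SIdx → ℂ) {φ : SIdx → ℂ}
    (hφ : ∀ a b d, φ (a, b, 1, d) = 0) (k : SIdx) :
    (if k.2.2.1 = 0 then -3 * q else m) * (φ ⬝ᵥ φ) * gr123 ψ k
      + cubicOff (mu2 (-3 * q) m q) ψ φ k + cubicRot (mu2 (-3 * q) m q) blk2 φ ψ k = 0 := by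
  simp only [cubicRot, cubicOff, sum_nine, mu2, blk2, trr]
  simp (decide := true) only [Matrix.cons_val, and_true, and_false,
    if_true, if_false, add_zero, zero_add]
  simp only [dotProduct_eq, Fin.sum_univ_two, gr_0_apply, gr_1_apply, gr_2_apply, gr_3_apply, gr_4_apply, gr_5_apply,
    gr_6_apply, gr_7_apply, gr_8_apply, gr123_apply, sgn_zero, sgn_one, sub_self, sub_zero,
    one_mul, mul_one, mul_neg, neg_mul, neg_neg, hφ, mul_zero, zero_mul,
    add_zero, zero_add, neg_zero]
  revert k
  rw [forall_sIdx]
  simp only [Fin.forall_fin_two]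
  refine ⟨⟨⟨⟨?_, ?_⟩, ⟨?_, ?_⟩⟩, ⟨⟨?_, ?_⟩, ⟨?_, ?_⟩⟩⟩, ⟨⟨⟨?_, ?_⟩, ⟨?_, ?_⟩⟩, ⟨⟨?_, ?_⟩, ⟨?_, ?_⟩⟩⟩⟩
  all_goals simp only [gr_0_apply, gr_1_apply, gr_2_apply, gr_3_apply, gr_4_apply, gr_5_apply,
    gr_6_apply, gr_7_apply, gr_8_apply, gr123_apply, sgn_zero, sgn_one, sub_self, sub_zero,
    one_mul, mul_one, mul_neg, neg_mul, neg_neg, hφ, mul_zero, zero_mul,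
    add_zero, zero_add, neg_zero, if_true, one_ne_zero, if_false]
  all_goals ring1

/-! ## The cubic condition for the two families -/

set_option maxHeartbeats 1000000 in
set_option maxRecDepth 10000 in
-- Γ₁₂₃ sends the basis spinor (0,0,0,0) to a multiple of (1,1,0,1), whence this coordinate. Of all
-- pairs inside a block only the indices 5 and 8 flip the same coordinates as Γ₁₂₃; they contribute
-- -½(α + β), which adds to -β.
theorem cubicRot_family1_single (α β : ℂ) {φ : SIdx → ℂ} (hφ : φ = Pi.single (0, 0, 0, 0) 1) :
    β * (φ ⬝ᵥ φ) * gr123 φ (1, 1, 0, 1) + cubicRot (mu1 α β) blk1 φ φ (1, 1, 0, 1)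
      = -(1 / 2) * (α + 3 * β) := by
  simp only [cubicRot, sum_nine, mu1, blk1, trr]
  simp (decide := true) only [if_true, if_false, add_zero, zero_add]
  simp only [dotProduct_eq, Fin.sum_univ_two, gr_0_apply, gr_1_apply, gr_2_apply, gr_3_apply,
    gr_4_apply, gr_5_apply, gr_6_apply, gr_7_apply, gr_8_apply, gr123_apply, sgn_zero, sgn_one,
    sub_self, sub_zero, one_mul, mul_one, mul_neg, neg_mul, neg_neg, hφ, Pi.single_apply]
  simp (decide := true) only [if_true, if_false, mul_zero, zero_mul, add_zero, zero_add, neg_zero]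
  ring

set_option maxHeartbeats 1000000 in
set_option maxRecDepth 10000 in
-- The same test spinor is admissible because its third index is 0, and the pair 5, 8 lies in the
-- block with μ = α₊ + α'₊, so α₋ does not appear.
theorem cubicRot_family2_single (p m q : ℂ) {φ : SIdx → ℂ} (hφ : φ = Pi.single (0, 0, 0, 0) 1) :
    q * (φ ⬝ᵥ φ) * gr123 φ (1, 1, 0, 1) + cubicRot (mu2 p m q) blk2 φ φ (1, 1, 0, 1)
      = -(1 / 2) * (p + 3 * q) := by
  simp only [cubicRot, sum_nine, mu2, blk2, trr]
  simp (decide := true) only [Matrix.cons_val, and_true, and_false, if_true, if_false, add_zero,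
    zero_add]
  simp only [dotProduct_eq, Fin.sum_univ_two, gr_0_apply, gr_1_apply, gr_2_apply, gr_3_apply,
    gr_4_apply, gr_5_apply, gr_6_apply, gr_7_apply, gr_8_apply, gr123_apply, sgn_zero, sgn_one,
    sub_self, sub_zero, one_mul, mul_one, mul_neg, neg_mul, neg_neg, hφ, Pi.single_apply]
  simp (decide := true) only [if_true, if_false, mul_zero, zero_mul, add_zero, zero_add, neg_zero]
  ring

theorem smul_gam123_mulVec_apply (z : ℂ) (w : SIdx → ℂ) (k : SIdx) :
    ((z • gam123) *ᵥ w) k = -I * (z * gr123 w k) := by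
  simp only [smul_mulVec, gam123_mulVec_eq, Pi.smul_apply, smul_eq_mul]
  ring

theorem Xp_Xm_gam123_mulVec_apply (p m : ℂ) (w : SIdx → ℂ) (k : SIdx) :
    (((p • Xp + m • Xm) * gam123) *ᵥ w) k
      = -I * ((if k.2.2.1 = 0 then p else m) * gr123 w k) := by
  obtain ⟨a, b, c, d⟩ := k
  rw [← mulVec_mulVec, gam123_mulVec_eq, mulVec_smul, Xm_eq]
  simp only [add_mulVec, sub_mulVec, smul_mulVec, one_mulVec, Pi.smul_apply, Pi.add_apply,
    Pi.sub_apply, Xp_mulVec, smul_eq_mul]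
  split_ifs <;> ring

theorem Xp_gam123_mulVec_apply (q : ℂ) {w : SIdx → ℂ} (hw : Xp *ᵥ w = w) (k : SIdx) :
    (((q • Xp) * gam123) *ᵥ w) k = -I * (q * gr123 w k) := by
  rw [smul_mul_assoc, Xp_gam123, ← smul_gam123_mulVec_apply, smul_mulVec, smul_mulVec,
    ← mulVec_mulVec, hw]

theorem cubic_family1_iff {α β : ℂ} {B : Fin 9 → ℝ}
    (hB : ∀ i, (B i : ℂ) = -(if i < 3 then (α - β) ^ 2 else (α + β) ^ 2)) :
    (family1 α β B).Cubic ↔ α = -3 * β := by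
  have h := admissibleData_family1 hB
  have ha := admissible_family1 α β
  rw [h.cubic_iff]
  constructor
  · intro hc
    have h1 := congrArg (fun χ : Spinor => χ.2 (1, 1, 0, 1))
      (hc (0, Pi.single (0, 0, 0, 0) 1) (one_mulVec _))
    have h2 := rep_pol_snd ha (fun i => rfl) (ψ := (0, Pi.single (0, 0, 0, 0) 1)) (one_mulVec _)
      (κ := fun _ => β) (smul_gam123_mulVec_apply β _) (1, 1, 0, 1)
    rw [cubicRot_family1_single α β rfl] at h2
    have h3 := h2.symm.trans h1
    have h4 := (mul_eq_zero.1 h3).resolve_left I_ne_zero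
    linear_combination (-2) * h4
  · rintro rfl ψ hψ
    refine Prod.ext (funext fun k => ?_) (funext fun k => ?_)
    · refine (rep_pol_fst ha (fun i => rfl) hψ (κ := fun _ => -3 * β)
        (smul_gam123_mulVec_apply _ _) k).trans ?_
      rw [fierz_family1_fst, mul_zero]
      rfl
    · refine (rep_pol_snd ha (fun i => rfl) hψ (κ := fun _ => β)
        (smul_gam123_mulVec_apply _ _) k).trans ?_
      rw [fierz_family1_snd, mul_zero]
      rfl

theorem cubic_family2_iff {p m q : ℂ} {B : Fin 9 → ℝ}
    (hB : ∀ i, (B i : ℂ) =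
      -(![(m - q) ^ 2, (m - q) ^ 2, (p - q) ^ 2, (m + q) ^ 2, (m + q) ^ 2,
        (p + q) ^ 2, (p + q) ^ 2, (p + q) ^ 2, (p + q) ^ 2] : Fin 9 → ℂ) i) :
    (family2 p m q B).Cubic ↔ p = -3 * q := by
  have h := admissibleData_family2 hB
  have ha := admissible_family2 p m q
  rw [h.cubic_iff]
  constructor
  · intro hc
    have hs : ((0, Pi.single (0, 0, 0, 0) 1) : Spinor) ∈ rangeSpinor Xp :=
      mem_rangeSpinor_Xp.2 fun a b d => by simp
    have h1 := congrArg (fun χ : Spinor => χ.2 (1, 1, 0, 1)) (hc _ hs)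
    have h2 := rep_pol_snd ha (fun i => rfl) (ψ := (0, Pi.single (0, 0, 0, 0) 1)) hs
      (κ := fun _ => q) (Xp_gam123_mulVec_apply q hs) (1, 1, 0, 1)
    rw [cubicRot_family2_single p m q rfl] at h2
    have h3 := h2.symm.trans h1
    have h4 := (mul_eq_zero.1 h3).resolve_left I_ne_zero
    linear_combination (-2) * h4
  · rintro rfl ψ hψ
    have hz := mem_rangeSpinor_Xp.1 hψ
    refine Prod.ext (funext fun k => ?_) (funext fun k => ?_)
    · refine (rep_pol_fst ha (fun i => rfl) hψ
        (κ := fun k => if k.2.2.1 = 0 then -3 * q else m)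
        (Xp_Xm_gam123_mulVec_apply _ _ _) k).trans ?_
      rw [fierz_family2_fst m q _ hz, mul_zero]
      rfl
    · refine (rep_pol_snd ha (fun i => rfl) hψ (κ := fun _ => q)
        (Xp_gam123_mulVec_apply q hψ) k).trans ?_
      rw [fierz_family2_snd m q hz, mul_zero]
      rfl

/-! ## Integrability of the parallelism equations -/

theorem pd_comm {F : Type*} [NormedAddCommGroup F] [NormedSpace ℝ F] {f : Spacetime → F}
    (hf : ContDiff ℝ ∞ f) (A E : Idx) (x : Spacetime) :
    pd A (fun y => pd E f y) x = pd E (fun y => pd A f y) x := by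
  have hd : DifferentiableAt ℝ (fderiv ℝ f) x :=
    (hf.fderiv_right (m := 1) (by norm_cast)).differentiable (by simp) x
  have hs : IsSymmSndFDerivAt ℝ f x := hf.contDiffAt.isSymmSndFDerivAt (by
    rw [minSmoothness_of_isRCLikeNormedField]
    exact WithTop.coe_le_coe.2 le_top)
  simp only [pd]
  rw [fderiv_clm_apply hd (differentiableAt_const _), fderiv_clm_apply hd (differentiableAt_const _)]
  simpa using hs (Pi.single A 1) (Pi.single E 1)

/-- Compare ∂_i∂₋ξ₁ with ∂₋∂_iξ₁ at the origin, substituting the parallelism equations for the inner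
derivatives. The potential term survives only through the derivative of B_i xⁱ. -/
theorem integrability_of_parallel {B : Fin 9 → ℝ} {c d : Cl} {ξ : SField}
    (hξ : ξ ∈ parallel B c d) (i : Fin 9) :
    (B i : ℂ) • (gam i *ᵥ (ξ 0).2) + c *ᵥ (sMap c d i *ᵥ (ξ 0).2)
      - sMap c d i *ᵥ (d *ᵥ (ξ 0).2) = 0 := by
  have hpm := pd_minus_of_parallel hξ
  have hps := pd_sp_of_parallel hξ
  have hs := hξ.1
  have hdiff : ∀ x, DifferentiableAt ℝ ξ x := hs.differentiable (by simp)
  have h1 : ∀ A y, pd A (fun y => (ξ y).1) y = (pd A ξ y).1 := fun A y =>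
    pd_clm A (ContinuousLinearMap.fst ℝ _ _) (hdiff y)
  have h2 : ∀ A y, pd A (fun y => (ξ y).2) y = (pd A ξ y).2 := fun A y =>
    pd_clm A (ContinuousLinearMap.snd ℝ _ _) (hdiff y)
  have d1 : DifferentiableAt ℝ (fun y => (ξ y).1) 0 := (hdiff 0).fst
  have d2 : DifferentiableAt ℝ (fun y => (ξ y).2) 0 := (hdiff 0).snd
  have hM : ∀ (M : Cl) {f : Spacetime → SIdx → ℂ}, DifferentiableAt ℝ f 0 →
      DifferentiableAt ℝ (fun y => M *ᵥ f y) 0 ∧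
      ∀ A, pd A (fun y => M *ᵥ f y) 0 = M *ᵥ pd A f 0 := by
    intro M f hf
    have e : ∀ w, M *ᵥ w = (mulVecCLM M).restrictScalars ℝ w := fun w => (mulVecCLM_apply M w).symm
    simp only [e]
    exact ⟨((mulVecCLM M).restrictScalars ℝ).differentiableAt.comp 0 hf, fun A => pd_clm A _ hf⟩
  have hB : ∀ j, DifferentiableAt ℝ (fun y : Spacetime => (B j * y (sp j) : ℂ)) 0 := fun j =>
    (differentiableAt_const _).mul (differentiableAt_coord_complex _)
  have hBpd : ∀ j, pd (sp i) (fun y : Spacetime => (B j * y (sp j) : ℂ)) 0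
      = if j = i then (B j : ℂ) else 0 := by
    intro j
    rw [pd_mul _ (differentiableAt_const _) (differentiableAt_coord_complex _), pd_coord_complex,
      pd_const]
    simp
  have hterm : ∀ j, DifferentiableAt ℝ
      (fun y : Spacetime => (B j * y (sp j) : ℂ) • (gam j *ᵥ (ξ y).2)) 0 := fun j =>
    (hB j).fun_smul (hM (gam j) d2).1
  have hcomm := pd_comm (hs.fst) (sp i) minus 0
  simp only [h1, hpm, hps, Prod.fst_neg] at hcomm
  rw [pd_neg, pd_add _ ((DifferentiableAt.fun_sum fun j _ => hterm j).fun_const_smul _)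
    (hM c d1).1, pd_smul _ (differentiableAt_const _) (DifferentiableAt.fun_sum fun j _ => hterm j),
    pd_sum _ _ fun j _ => hterm j, pd_smul _ (differentiableAt_const _) (hM _ d2).1, (hM c d1).2,
    (hM _ d2).2, h1, h2, hps, hpm] at hcomm
  simp only [pd_smul _ (hB _) (hM (gam _) d2).1, hBpd, pd_const, zero_smul, add_zero, ite_smul,
    Finset.sum_add_distrib, Finset.sum_ite_eq', Finset.mem_univ, if_true, Pi.zero_apply,
    Complex.ofReal_zero, mul_zero, Finset.sum_const_zero, zero_add, Prod.snd_neg, mulVec_neg,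
    mulVec_smul] at hcomm
  -- The factor -2 clears the common coefficient -½ of the two mixed derivatives.
  have h3 := congrArg ((-2 : ℂ) • ·) (sub_eq_zero.2 hcomm)
  simp only [smul_zero] at h3
  rw [← h3]
  module

/-- For Γ_i commuting with Γ₁₂₄₅, the projection X⁻ passes through the integrability condition. On
its range c acts as α₋Γ₁₂₃ and d as zero, so the condition becomes (B_i + α₋²) Γ_i X⁻ξ₂ = 0, and Γ_i
is invertible. -/
theorem Xm_mulVec_eq_zero_of_parallel {p m q : ℂ} {B : Fin 9 → ℝ} {ξ : SField}
    (hξ : ξ ∈ parallel B ((p • Xp + m • Xm) * gam123) ((q • Xp) * gam123)) {i : Fin 9}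
    (hi : eta1245 i = 1) (hk : (B i : ℂ) + m ^ 2 ≠ 0) : Xm *ᵥ (ξ 0).2 = 0 := by
  obtain ⟨c, hc⟩ : ∃ c, c = (p • Xp + m • Xm) * gam123 := ⟨_, rfl⟩
  obtain ⟨d, hd⟩ : ∃ d, d = (q • Xp) * gam123 := ⟨_, rfl⟩
  rw [← hc, ← hd] at hξ
  have hmm : Xm * Xm = Xm := by
    rw [Xm_eq, mul_sub, mul_one, sub_mul, one_mul, Xp_mul_Xp, sub_self, sub_zero]
  have hXc : Xm * c = m • (gam123 * Xm) := by
    rw [hc, ← mul_assoc, mul_add, mul_smul_comm, mul_smul_comm, Xm_mul_Xp, hmm, smul_zero, zero_add,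
      smul_mul_assoc, Xm_gam123]
  have hXd : Xm * d = 0 := by
    rw [hd, ← mul_assoc, mul_smul_comm, Xm_mul_Xp, smul_zero, zero_mul]
  have hXs : Xm * sMap c d i = m • (gam123 * gam i * Xm) := by
    rw [sMap, mul_sub, ← mul_assoc, ← mul_assoc, hXc, Xm_gam hi, mul_assoc (gam i), hXd, mul_zero,
      sub_zero, smul_mul_assoc, mul_assoc, Xm_gam hi, mul_assoc]
  have hE : Xm * ((B i : ℂ) • gam i + c * sMap c d i - sMap c d i * d)
      = ((B i : ℂ) + m ^ 2) • (gam i * Xm) := by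
    rw [mul_sub, mul_add, mul_smul_comm, ← mul_assoc, ← mul_assoc, hXc, hXs, Xm_gam hi,
      smul_mul_assoc, smul_mul_assoc, mul_assoc gam123 Xm, hXs, mul_assoc _ Xm d, hXd, mul_zero,
      smul_zero, sub_zero, mul_smul_comm, mul_assoc gam123 (gam i), ← mul_assoc gam123 gam123,
      gam123_mul_self, one_mul]
    module
  have h0 := congrArg (Xm *ᵥ ·) (integrability_of_parallel hξ i)
  have h1 : (Xm * ((B i : ℂ) • gam i + c * sMap c d i - sMap c d i * d)) *ᵥ (ξ 0).2 = 0 := by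
    rw [← mulVec_mulVec, sub_mulVec, add_mulVec, smul_mulVec, ← mulVec_mulVec, ← mulVec_mulVec]
    simpa only [mulVec_zero] using h0
  rw [hE, smul_mulVec, ← mulVec_mulVec] at h1
  have h2 := congrArg (gam i *ᵥ ·) ((smul_eq_zero.1 h1).resolve_left hk)
  simpa only [mulVec_mulVec, ← mul_assoc, gam_mul_self, neg_mul, one_mul, neg_mulVec, mulVec_zero,
    neg_eq_zero] using h2

theorem nonRestricted_family2 {m q : ℂ} {B : Fin 9 → ℝ} (h2 : (B 2 : ℂ) = -(16 * q ^ 2))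
    (h5 : (B 5 : ℂ) = -(4 * q ^ 2)) (h : ¬ (m = 0 ∧ q = 0)) :
    (family2 (-3 * q) m q B).NonRestricted := by
  intro ξ hξ
  refine ⟨hξ, ?_⟩
  change ξ ∈ chiral
  rw [mem_chiral, mem_rangeSpinor]
  have hX : Xm *ᵥ (ξ 0).2 = 0 := by
    by_cases hk : (B 2 : ℂ) + m ^ 2 = 0
    · refine Xm_mulVec_eq_zero_of_parallel hξ (i := 5) (by simp [eta1245]) fun hk' => h ?_
      rw [h2] at hk
      change (B 5 : ℂ) + m ^ 2 = 0 at hk'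
      rw [h5] at hk'
      -- The two equations are m² = 16q² and m² = 4q²; their difference is 12q² = 0.
      have hq : q = 0 := pow_eq_zero_iff two_ne_zero |>.1 (by linear_combination (hk' - hk) / 12)
      subst hq
      exact ⟨pow_eq_zero_iff two_ne_zero |>.1 (by linear_combination hk), rfl⟩
    · exact Xm_mulVec_eq_zero_of_parallel hξ (i := 2) (by simp [eta1245]) hk
  rw [Xm_eq, sub_mulVec, one_mulVec, sub_eq_zero] at hX
  exact hX.symm

/-! ### Dimension quotients and characterization of the parameters -/

theorem gam123_ne_zero : gam123 ≠ 0 := by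
  intro h
  have := gam123_mul_self
  rw [h, zero_mul] at this
  exact zero_ne_one this

theorem Xp_mul_gam123_ne_zero : Xp * gam123 ≠ 0 := by
  intro h
  have h1 : Xp = 0 := by
    rw [← mul_one Xp, ← gam123_mul_self, ← mul_assoc, h, zero_mul]
  have h2 := Xp_mulVec (fun _ => 1) 0 0 0 0
  rw [h1, zero_mulVec, if_pos rfl] at h2
  exact zero_ne_one h2

theorem family1_nu {α β : ℂ} {B : Fin 9 → ℝ}
    (hB : ∀ i, (B i : ℂ) = -(if i < 3 then (α - β) ^ 2 else (α + β) ^ 2)) :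
    (family1 α β B).nu = 1 := by
  rw [SuperData.nu, (admissibleData_family1 hB).finrank_odd, finrank_rangeSpinor_one,
    finrank_spinor]
  norm_num

theorem family2_nu {p m q : ℂ} {B : Fin 9 → ℝ}
    (hB : ∀ i, (B i : ℂ) =
      -(![(m - q) ^ 2, (m - q) ^ 2, (p - q) ^ 2, (m + q) ^ 2, (m + q) ^ 2,
        (p + q) ^ 2, (p + q) ^ 2, (p + q) ^ 2, (p + q) ^ 2] : Fin 9 → ℂ) i) :
    (family2 p m q B).nu = 3 / 4 := by
  rw [SuperData.nu, (admissibleData_family2 hB).finrank_odd, finrank_rangeSpinor_Xp,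
    finrank_spinor]
  norm_num

theorem family1_supersymmetry_iff {α β : ℂ} {B : Fin 9 → ℝ}
    (hB : ∀ i, (B i : ℂ) = -(if i < 3 then (α - β) ^ 2 else (α + β) ^ 2)) :
    ((family1 α β B).IsSupersymmetry ∧ (family1 α β B).NonRestricted ∧ (family1 α β B).nu = 1)
      ↔ α = -3 * β := by
  rw [← cubic_family1_iff hB]
  exact ⟨fun h => h.1.2, fun h => ⟨⟨(admissibleData_family1 hB).isGeometricSuperalgebra, h⟩,
    le_rfl, family1_nu hB⟩⟩

/-- Conversely, c and d determine α and β because Γ₁₂₃ is nonzero, so any such a forces α = -3a and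
β = a. -/
theorem family1_parameters_iff {α β : ℂ} {B : Fin 9 → ℝ}
    (hB : ∀ i, (B i : ℂ) = -(if i < 3 then (α - β) ^ 2 else (α + β) ^ 2)) :
    α = -3 * β ↔ ∃ a : ℂ, (∀ i, (B i : ℂ) = -4 * a ^ 2 * (if i < 3 then 4 else 1)) ∧
      (family1 α β B).c = (-3 * a) • gam123 ∧ (family1 α β B).d = a • gam123 := by
  constructor
  · rintro rfl
    refine ⟨β, fun i => ?_, rfl, rfl⟩
    rw [hB]
    split_ifs <;> ring
  · rintro ⟨a, -, hc, hd⟩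
    rw [smul_left_injective ℂ gam123_ne_zero hc, smul_left_injective ℂ gam123_ne_zero hd]

theorem family2_supersymmetry_iff {p m q : ℂ} {B : Fin 9 → ℝ}
    (hB : ∀ i, (B i : ℂ) =
      -(![(m - q) ^ 2, (m - q) ^ 2, (p - q) ^ 2, (m + q) ^ 2, (m + q) ^ 2,
        (p + q) ^ 2, (p + q) ^ 2, (p + q) ^ 2, (p + q) ^ 2] : Fin 9 → ℂ) i) :
    (family2 p m q B).IsSupersymmetry ↔ p = -3 * q := by
  rw [← cubic_family2_iff hB]
  exact ⟨fun h => h.2, fun h => ⟨(admissibleData_family2 hB).isGeometricSuperalgebra, h⟩⟩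

theorem family2_parameters_iff {p m q : ℂ} {B : Fin 9 → ℝ}
    (hB : ∀ i, (B i : ℂ) =
      -(![(m - q) ^ 2, (m - q) ^ 2, (p - q) ^ 2, (m + q) ^ 2, (m + q) ^ 2,
        (p + q) ^ 2, (p + q) ^ 2, (p + q) ^ 2, (p + q) ^ 2] : Fin 9 → ℂ) i) :
    p = -3 * q ↔ (∀ i, (B i : ℂ) =
        -(![(m - q) ^ 2, (m - q) ^ 2, 16 * q ^ 2, (m + q) ^ 2, (m + q) ^ 2,
          4 * q ^ 2, 4 * q ^ 2, 4 * q ^ 2, 4 * q ^ 2] : Fin 9 → ℂ) i) ∧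
      (family2 p m q B).c = ((-3 * q) • Xp + m • Xm) * gam123 ∧
      (family2 p m q B).d = (q • Xp) * gam123 := by
  constructor
  · rintro rfl
    refine ⟨fun i => ?_, rfl, rfl⟩
    rw [hB]
    have e1 : (-3 * q - q) ^ 2 = 16 * q ^ 2 := by ring
    have e2 : (-3 * q + q) ^ 2 = 4 * q ^ 2 := by ring
    rw [e1, e2]
  · rintro ⟨-, hc, -⟩
    have h : (p - -3 * q) • (Xp * gam123) = 0 := by
      change (p • Xp + m • Xm) * gam123 = _ at hc
      rw [add_mul, add_mul, add_left_inj, smul_mul_assoc, smul_mul_assoc] at hc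
      rw [sub_smul, hc, sub_self]
    exact sub_eq_zero.1 ((smul_eq_zero.1 h).resolve_right Xp_mul_gam123_ne_zero)

end CahenWallach

end

theorem proposition3 :
    (∀ (α β : ℂ) (B : Fin 9 → ℝ),
      (∀ i, (B i : ℂ) = -(if i < 3 then (α - β) ^ 2 else (α + β) ^ 2)) →
      ((CahenWallach.family1 α β B).Cubic ↔ α = -3 * β) ∧
      (((CahenWallach.family1 α β B).IsSupersymmetry ∧
          (CahenWallach.family1 α β B).NonRestricted ∧
          (CahenWallach.family1 α β B).nu = 1) ↔ α = -3 * β) ∧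
      (((CahenWallach.family1 α β B).IsSupersymmetry ∧
          (CahenWallach.family1 α β B).NonRestricted ∧
          (CahenWallach.family1 α β B).nu = 1) ↔
        ∃ a : ℂ,
          (∀ i, (B i : ℂ) = -4 * a ^ 2 * (if i < 3 then 4 else 1)) ∧
          (CahenWallach.family1 α β B).c = (-3 * a) • CahenWallach.gam123 ∧
          (CahenWallach.family1 α β B).d = a • CahenWallach.gam123)) ∧
    (∀ (p m q : ℂ) (B : Fin 9 → ℝ),
      (∀ i, (B i : ℂ) =
        -(![(m - q) ^ 2, (m - q) ^ 2, (p - q) ^ 2, (m + q) ^ 2, (m + q) ^ 2,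
          (p + q) ^ 2, (p + q) ^ 2, (p + q) ^ 2, (p + q) ^ 2] : Fin 9 → ℂ) i) →
      ((CahenWallach.family2 p m q B).Cubic ↔ p = -3 * q) ∧
      (((CahenWallach.family2 p m q B).IsSupersymmetry ∧
          (CahenWallach.family2 p m q B).nu = 3 / 4) ↔ p = -3 * q) ∧
      (¬ (p = 0 ∧ m = 0 ∧ q = 0) →
        (((CahenWallach.family2 p m q B).IsSupersymmetry ∧
          (CahenWallach.family2 p m q B).NonRestricted ∧
          (CahenWallach.family2 p m q B).nu = 3 / 4) ↔ p = -3 * q)) ∧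
      (p = -3 * q ↔
        (∀ i, (B i : ℂ) =
          -(![(m - q) ^ 2, (m - q) ^ 2, 16 * q ^ 2, (m + q) ^ 2, (m + q) ^ 2,
            4 * q ^ 2, 4 * q ^ 2, 4 * q ^ 2, 4 * q ^ 2] : Fin 9 → ℂ) i) ∧
        (CahenWallach.family2 p m q B).c =
          ((-3 * q) • CahenWallach.Xp + m • CahenWallach.Xm) * CahenWallach.gam123 ∧
        (CahenWallach.family2 p m q B).d =
          (q • CahenWallach.Xp) * CahenWallach.gam123)) := by
  refine ⟨fun α β B hB => ?_, fun p m q B hB => ?_⟩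
  · have h := CahenWallach.family1_supersymmetry_iff hB
    exact ⟨CahenWallach.cubic_family1_iff hB, h, h.trans (CahenWallach.family1_parameters_iff hB)⟩
  · have h := CahenWallach.family2_supersymmetry_iff hB
    have hnu := CahenWallach.family2_nu hB
    refine ⟨CahenWallach.cubic_family2_iff hB, ⟨fun hs => h.1 hs.1, fun hp => ⟨h.2 hp, hnu⟩⟩,
      fun h0 => ⟨fun hs => h.1 hs.1, fun hp => ⟨h.2 hp, ?_, hnu⟩⟩,
      CahenWallach.family2_parameters_iff hB⟩
    subst hp
    refine CahenWallach.nonRestricted_family2 ?_ ?_ fun hmq => h0 ?_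
    · rw [hB]
      simp only [Matrix.cons_val]
      ring
    · rw [hB]
      simp only [Matrix.cons_val]
      ring
    -- Since α₊ = -3α'₊, the exceptional case α₋ = α'₊ = 0 is the one in which all three parameters
    -- vanish.
    · exact ⟨by rw [hmq.2, mul_zero], hmq⟩
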